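/- **Theorem 5 (Higher-order equivalence of ETEL to EL).** Let $x_1,x_2,\dots$ be random vectors and let $g(x,\theta)\in\mathbb R^{N_g}$ be a (jointly measurable) vector of moment functions, $\theta\in\Theta\subset\mathbb R^{N_\theta}$. For a sample $x_1,\dots,x_n$ and $\theta\in\Theta$ let $\hat w^{\mathrm{EL}}(\theta)$ and $\hat w^{\mathrm{ET}}(\theta)$ be the weights $(w_1,\dots,w_n)$ that minimize, respectively, $n^{-1}\sum_{i=1}^n -\ln(nw_i)$ over $w_i>0$, and $n^{-1}\sum_{i=1}^n nw_i\ln(nw_i)$ over $w_i\ge 0$ (with $0\ln 0=0$), subject to $$\sum_{i=1}^n w_i\,g(x_i,\theta)=0,\qquad \sum_{i=1}^n w_i=1 .$$ Let $\hat\theta_{\mathrm{EL}}$ be a minimizer over $\theta\in\Theta$ of $n^{-1}\sum_i-\ln\big(n\hat w^{\mathrm{EL}}_i(\theta)\big)$ and $\hat\theta_{\mathrm{ETEL}}$ a minimizer over $\theta\in\Theta$ of $n^{-1}\sum_i-\ln\big(n\hat w^{\mathrm{ET}}_i(\theta)\big)$, whenever such minimizers exist (arbitrary otherwise); an objective counts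 as $+\infty$ at those $\theta$ at which the weights do not exist or are not all positive. Write $G(x,\theta)=\partial g(x,\theta)/\partial\theta'$, and suppose that, for some $\theta^*$ and some open neighborhood $\mathcal N$ of $\theta^*$: 1. $x_i$ forms an i.i.d. sequence; 2. $\Theta$ is compact, $\theta^*\in\operatorname{int}(\Theta)$, and $\theta^*$ is the unique solution in $\Theta$ of $E[g(x_i,\theta)]=0$; 3. for each $\theta\in\Theta$, with probability one $g(x_i,\cdot)$ is continuous at $\theta$ (as a function on $\Theta$); 4. $E[\sup_{\theta\in\Theta}\|g(x_i,\theta)\|^{2+\delta}]<\infty$ for some $\delta>0$, and $E[\sup_{\theta\in\mathcal N}\|G(x_i,\theta)\|]<\infty$; 5. $E[g(x_i,\theta^*)g(x_i,\theta^*)']$ is finite and nonsingular, and $E[G(x_i,\theta^*)]$ has rank $N_\theta$; 6. with probability one, $g(x_i,\cdot)$ is continuously differentiable on $\mathcal N$; 7. $E[\sup_{\theta\in\mathcal N}\|g(x_i,\theta)\|^4]<\infty$ and $E[\sup_{\theta\in\mathcal N}\|G(x_i,\theta)\|^2]<\infty$; 8. there is a function $b$ with $E[|b(x_i)|]<\infty$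 such that, with probability one, $\|G(x_i,\theta_1)-G(x_i,\theta_2)\|\le b(x_i)\|\theta_1-\theta_2\|$ for all $\theta_1,\theta_2\in\mathcal N$. Then $\hat\theta_{\mathrm{ETEL}}-\hat\theta_{\mathrm{EL}}=O_p(n^{-3/2})$ as $n\to\infty$, that is, for every $\varepsilon>0$ there is $C$ such that $P\big(\|\hat\theta_{\mathrm{ETEL}}-\hat\theta_{\mathrm{EL}}\|>Cn^{-3/2}\big)\le\varepsilon$ for all sufficiently large $n$. -/

import Mathlib

open MeasureTheory ProbabilityTheory Filter Topology
open scoped ENNReal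

noncomputable section

/-- `ℝ^k` with its Euclidean norm. -/
abbrev Vec (k : ℕ) : Type := EuclideanSpace ℝ (Fin k)

/-! ### Discrepancies, weights and estimators -/

/-- The empirical likelihood discrepancy `-ln t`, as a function of `t = n w`. -/
def hEL (t : ℝ) : ℝ := -Real.log t

/-- The exponential tilting discrepancy `t ln t`, as a function of `t = n w`
(with `0 ln 0 = 0`). -/
def hET (t : ℝ) : ℝ := t * Real.log t

/-- The empirical discrepancy `n⁻¹ ∑ᵢ h(n wᵢ)`. -/
def discrepancy {n : ℕ} (h : ℝ → ℝ) (w : Fin n → ℝ) : ℝ :=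
  (n : ℝ)⁻¹ * ∑ i, h (n * w i)

/-- Weights with values in `D` satisfying the moment constraint `∑ᵢ wᵢ yᵢ = 0` and the
normalization `∑ᵢ wᵢ = 1`. Here `yᵢ` stands for `g(xᵢ, θ)`, and `D` is the set on which the
discrepancy in use is defined. -/
def weightSet {n m : ℕ} (D : Set ℝ) (y : Fin n → Vec m) : Set (Fin n → ℝ) :=
  {w | (∀ i, w i ∈ D) ∧ ∑ i, w i • y i = 0 ∧ ∑ i, w i = 1}

/-- `w` solves the minimum discrepancy problem for `h`, whose domain is `D`. -/
def IsMinDiscrepancyWeights {n m : ℕ} (D : Set ℝ) (h : ℝ → ℝ) (y : Fin n → Vec m)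
    (w : Fin n → ℝ) : Prop :=
  w ∈ weightSet D y ∧ IsMinOn (discrepancy h) (weightSet D y) w

/-- The empirical likelihood weights. -/
def IsELWeights {n m : ℕ} (y : Fin n → Vec m) (w : Fin n → ℝ) : Prop :=
  IsMinDiscrepancyWeights (Set.Ioi 0) hEL y w

/-- The exponential tilting weights. -/
def IsETWeights {n m : ℕ} (y : Fin n → Vec m) (w : Fin n → ℝ) : Prop :=
  IsMinDiscrepancyWeights (Set.Ici 0) hET y w

/-- `θ` minimizes over `Θ` the discrepancy `n⁻¹ ∑ᵢ -ln(n ŵᵢ(θ))`, where `ŵ(θ)` is the solution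
of the inner problem `IsSol`. The minimum runs over the `θ` at which this objective is defined
and finite, that is, at which the inner problem has a solution with positive weights. -/
def IsLogEstimator {k m n : ℕ} (IsSol : (Fin n → Vec m) → (Fin n → ℝ) → Prop)
    (Θ : Set (Vec k)) (y : Vec k → Fin n → Vec m) (θ : Vec k) : Prop :=
  θ ∈ Θ ∧ ∃ w, IsSol (y θ) w ∧ (∀ i, 0 < w i) ∧
    ∀ θ' ∈ Θ, ∀ w', IsSol (y θ') w' → (∀ i, 0 < w' i) →
      discrepancy hEL w ≤ discrepancy hEL w'

/-- `θ` is an empirical likelihood estimate for the sample `x 0, …, x (n - 1)`. -/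
def IsELEstimate {X : Type*} {k m : ℕ} (g : X → Vec k → Vec m) (Θ : Set (Vec k))
    (n : ℕ) (x : ℕ → X) (θ : Vec k) : Prop :=
  IsLogEstimator (n := n) IsELWeights Θ (fun θ i => g (x i) θ) θ

/-- `θ` is an exponentially tilted empirical likelihood estimate for the sample
`x 0, …, x (n - 1)`. -/
def IsETELEstimate {X : Type*} {k m : ℕ} (g : X → Vec k → Vec m) (Θ : Set (Vec k))
    (n : ℕ) (x : ℕ → X) (θ : Vec k) : Prop :=
  IsLogEstimator (n := n) IsETWeights Θ (fun θ i => g (x i) θ) θ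

/-! ### Regularity conditions -/

/-- The Jacobian `G(x, θ) = ∂g(x, θ)/∂θ'`. -/
def jac {X : Type*} {k m : ℕ} (g : X → Vec k → Vec m) (x : X) (θ : Vec k) :
    Vec k →L[ℝ] Vec m :=
  fderiv ℝ (g x) θ

/-- `E[G(x, θ)]` for `x` with law `P`. -/
def meanJac {X : Type*} [MeasurableSpace X] {k m : ℕ} (P : Measure X)
    (g : X → Vec k → Vec m) (θ : Vec k) : Vec k →L[ℝ] Vec m :=
  ∫ x, jac g x θ ∂P

/-- `Ω(θ) = E[g(x, θ) g(x, θ)']` for `x` with law `P`. -/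
def momentMatrix {X : Type*} [MeasurableSpace X] {k m : ℕ} (P : Measure X)
    (g : X → Vec k → Vec m) (θ : Vec k) : Matrix (Fin m) (Fin m) ℝ :=
  Matrix.of fun a b => ∫ x, g x θ a * g x θ b ∂P

/-- The first-order regularity conditions on the moment function `g`, the parameter set `Θ`, the
true value `θs` and the neighborhood `N` of `θs`, for observations with law `P`. -/
structure Regular {X : Type*} [MeasurableSpace X] {k m : ℕ} (P : Measure X)
    (g : X → Vec k → Vec m) (Θ N : Set (Vec k)) (θs : Vec k) : Prop where
  measurable : Measurable (Function.uncurry g)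
  isCompact : IsCompact Θ
  mem_interior : θs ∈ interior Θ
  moment_eq_zero : ∫ x, g x θs ∂P = 0
  unique : ∀ θ ∈ Θ, ∫ x, g x θ ∂P = 0 → θ = θs
  continuous : ∀ θ ∈ Θ, ∀ᵐ x ∂P, ContinuousWithinAt (g x) Θ θ
  moment_bound : ∃ δ : ℝ, 0 < δ ∧ ∫⁻ x, ⨆ θ ∈ Θ, ‖g x θ‖ₑ ^ (2 + δ) ∂P < ∞
  isOpen : IsOpen N
  mem_nhd : θs ∈ N
  contDiff : ∀ᵐ x ∂P, ContDiffOn ℝ 1 (g x) N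
  jac_bound : ∫⁻ x, ⨆ θ ∈ N, ‖jac g x θ‖ₑ ∂P < ∞
  finite_var : ∀ a b, Integrable (fun x => g x θs a * g x θs b) P
  nonsingular : (momentMatrix P g θs).det ≠ 0
  rank_eq : Module.finrank ℝ (LinearMap.range (meanJac P g θs).toLinearMap) = k

/-! ### Stochastic order -/

/-- `Y n = O_p(a n)`: for every `ε > 0` there is `C` with `P(‖Y n‖ > C a n) ≤ ε` for all large
`n`. For sets that are not measurable, `μ` is the outer measure. -/
def IsBigOInProbability {Ω : Type*} [MeasurableSpace Ω] {k : ℕ} (μ : Measure Ω)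
    (Y : ℕ → Ω → Vec k) (a : ℕ → ℝ) : Prop :=
  ∀ ε : ℝ, 0 < ε → ∃ C : ℝ, ∀ᶠ n in atTop,
    μ {ω | C * a n < ‖Y n ω‖} ≤ ENNReal.ofReal ε

end

/- At the ETEL estimate, let `l` be the multiplier of the inner problem and `ν` that of the inner
first-order condition seen as a constraint of the outer problem. Both are of order
`s = n ^ (-1/2)`, and `ν - l` is of order `s ^ 2`. Written in terms of `ν`, the first-order
conditions of ETEL are those of EL up to a residual of order `s ^ 3`: the second-order terms cancel.
The linearization `(v, u) ↦ (Γ v - Ω u, Γ' u)` of the EL conditions, with `Γ = E[G]` and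
`Ω = E[g g']`, is invertible because `Γ` is injective and `Ω` is positive definite, so the two
estimates differ by `O(s ^ 3)`. -/

section AnalyticSet

variable {α : Type*} [MeasurableSpace α] {μ : Measure α} [IsFiniteMeasure μ]

lemma exists_measure_image_le_measure_image_inter_add (f : (ℕ → ℕ) → α) (B : Set (ℕ → ℕ)) (n : ℕ)
    {δ : ℝ≥0∞} (hδ : δ ≠ 0) : ∃ j : ℕ, μ (f '' B) ≤ μ (f '' (B ∩ {x | x n ≤ j})) + δ := by
  have hmono : Monotone fun j : ℕ => f '' (B ∩ {x | x n ≤ j}) := fun i j hij =>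
    Set.image_mono (Set.inter_subset_inter_right _ fun x (hx : x n ≤ i) => hx.trans hij)
  have hunion : ⋃ j : ℕ, f '' (B ∩ {x | x n ≤ j}) = f '' B := by
    rw [← Set.image_iUnion, ← Set.inter_iUnion]
    congr 1
    exact Set.inter_eq_left.2 fun x _ => Set.mem_iUnion.2 ⟨x n, le_refl (x n)⟩
  have hsup := hmono.measure_iUnion (μ := μ)
  rw [hunion] at hsup
  rcases eq_or_ne (μ (f '' B)) 0 with h0 | h0
  · exact ⟨0, by simp [h0]⟩
  have hlt : μ (f '' B) - δ < ⨆ j : ℕ, μ (f '' (B ∩ {x | x n ≤ j})) :=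
    hsup ▸ ENNReal.sub_lt_self (measure_ne_top _ _) h0 hδ
  obtain ⟨j, hj⟩ := lt_iSup_iff.1 hlt
  exact ⟨j, tsub_le_iff_right.1 hj.le⟩

lemma exists_forall_measure_range_le_measure_image_add (f : (ℕ → ℕ) → α) {ε : ℝ≥0∞}
    (hε : ε ≠ 0) :
    ∃ k : ℕ → ℕ, ∀ n, μ (Set.range f) ≤ μ (f '' {x | ∀ i < n, x i ≤ k i}) + ε := by
  obtain ⟨δ, hδ, hδε⟩ := ENNReal.exists_pos_sum_of_countable' hε ℕ
  choose J hJ using fun (B : Set (ℕ → ℕ)) (n : ℕ) =>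
    exists_measure_image_le_measure_image_inter_add (μ := μ) f B n (hδ n).ne'
  let B : ℕ → Set (ℕ → ℕ) := fun n =>
    Nat.rec Set.univ (fun n B => B ∩ {x | x n ≤ J B n}) n
  have hsucc : ∀ n, B (n + 1) = B n ∩ {x | x n ≤ J (B n) n} := fun _ => rfl
  have hbox : ∀ n, B n = {x | ∀ i < n, x i ≤ J (B i) i} := fun n => by
    induction n with
    | zero => simp [B]
    | succ n ih =>
      ext x
      have hx : x ∈ B n ↔ ∀ i < n, x i ≤ J (B i) i := Set.ext_iff.1 ih x
      simp only [hsucc, Set.mem_inter_iff, hx, Set.mem_ofPred_eq, Nat.forall_lt_succ_right]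
  have hmeas : ∀ n, μ (Set.range f) ≤ μ (f '' B n) + ∑ i ∈ Finset.range n, δ i := fun n => by
    induction n with
    | zero => simp [B]
    | succ n ih =>
      calc μ (Set.range f) ≤ μ (f '' B n) + ∑ i ∈ Finset.range n, δ i := ih
        _ ≤ μ (f '' B (n + 1)) + δ n + ∑ i ∈ Finset.range n, δ i :=
          add_le_add_left (hJ (B n) n) _
        _ = _ := by rw [Finset.sum_range_succ]; ring
  refine ⟨fun n => J (B n) n, fun n => (hmeas n).trans ?_⟩
  rw [hbox]
  gcongr
  exact (ENNReal.sum_le_tsum _).trans hδε.le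

lemma exists_setOf_forall_lt_subset_of_Iic_subset {V : Set (ℕ → ℕ)} (hV : IsOpen V) {k : ℕ → ℕ}
    (hkV : Set.Iic k ⊆ V) : ∃ n, {x : ℕ → ℕ | ∀ i < n, x i ≤ k i} ⊆ V := by
  by_contra! hcon
  choose x hx hxV using fun n => Set.not_subset.1 (hcon n)
  have hcompact : IsCompact (Set.Iic k) := Set.Icc_bot (a := k) ▸ isCompact_Icc
  obtain ⟨y, hy, φ, hφ, hlim⟩ :=
    hcompact.tendsto_subseq (x := fun n => x n ⊓ k) fun _ => Set.mem_Iic.2 inf_le_right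
  have hlim' : Tendsto (fun n => x (φ n)) atTop (𝓝 y) := by
    rw [tendsto_pi_nhds] at hlim ⊢
    intro i
    refine (hlim i).congr' ?_
    filter_upwards [hφ.tendsto_atTop.eventually_gt_atTop i] with n hn
    exact min_eq_left (hx (φ n) i hn)
  obtain ⟨n, hn⟩ := (hlim'.eventually_mem (hV.mem_nhds (hkV hy))).exists
  exact hxV _ hn

variable [TopologicalSpace α] [μ.OuterRegular] {s : Set α}

lemma exists_isCompact_subset_of_analyticSet (hs : AnalyticSet s) {ε : ℝ≥0∞} (hε : ε ≠ 0) :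
    ∃ K ⊆ s, IsCompact K ∧ μ s ≤ μ K + ε := by
  rw [AnalyticSet] at hs
  rcases hs with rfl | ⟨f, hf, rfl⟩
  · exact ⟨∅, subset_rfl, isCompact_empty, by simp⟩
  obtain ⟨k, hk⟩ := exists_forall_measure_range_le_measure_image_add (μ := μ) f hε
  have hcompact : IsCompact (Set.Iic k) := Set.Icc_bot (a := k) ▸ isCompact_Icc
  refine ⟨f '' Set.Iic k, Set.image_subset_range _ _, hcompact.image hf, ?_⟩
  -- The images of the truncated boxes may fail to be measurable, so outer regularity of `μ` has to
  -- stand in for continuity from above.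
  rw [Set.measure_eq_iInf_isOpen (f '' Set.Iic k) μ]
  simp only [ENNReal.iInf_add]
  refine le_iInf₂ fun U hU => le_iInf fun hUo => ?_
  obtain ⟨n, hn⟩ := exists_setOf_forall_lt_subset_of_Iic_subset (hUo.preimage hf)
    (Set.image_subset_iff.1 hU)
  exact (hk n).trans (add_le_add_left (measure_mono (Set.image_subset_iff.2 hn)) _)

lemma nullMeasurableSet_of_analyticSet [T2Space α] [BorelSpace α] (hs : AnalyticSet s) :
    NullMeasurableSet s μ := by
  choose K hKs hK hle using fun n : ℕ => exists_isCompact_subset_of_analyticSet (μ := μ) hs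
    (ENNReal.inv_ne_zero.2 (ENNReal.natCast_ne_top n))
  have hm : MeasurableSet (⋃ n, K n) := .iUnion fun n => (hK n).measurableSet
  refine hm.nullMeasurableSet.congr (ae_eq_of_subset_of_measure_ge (Set.iUnion_subset hKs) ?_
    hm.nullMeasurableSet (measure_ne_top _ _))
  have h : ∀ n : ℕ, μ s ≤ μ (⋃ n, K n) + (n : ℝ≥0∞)⁻¹ := fun n =>
    (hle n).trans (add_le_add_left (measure_mono (Set.subset_iUnion K n)) _)
  have hlim := tendsto_const_nhds (x := μ (⋃ n, K n)).add ENNReal.tendsto_inv_nat_nhds_zero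
  rw [add_zero] at hlim
  exact ge_of_tendsto' hlim h

end AnalyticSet

lemma aemeasurable_biSup_of_measurable_uncurry {X Y : Type*} [MeasurableSpace X]
    [StandardBorelSpace X] [MeasurableSpace Y] [StandardBorelSpace Y] {μ : Measure X}
    [IsFiniteMeasure μ] {f : X → Y → ℝ≥0∞} (hf : Measurable (Function.uncurry f)) {s : Set Y}
    (hs : MeasurableSet s) : AEMeasurable (fun x => ⨆ y ∈ s, f x y) μ := by
  let := upgradeStandardBorel X
  let : MetricSpace X := TopologicalSpace.metrizableSpaceMetric X
  refine NullMeasurable.aemeasurable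
    (measurable_of_Ioi (α := ℝ≥0∞) (δ := NullMeasurableSpace X μ) fun a => ?_)
  -- The superlevel sets of a supremum are projections of measurable sets, hence analytic.
  have hset : (fun x => ⨆ y ∈ s, f x y) ⁻¹' Set.Ioi a
      = Prod.fst '' ({p : X × Y | a < Function.uncurry f p} ∩ Prod.snd ⁻¹' s) := by
    ext x
    simp [lt_iSup_iff, and_comm]
  have hanalytic : AnalyticSet ((fun x => ⨆ y ∈ s, f x y) ⁻¹' Set.Ioi a) := by
    rw [hset]
    exact ((measurableSet_lt measurable_const hf).inter
      (measurable_snd hs)).analyticSet_image measurable_fst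
  exact nullMeasurableSet_of_analyticSet (μ := μ) hanalytic

/-- The sample average `n⁻¹ ∑ᵢ fᵢ`. It is `0` for the empty sample. -/
noncomputable def avg {n : ℕ} {E : Type*} [AddCommGroup E] [Module ℝ E] (f : Fin n → E) : E :=
  (n : ℝ)⁻¹ • ∑ i, f i

section Average

variable {n : ℕ} {E F : Type*} [NormedAddCommGroup E] [NormedSpace ℝ E]
  [NormedAddCommGroup F] [NormedSpace ℝ F]

lemma avg_add (f h : Fin n → E) : avg (fun i => f i + h i) = avg f + avg h := by
  simp [avg, Finset.sum_add_distrib]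

lemma avg_sub (f h : Fin n → E) : avg (fun i => f i - h i) = avg f - avg h := by
  simp [avg, Finset.sum_sub_distrib, smul_sub]

lemma avg_neg (f : Fin n → E) : avg (fun i => - f i) = - avg f := by
  simp [avg]

lemma avg_mul_left (c : ℝ) (f : Fin n → ℝ) : avg (fun i => c * f i) = c * avg f := by
  simp only [avg, smul_eq_mul, ← Finset.mul_sum, mul_left_comm]

lemma avg_mul_right (c : ℝ) (f : Fin n → ℝ) : avg (fun i => f i * c) = avg f * c := by
  simp only [mul_comm _ c, avg_mul_left]

lemma avg_const (hn : n ≠ 0) (c : E) : avg (fun _ : Fin n => c) = c := by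
  have hn' : (n : ℝ) ≠ 0 := Nat.cast_ne_zero.2 hn
  rw [avg, Finset.sum_const, Finset.card_univ, Fintype.card_fin, ← Nat.cast_smul_eq_nsmul ℝ,
    smul_smul, inv_mul_cancel₀ hn', one_smul]

lemma map_avg (L : E →L[ℝ] F) (f : Fin n → E) : L (avg f) = avg fun i => L (f i) := by
  simp [avg]

lemma inner_avg {m : ℕ} (v : Vec m) (f : Fin n → Vec m) :
    inner ℝ v (avg f) = avg fun i => inner ℝ v (f i) :=
  map_avg (innerSL ℝ v) f

lemma avg_apply (f : Fin n → E →L[ℝ] F) (v : E) : avg f v = avg fun i => f i v := by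
  simp [avg]

lemma avg_mono {f h : Fin n → ℝ} (hfh : ∀ i, f i ≤ h i) : avg f ≤ avg h :=
  mul_le_mul_of_nonneg_left (Finset.sum_le_sum fun i _ => hfh i) (by positivity)

lemma avg_nonneg {f : Fin n → ℝ} (hf : ∀ i, 0 ≤ f i) : 0 ≤ avg f :=
  mul_nonneg (by positivity) (Finset.sum_nonneg fun i _ => hf i)

lemma avg_pos (hn : n ≠ 0) {f : Fin n → ℝ} (hf : ∀ i, 0 < f i) : 0 < avg f := by
  have : NeZero n := ⟨hn⟩
  exact mul_pos (inv_pos.2 (Nat.cast_pos.2 (Nat.pos_of_ne_zero hn)))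
    (Finset.sum_pos (fun i _ => hf i) Finset.univ_nonempty)

lemma continuousOn_avg {Z : Type*} [TopologicalSpace Z] {f : Fin n → Z → E} {s : Set Z}
    (hf : ∀ i, ContinuousOn (f i) s) : ContinuousOn (fun z => avg fun i => f i z) s :=
  ContinuousOn.const_smul (continuousOn_finsetSum _ fun i _ => hf i) (n : ℝ)⁻¹

lemma norm_avg_le (f : Fin n → E) : ‖avg f‖ ≤ avg fun i => ‖f i‖ := by
  simp only [avg, norm_smul, smul_eq_mul, norm_inv, Real.norm_natCast]
  gcongr
  exact norm_sum_le _ _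

lemma norm_avg_le_of_le {f : Fin n → E} {h : Fin n → ℝ} (hfh : ∀ i, ‖f i‖ ≤ h i) :
    ‖avg f‖ ≤ avg h :=
  (norm_avg_le f).trans (avg_mono hfh)

lemma sum_eq_mul_avg (f : Fin n → ℝ) : ∑ i, f i = n * avg f := by
  rcases eq_or_ne n 0 with rfl | hn
  · simp
  · rw [avg, smul_eq_mul, mul_inv_cancel_left₀ (Nat.cast_ne_zero.2 hn)]

lemma le_mul_avg {f : Fin n → ℝ} (hf : ∀ i, 0 ≤ f i) (i : Fin n) : f i ≤ n * avg f := by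
  rw [← sum_eq_mul_avg]
  exact Finset.single_le_sum (fun j _ => hf j) (Finset.mem_univ i)

lemma norm_avg_le_mul {f : Fin n → E} {D : Fin n → ℝ} {c K : ℝ} (hc : 0 ≤ c)
    (hf : ∀ i, ‖f i‖ ≤ c * D i) (hD : avg D ≤ K) : ‖avg f‖ ≤ c * K :=
  (norm_avg_le_of_le hf).trans (by rw [avg_mul_left]; gcongr)

end Average

section InnerBounds

variable {E F : Type*} [NormedAddCommGroup E] [InnerProductSpace ℝ E] [NormedAddCommGroup F]
  [NormedSpace ℝ F]

lemma abs_inner_le_mul {u v : E} {a b : ℝ} (hu : ‖u‖ ≤ a) (hv : ‖v‖ ≤ b) :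
    |inner ℝ u v| ≤ a * b :=
  (abs_real_inner_le_norm u v).trans
    (mul_le_mul hu hv (norm_nonneg _) ((norm_nonneg _).trans hu))

lemma abs_inner_apply_le_mul {u : E} {G : F →L[ℝ] E} {a g : ℝ} (hu : ‖u‖ ≤ a) (hG : ‖G‖ ≤ g)
    (v : F) : |inner ℝ u (G v)| ≤ a * (g * ‖v‖) :=
  abs_inner_le_mul hu (G.le_of_opNorm_le hG v)

end InnerBounds

/-- `p n` holds with probability approaching one. As `p n` need not be measurable, this says that
the outer measure of its complement tends to zero. -/
def HoldsWPA {S : Type*} [MeasurableSpace S] (μ : Measure S) (p : ℕ → S → Prop) : Prop :=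
  Tendsto (fun n => μ {s | ¬ p n s}) atTop (𝓝 0)

section WPA

variable {S : Type*} [MeasurableSpace S] {μ : Measure S} {p q : ℕ → S → Prop}

lemma HoldsWPA.mono (hp : HoldsWPA μ p) (h : ∀ᶠ n in atTop, ∀ᵐ s ∂μ, p n s → q n s) :
    HoldsWPA μ q := by
  refine tendsto_of_tendsto_of_tendsto_of_le_of_le' tendsto_const_nhds hp
    (Eventually.of_forall fun _ => zero_le) ?_
  filter_upwards [h] with n hn
  exact measure_mono_ae (hn.mono fun s hs => mt hs)

lemma HoldsWPA.and (hp : HoldsWPA μ p) (hq : HoldsWPA μ q) :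
    HoldsWPA μ fun n s => p n s ∧ q n s := by
  have hadd := Tendsto.add hp hq
  rw [add_zero] at hadd
  refine tendsto_of_tendsto_of_tendsto_of_le_of_le tendsto_const_nhds hadd
    (fun _ => zero_le) fun n => (measure_mono fun s hs => ?_).trans (measure_union_le _ _)
  exact not_and_or.1 hs

lemma HoldsWPA.of_forall (h : ∀ n, ∀ᵐ s ∂μ, p n s) : HoldsWPA μ p :=
  tendsto_const_nhds.congr fun n => (show μ {s | ¬ p n s} = 0 from h n).symm

lemma HoldsWPA.eventually_measure_le (hp : HoldsWPA μ p) {ε : ℝ} (hε : 0 < ε) :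
    ∀ᶠ n in atTop, μ {s | ¬ p n s} ≤ ENNReal.ofReal ε :=
  hp.eventually_le_const (ENNReal.ofReal_pos.2 hε)

lemma HoldsWPA.isBigOInProbability {k m : ℕ} {Y : ℕ → S → Vec k} {Z : ℕ → S → Vec m}
    {a b : ℕ → ℝ} (hp : HoldsWPA μ p) (hZ : IsBigOInProbability μ Z a)
    (h : ∀ C, ∃ D, ∀ᶠ n in atTop, ∀ᵐ s ∂μ, p n s → ‖Z n s‖ ≤ C * a n → ‖Y n s‖ ≤ D * b n) :
    IsBigOInProbability μ Y b := by
  intro ε hε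
  obtain ⟨C, hC⟩ := hZ (ε / 2) (half_pos hε)
  obtain ⟨D, hD⟩ := h C
  refine ⟨D, ?_⟩
  filter_upwards [hC, hD, hp.eventually_measure_le (half_pos hε)] with n hCn hDn hpn
  calc μ {s | D * b n < ‖Y n s‖}
      ≤ μ ({s | ¬ p n s} ∪ {s | C * a n < ‖Z n s‖}) := by
        refine measure_mono_ae ?_
        filter_upwards [hDn] with s hs hlt
        by_contra hmem
        obtain ⟨hps, hZs⟩ := not_or.1 hmem
        exact hlt.not_ge (hs (not_not.1 hps) (not_lt.1 hZs))
    _ ≤ ENNReal.ofReal (ε / 2) + ENNReal.ofReal (ε / 2) :=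
        (measure_union_le _ _).trans (add_le_add hpn hCn)
    _ = ENNReal.ofReal ε := by
        rw [← ENNReal.ofReal_add (half_pos hε).le (half_pos hε).le, add_halves]

end WPA

section Sample

variable {S X : Type*} [MeasurableSpace S] [MeasurableSpace X] {μ : Measure S}
  {P : Measure X} {x : ℕ → S → X}

lemma ae_forall_sample (x_law : ∀ i, HasLaw (x i) P μ) {p : X → Prop} (hp : ∀ᵐ z ∂P, p z) :
    ∀ᵐ s ∂μ, ∀ i, p (x i s) :=
  ae_all_iff.2 fun i => ae_of_ae_map (x_law i).aemeasurable ((x_law i).map_eq ▸ hp)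

lemma pairwise_indepFun_comp {E : Type*} [MeasurableSpace E]
    (x_indep : Pairwise fun i j => IndepFun (x i) (x j) μ) (x_law : ∀ i, HasLaw (x i) P μ)
    {f : X → E} (hf : AEMeasurable f P) :
    Pairwise fun i j => IndepFun (fun s => f (x i s)) (fun s => f (x j s)) μ :=
  fun i j hij => (x_indep hij).comp₀ (x_law i).aemeasurable (x_law j).aemeasurable
    ((x_law i).map_eq ▸ hf) ((x_law j).map_eq ▸ hf)

lemma holdsWPA_norm_avg_sub_integral_lt [IsFiniteMeasure μ] {E : Type*} [NormedAddCommGroup E]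
    [NormedSpace ℝ E] [CompleteSpace E]
    (x_indep : Pairwise fun i j => IndepFun (x i) (x j) μ) (x_law : ∀ i, HasLaw (x i) P μ)
    {f : X → E} (hf : Integrable f P) {δ : ℝ} (hδ : 0 < δ) :
    HoldsWPA μ fun n s => ‖avg (fun i : Fin n => f (x i s)) - ∫ z, f z ∂P‖ < δ := by
  borelize E
  have hmap : ∀ i, AEStronglyMeasurable f (μ.map (x i)) := fun i => (x_law i).map_eq ▸ hf.1
  have hident : ∀ i, IdentDistrib (fun s => f (x i s)) (fun s => f (x 0 s)) μ μ := fun i =>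
    ((x_law i).identDistrib (x_law 0)).comp_of_aemeasurable (hmap i).aemeasurable
  have hint : Integrable (fun s => f (x 0 s)) μ :=
    ((x_law 0).map_eq ▸ hf).comp_aemeasurable (x_law 0).aemeasurable
  have hstrong := strong_law_ae (fun i s => f (x i s)) hint
    (pairwise_indepFun_comp x_indep x_law hf.1.aemeasurable) hident
  have havg : ∀ n : ℕ, AEStronglyMeasurable
      (fun s => (n : ℝ)⁻¹ • ∑ i ∈ Finset.range n, f (x i s)) μ := fun n =>
    (Finset.aestronglyMeasurable_fun_sum _ fun i _ =>
      (hmap i).comp_aemeasurable (x_law i).aemeasurable).const_smul _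
  have hweak := tendstoInMeasure_iff_norm.1 (tendstoInMeasure_of_tendsto_ae havg hstrong) δ hδ
  have hmean : ∫ s, f (x 0 s) ∂μ = ∫ z, f z ∂P := (x_law 0).integral_comp hf.1
  simp only [hmean] at hweak
  refine hweak.congr fun n => ?_
  simp only [avg, Finset.sum_range, not_lt]

lemma holdsWPA_avg_le [IsFiniteMeasure μ]
    (x_indep : Pairwise fun i j => IndepFun (x i) (x j) μ) (x_law : ∀ i, HasLaw (x i) P μ)
    {f : X → ℝ} (hf : Integrable f P) {c : ℝ} (hc : ∫ z, f z ∂P < c) :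
    HoldsWPA μ fun n s => avg (fun i : Fin n => f (x i s)) ≤ c := by
  refine (holdsWPA_norm_avg_sub_integral_lt x_indep x_law hf (sub_pos.2 hc)).mono
    (.of_forall fun n => .of_forall fun s hs => ?_)
  rw [Real.norm_eq_abs] at hs
  linarith [le_abs_self (avg (fun i : Fin n => f (x i s)) - ∫ z, f z ∂P)]

lemma integral_sq_avg [IsProbabilityMeasure μ]
    (x_indep : Pairwise fun i j => IndepFun (x i) (x j) μ) (x_law : ∀ i, HasLaw (x i) P μ)
    {f : X → ℝ} (hf : MemLp f 2 P) (hf0 : ∫ z, f z ∂P = 0) (n : ℕ) :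
    ∫ s, avg (fun i : Fin n => f (x i s)) ^ 2 ∂μ = (n : ℝ)⁻¹ * ∫ z, f z ^ 2 ∂P := by
  have hLp : ∀ i, MemLp (fun s => f (x i s)) 2 μ := fun i =>
    MemLp.comp_of_map ((x_law i).map_eq ▸ hf) (x_law i).aemeasurable
  have hmean : ∀ i, ∫ s, f (x i s) ∂μ = 0 := fun i => ((x_law i).integral_comp hf.1).trans hf0
  have hvar : ∀ i, variance (fun s => f (x i s)) μ = ∫ z, f z ^ 2 ∂P := fun i => by
    rw [variance_of_integral_eq_zero (hLp i).1.aemeasurable (hmean i)]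
    exact (x_law i).integral_comp (hf.1.pow 2)
  have hindep := pairwise_indepFun_comp x_indep x_law hf.1.aemeasurable
  have havg : (fun s => avg fun i : Fin n => f (x i s))
      = (n : ℝ)⁻¹ • ∑ i : Fin n, fun s => f (x i s) := by
    ext s
    simp [avg]
  have havg_mean : ∫ s, avg (fun i : Fin n => f (x i s)) ∂μ = 0 := by
    simp only [avg, integral_smul,
      integral_finsetSum _ fun (i : Fin n) _ => (hLp i).integrable one_le_two, hmean]
    simp
  calc ∫ s, avg (fun i : Fin n => f (x i s)) ^ 2 ∂μ
      = variance (fun s => avg fun i : Fin n => f (x i s)) μ := by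
        refine (variance_of_integral_eq_zero ?_ havg_mean).symm
        rw [havg]
        exact ((memLp_finsetSum' _ fun (i : Fin n) _ => hLp i).const_smul (n : ℝ)⁻¹).1.aemeasurable
    _ = (n : ℝ)⁻¹ ^ 2 * ∑ i : Fin n, variance (fun s => f (x i s)) μ := by
        rw [havg, variance_smul, IndepFun.variance_sum (fun (i : Fin n) _ => hLp i)
          fun i _ j _ hij => hindep (Fin.val_injective.ne hij)]
    _ = (n : ℝ)⁻¹ * ∫ z, f z ^ 2 ∂P := by
        simp only [hvar, Finset.sum_const, Finset.card_univ, Fintype.card_fin, nsmul_eq_mul]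
        rcases eq_or_ne (n : ℝ) 0 with hn | hn
        · simp [hn]
        · field_simp

lemma memLp_avg (x_law : ∀ i, HasLaw (x i) P μ) {E : Type*} [NormedAddCommGroup E]
    [NormedSpace ℝ E] {p : ℝ≥0∞} {f : X → E} (hf : MemLp f p P) (n : ℕ) :
    MemLp (fun s => avg fun i : Fin n => f (x i s)) p μ := by
  have hsum : MemLp (fun s => ∑ i : Fin n, f (x i s)) p μ := memLp_finsetSum _ fun i _ =>
    MemLp.comp_of_map ((x_law i).map_eq ▸ hf) (x_law i).aemeasurable
  exact hsum.const_smul (n : ℝ)⁻¹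

lemma integral_norm_sq_avg [IsProbabilityMeasure μ] {m : ℕ}
    (x_indep : Pairwise fun i j => IndepFun (x i) (x j) μ) (x_law : ∀ i, HasLaw (x i) P μ)
    {f : X → Vec m} (hf : MemLp f 2 P) (hf0 : ∫ z, f z ∂P = 0) (n : ℕ) :
    ∫ s, ‖avg fun i : Fin n => f (x i s)‖ ^ 2 ∂μ = (n : ℝ)⁻¹ * ∫ z, ‖f z‖ ^ 2 ∂P := by
  have : IsProbabilityMeasure P := (x_law 0).isProbabilityMeasure_iff.1 inferInstance
  have hcoord := hf.eval_piLp
  have hcoord0 : ∀ a, ∫ z, f z a ∂P = 0 := fun a => by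
    rw [← eval_integral_piLp fun a => (hcoord a).integrable one_le_two, hf0, PiLp.zero_apply]
  have havg : ∀ s a, (avg fun i : Fin n => f (x i s)) a = avg fun i : Fin n => f (x i s) a :=
    fun s a => map_avg (EuclideanSpace.proj a) _
  simp only [EuclideanSpace.real_norm_sq_eq, havg]
  rw [integral_finsetSum _ fun a _ => (memLp_avg x_law (hcoord a) n).integrable_sq,
    integral_finsetSum _ fun a _ => (hcoord a).integrable_sq, Finset.mul_sum]
  exact Finset.sum_congr rfl fun a _ => integral_sq_avg x_indep x_law (hcoord a) (hcoord0 a) n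

lemma isBigOInProbability_avg [IsProbabilityMeasure μ] {m : ℕ}
    (x_indep : Pairwise fun i j => IndepFun (x i) (x j) μ) (x_law : ∀ i, HasLaw (x i) P μ)
    {f : X → Vec m} (hf : MemLp f 2 P) (hf0 : ∫ z, f z ∂P = 0) :
    IsBigOInProbability μ (fun n s => avg fun i : Fin n => f (x i s)) fun n => (√n)⁻¹ := by
  intro ε hε
  set v := ∫ z, ‖f z‖ ^ 2 ∂P with hv
  have hv1 : 0 < v + 1 := add_pos_of_nonneg_of_pos (integral_nonneg fun z => sq_nonneg _) one_pos
  refine ⟨√((v + 1) / ε), (eventually_gt_atTop 0).mono fun n hn => ?_⟩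
  have hn' : (0 : ℝ) < n := Nat.cast_pos.2 hn
  set c := (v + 1) / ε * (n : ℝ)⁻¹ with hc
  have hc0 : 0 < c := mul_pos (div_pos hv1 hε) (inv_pos.2 hn')
  have hsq : (√((v + 1) / ε) * (√n)⁻¹) ^ 2 = c := by
    rw [mul_pow, inv_pow, Real.sq_sqrt (div_pos hv1 hε).le, Real.sq_sqrt hn'.le]
  have hmarkov : c * μ.real {s | c ≤ ‖avg fun i : Fin n => f (x i s)‖ ^ 2} ≤ (n : ℝ)⁻¹ * v := by
    rw [hv, ← integral_norm_sq_avg x_indep x_law hf hf0]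
    exact mul_meas_ge_le_integral_of_nonneg (.of_forall fun s => sq_nonneg _)
      ((memLp_avg x_law hf n).norm.integrable_sq) c
  have hle : μ.real {s | c ≤ ‖avg fun i : Fin n => f (x i s)‖ ^ 2} ≤ ε := by
    refine le_of_mul_le_mul_left (hmarkov.trans ?_) hc0
    rw [hc, mul_right_comm, div_mul_cancel₀ _ hε.ne', mul_comm]
    gcongr
    linarith
  refine (measure_mono fun s hs => ?_).trans (ENNReal.le_ofReal_iff_toReal_le
    (measure_ne_top _ _) hε.le |>.2 hle)
  rw [Set.mem_ofPred_eq, ← hsq]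
  exact pow_le_pow_left₀ (by positivity) (le_of_lt hs) 2

end Sample

/-- The supremum of `‖h y‖` over `y ∈ s`, used as an envelope for a family of random vectors. It
is `0` when the supremum is infinite. -/
noncomputable def supNormOn {Y E : Type*} [NormedAddCommGroup E] (h : Y → E) (s : Set Y) : ℝ :=
  (⨆ y ∈ s, ‖h y‖ₑ).toReal

section Envelope

variable {Y E : Type*} [NormedAddCommGroup E]

lemma supNormOn_nonneg (h : Y → E) (s : Set Y) : 0 ≤ supNormOn h s :=
  ENNReal.toReal_nonneg

lemma norm_le_supNormOn_of_ne_top {h : Y → E} {s : Set Y} (hfin : ⨆ y ∈ s, ‖h y‖ₑ ≠ ∞) {y : Y}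
    (hy : y ∈ s) : ‖h y‖ ≤ supNormOn h s := by
  rw [← toReal_enorm]
  exact ENNReal.toReal_mono hfin (le_iSup₂ (f := fun y (_ : y ∈ s) => ‖h y‖ₑ) y hy)

lemma biSup_enorm_le_ofReal {h : Y → E} {s : Set Y} {c : ℝ} (hc : ∀ y ∈ s, ‖h y‖ ≤ c) :
    ⨆ y ∈ s, ‖h y‖ₑ ≤ ENNReal.ofReal c :=
  iSup₂_le fun y hy => ofReal_norm (h y) ▸ ENNReal.ofReal_le_ofReal (hc y hy)

lemma norm_le_supNormOn {h : Y → E} {s : Set Y} {c : ℝ} (hc : ∀ y ∈ s, ‖h y‖ ≤ c) {y : Y}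
    (hy : y ∈ s) : ‖h y‖ ≤ supNormOn h s :=
  norm_le_supNormOn_of_ne_top
    ((biSup_enorm_le_ofReal hc).trans_lt ENNReal.ofReal_lt_top).ne hy

lemma supNormOn_le {h : Y → E} {s : Set Y} {c : ℝ} (hc0 : 0 ≤ c) (hc : ∀ y ∈ s, ‖h y‖ ≤ c) :
    supNormOn h s ≤ c :=
  ENNReal.toReal_le_of_le_ofReal hc0 (biSup_enorm_le_ofReal hc)

lemma biSup_enorm_rpow {h : Y → E} {s : Set Y} {p : ℝ} (hp : 0 < p) :
    ⨆ y ∈ s, ‖h y‖ₑ ^ p = (⨆ y ∈ s, ‖h y‖ₑ) ^ p := by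
  simpa only [ENNReal.orderIsoRpow_apply] using
    ((ENNReal.orderIsoRpow p hp).map_iSup₂ fun y (_ : y ∈ s) => ‖h y‖ₑ).symm

lemma tendsto_supNormOn_sub_ball {Y : Type*} [PseudoMetricSpace Y] {h : Y → E} {s : Set Y}
    {y₀ : Y} (hh : ContinuousWithinAt h s y₀) :
    Tendsto (fun r : ℝ => supNormOn (fun y => h y - h y₀) (s ∩ Metric.ball y₀ r)) (𝓝[>] 0)
      (𝓝 0) := by
  refine Metric.tendsto_nhdsWithin_nhds.2 fun ε hε => ?_
  obtain ⟨r, hr, hr'⟩ := Metric.continuousWithinAt_iff.1 hh (ε / 2) (half_pos hε)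
  refine ⟨r, hr, fun t _ ht => ?_⟩
  rw [Real.dist_0_eq_abs] at ht ⊢
  rw [abs_of_nonneg (supNormOn_nonneg _ _)]
  refine (supNormOn_le (half_pos hε).le fun y hy => ?_).trans_lt (half_lt_self hε)
  rw [← dist_eq_norm]
  exact (hr' hy.1 (hy.2.trans ((le_abs_self t).trans_lt ht))).le

variable {X : Type*} [MeasurableSpace X] [StandardBorelSpace X] {P : Measure X}
  [IsFiniteMeasure P] [MeasurableSpace Y] [StandardBorelSpace Y] [MeasurableSpace E]
  [OpensMeasurableSpace E] {f : X → Y → E} {s : Set Y}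

lemma aemeasurable_biSup_enorm (hf : Measurable (Function.uncurry f)) (hs : MeasurableSet s) :
    AEMeasurable (fun z => ⨆ y ∈ s, ‖f z y‖ₑ) P :=
  aemeasurable_biSup_of_measurable_uncurry (f := fun z y => ‖f z y‖ₑ) hf.enorm hs

lemma aestronglyMeasurable_supNormOn (hf : Measurable (Function.uncurry f))
    (hs : MeasurableSet s) : AEStronglyMeasurable (fun z => supNormOn (f z) s) P :=
  (aemeasurable_biSup_enorm hf hs).ennreal_toReal.aestronglyMeasurable

lemma ae_biSup_enorm_lt_top (hf : Measurable (Function.uncurry f)) (hs : MeasurableSet s) {p : ℝ}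
    (hp : 0 < p) (hfin : ∫⁻ z, ⨆ y ∈ s, ‖f z y‖ₑ ^ p ∂P < ∞) :
    ∀ᵐ z ∂P, ⨆ y ∈ s, ‖f z y‖ₑ < ∞ := by
  simp only [biSup_enorm_rpow hp] at hfin
  filter_upwards [ae_lt_top' ((aemeasurable_biSup_enorm hf hs).pow_const p) hfin.ne] with z hz
  exact (ENNReal.rpow_lt_top_iff_of_pos hp).1 hz

lemma ae_norm_le_supNormOn (hf : Measurable (Function.uncurry f)) (hs : MeasurableSet s) {p : ℝ}
    (hp : 0 < p) (hfin : ∫⁻ z, ⨆ y ∈ s, ‖f z y‖ₑ ^ p ∂P < ∞) :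
    ∀ᵐ z ∂P, ∀ y ∈ s, ‖f z y‖ ≤ supNormOn (f z) s :=
  (ae_biSup_enorm_lt_top hf hs hp hfin).mono fun _ hz _ hy =>
    norm_le_supNormOn_of_ne_top hz.ne hy

lemma memLp_supNormOn (hf : Measurable (Function.uncurry f)) (hs : MeasurableSet s) {p : ℝ}
    (hp : 0 < p) (hfin : ∫⁻ z, ⨆ y ∈ s, ‖f z y‖ₑ ^ p ∂P < ∞) :
    MemLp (fun z => supNormOn (f z) s) (ENNReal.ofReal p) P := by
  refine ⟨aestronglyMeasurable_supNormOn hf hs, ?_⟩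
  rw [eLpNorm_lt_top_iff_lintegral_rpow_enorm_lt_top (ENNReal.ofReal_pos.2 hp).ne'
    ENNReal.ofReal_ne_top, ENNReal.toReal_ofReal hp.le]
  refine (lintegral_congr_ae ?_).trans_lt hfin
  filter_upwards [ae_biSup_enorm_lt_top hf hs hp hfin] with z hz
  rw [biSup_enorm_rpow hp, supNormOn, Real.enorm_of_nonneg ENNReal.toReal_nonneg,
    ENNReal.ofReal_toReal hz.ne]

end Envelope

section Jacobian

variable {E F : Type*} [NormedAddCommGroup E] [NormedSpace ℝ E] [NormedAddCommGroup F]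
  [NormedSpace ℝ F] {f : E → F} {s : Set E}

lemma enorm_norm_sub_div_le_biSup_enorm_fderiv (hs : Convex ℝ s)
    (hf : ∀ x ∈ s, DifferentiableAt ℝ f x) {x y : E} (hx : x ∈ s) (hy : y ∈ s) :
    ‖‖f x - f y‖ / ‖x - y‖‖ₑ ≤ ⨆ z ∈ s, ‖fderiv ℝ f z‖ₑ := by
  rcases eq_or_ne (⨆ z ∈ s, ‖fderiv ℝ f z‖ₑ) ∞ with htop | htop
  · exact htop ▸ le_top
  rw [← ENNReal.ofReal_toReal htop, Real.enorm_of_nonneg (by positivity)]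
  refine ENNReal.ofReal_le_ofReal (div_le_of_le_mul₀ (norm_nonneg _) ENNReal.toReal_nonneg ?_)
  exact hs.norm_image_sub_le_of_norm_fderiv_le hf
    (fun z hz => norm_le_supNormOn_of_ne_top htop hz) hy hx

lemma norm_fderiv_le_of_norm_sub_div_le (hs : IsOpen s) {l : ℝ} (hl0 : 0 ≤ l)
    (hl : ∀ x ∈ s, ∀ y ∈ s, ‖f x - f y‖ / ‖x - y‖ ≤ l) {x : E} (hx : x ∈ s) :
    ‖fderiv ℝ f x‖ ≤ l := by
  refine norm_fderiv_le_of_lip' ℝ hl0 (mem_of_superset (hs.mem_nhds hx) fun y hy => ?_)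
  rcases eq_or_ne y x with rfl | hne
  · simp
  · exact (div_le_iff₀ (norm_pos_iff.2 (sub_ne_zero.2 hne))).1 (hl y hy x hx)

-- The envelope is built from difference quotients: their supremum over pairs of points is
-- measurable, while the Jacobian is not known to be jointly measurable.
lemma exists_memLp_jac_le {X : Type*} [MeasurableSpace X] [StandardBorelSpace X] {P : Measure X}
    [IsFiniteMeasure P] {k m : ℕ} {g : X → Vec k → Vec m} (hg : Measurable (Function.uncurry g))
    {N U : Set (Vec k)} (hN : IsOpen N) (hdiff : ∀ᵐ z ∂P, ContDiffOn ℝ 1 (g z) N) {p : ℝ}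
    (hp : 0 < p) (hfin : ∫⁻ z, ⨆ θ ∈ N, ‖jac g z θ‖ₑ ^ p ∂P < ∞) (hU : IsOpen U)
    (hUconv : Convex ℝ U) (hUN : U ⊆ N) :
    ∃ l : X → ℝ, (∀ z, 0 ≤ l z) ∧ MemLp l (ENNReal.ofReal p) P ∧
      ∀ᵐ z ∂P, ∀ θ ∈ U, ‖jac g z θ‖ ≤ l z := by
  let slope : X → Vec k × Vec k → ℝ := fun z q => ‖g z q.1 - g z q.2‖ / ‖q.1 - q.2‖
  have hslope : Measurable (Function.uncurry slope) := by
    have h₁ : Measurable fun q : X × (Vec k × Vec k) => g q.1 q.2.1 :=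
      hg.comp (measurable_fst.prodMk (measurable_fst.comp measurable_snd))
    have h₂ : Measurable fun q : X × (Vec k × Vec k) => g q.1 q.2.2 :=
      hg.comp (measurable_fst.prodMk (measurable_snd.comp measurable_snd))
    exact (h₁.sub h₂).norm.div (by fun_prop)
  have hUU : MeasurableSet (U ×ˢ U) := hU.measurableSet.prod hU.measurableSet
  have hslope_fin : ∫⁻ z, ⨆ q ∈ U ×ˢ U, ‖slope z q‖ₑ ^ p ∂P < ∞ := by
    refine (lintegral_mono_ae ?_).trans_lt hfin
    filter_upwards [hdiff] with z hz
    have hdiffU : ∀ θ ∈ U, DifferentiableAt ℝ (g z) θ := fun θ hθ =>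
      (hz.contDiffAt (hN.mem_nhds (hUN hθ))).differentiableAt one_ne_zero
    rw [biSup_enorm_rpow hp, biSup_enorm_rpow hp]
    gcongr
    exact iSup₂_le fun q hq => (enorm_norm_sub_div_le_biSup_enorm_fderiv hUconv hdiffU hq.1
      hq.2).trans (biSup_mono hUN)
  refine ⟨fun z => supNormOn (slope z) (U ×ˢ U), fun z => supNormOn_nonneg _ _,
    memLp_supNormOn hslope hUU hp hslope_fin, ?_⟩
  filter_upwards [ae_norm_le_supNormOn hslope hUU hp hslope_fin] with z hz θ hθ
  exact norm_fderiv_le_of_norm_sub_div_le hU (supNormOn_nonneg _ _)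
    (fun θ₁ h₁ θ₂ h₂ => (le_abs_self _).trans (hz (θ₁, θ₂) ⟨h₁, h₂⟩)) hθ

end Jacobian

section Separation

variable {X : Type*} [MeasurableSpace X] {P : Measure X} {k m : ℕ} {g : X → Vec k → Vec m}
  {Θ : Set (Vec k)} {e : X → ℝ}

lemma measurable_sub_apply (hg : Measurable (Function.uncurry g)) (θ₀ : Vec k) :
    Measurable (Function.uncurry fun z θ => g z θ - g z θ₀) :=
  hg.sub ((hg.comp (measurable_id.prodMk measurable_const)).comp measurable_fst)

variable [StandardBorelSpace X]

lemma tendsto_integral_supNormOn_sub_ball [IsFiniteMeasure P]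
    (hg : Measurable (Function.uncurry g)) (hΘ : MeasurableSet Θ) (he : Integrable e P)
    (hle : ∀ᵐ z ∂P, ∀ θ ∈ Θ, ‖g z θ‖ ≤ e z) {θ₀ : Vec k} (hθ₀ : θ₀ ∈ Θ)
    (hcont : ∀ᵐ z ∂P, ContinuousWithinAt (g z) Θ θ₀) :
    Tendsto (fun r : ℝ => ∫ z, supNormOn (fun θ => g z θ - g z θ₀) (Θ ∩ Metric.ball θ₀ r) ∂P)
      (𝓝[>] 0) (𝓝 0) := by
  have hdom := tendsto_integral_filter_of_dominated_convergence (μ := P) (l := 𝓝[>] (0 : ℝ))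
    (F := fun r z => supNormOn (fun θ => g z θ - g z θ₀) (Θ ∩ Metric.ball θ₀ r)) (f := 0)
    (fun z => 2 * e z) (.of_forall fun r =>
      aestronglyMeasurable_supNormOn (measurable_sub_apply hg θ₀) (hΘ.inter measurableSet_ball))
    (.of_forall fun r => ?_) (he.const_mul 2)
    (hcont.mono fun z hz => tendsto_supNormOn_sub_ball hz)
  · simpa using hdom
  · filter_upwards [hle] with z hz
    rw [Real.norm_of_nonneg (supNormOn_nonneg _ _), two_mul]
    have he0 : 0 ≤ e z := (norm_nonneg _).trans (hz θ₀ hθ₀)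
    exact supNormOn_le (add_nonneg he0 he0) fun θ hθ =>
      (norm_sub_le _ _).trans (add_le_add (hz θ hθ.1) (hz θ₀ hθ₀))

variable {S : Type*} [MeasurableSpace S] {μ : Measure S} [IsProbabilityMeasure μ] {x : ℕ → S → X}

lemma exists_nhdsWithin_holdsWPA_le_norm_avg
    (x_indep : Pairwise fun i j => IndepFun (x i) (x j) μ) (x_law : ∀ i, HasLaw (x i) P μ)
    (hg : Measurable (Function.uncurry g)) (hΘ : MeasurableSet Θ) (he : Integrable e P)
    (hle : ∀ᵐ z ∂P, ∀ θ ∈ Θ, ‖g z θ‖ ≤ e z) {θ₀ : Vec k} (hθ₀ : θ₀ ∈ Θ)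
    (hcont : ∀ᵐ z ∂P, ContinuousWithinAt (g z) Θ θ₀) (hne : ∫ z, g z θ₀ ∂P ≠ 0) :
    ∃ t ∈ 𝓝[Θ] θ₀, ∃ c : ℝ, 0 < c ∧
      HoldsWPA μ fun n s => ∀ θ ∈ t, c ≤ ‖avg fun i : Fin n => g (x i s) θ‖ := by
  have : IsProbabilityMeasure P := (x_law 0).isProbabilityMeasure_iff.1 inferInstance
  have hint : Integrable (fun z => g z θ₀) P :=
    he.mono' (hg.comp (measurable_id.prodMk measurable_const)).aestronglyMeasurable
      (hle.mono fun z hz => hz θ₀ hθ₀)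
  set M := ‖∫ z, g z θ₀ ∂P‖
  have hM4 : 0 < M / 4 := div_pos (norm_pos_iff.2 hne) four_pos
  obtain ⟨r, hosc, hr⟩ := (((tendsto_integral_supNormOn_sub_ball hg hΘ he hle hθ₀
    hcont).eventually_lt_const hM4).and self_mem_nhdsWithin).exists
  set t := Θ ∩ Metric.ball θ₀ r
  set o : X → ℝ := fun z => supNormOn (fun θ => g z θ - g z θ₀) t
  have ho_bound : ∀ᵐ z ∂P, ∀ θ ∈ t, ‖g z θ - g z θ₀‖ ≤ e z + e z :=
    hle.mono fun z hz θ hθ => (norm_sub_le _ _).trans (add_le_add (hz θ hθ.1) (hz θ₀ hθ₀))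
  have ho : Integrable o P := by
    refine (he.add he).mono' (aestronglyMeasurable_supNormOn
      (measurable_sub_apply hg θ₀) (hΘ.inter measurableSet_ball)) ?_
    filter_upwards [ho_bound, hle] with z hz hez
    have he0 : 0 ≤ e z := (norm_nonneg _).trans (hez θ₀ hθ₀)
    rw [Real.norm_of_nonneg (supNormOn_nonneg _ _)]
    exact supNormOn_le (add_nonneg he0 he0) hz
  refine ⟨t, inter_mem_nhdsWithin _ (Metric.ball_mem_nhds _ hr), M / 4, hM4, ?_⟩
  refine ((holdsWPA_avg_le x_indep x_law ho hosc).and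
    (holdsWPA_norm_avg_sub_integral_lt x_indep x_law hint hM4)).mono (.of_forall fun n => ?_)
  filter_upwards [ae_forall_sample x_law ho_bound] with s hs ⟨hosc_s, hlln⟩ θ hθ
  have hclose : ‖avg (fun i : Fin n => g (x i s) θ) - avg fun i : Fin n => g (x i s) θ₀‖
      ≤ M / 4 := by
    rw [← avg_sub]
    exact (norm_avg_le_of_le fun i => norm_le_supNormOn (hs i) hθ).trans hosc_s
  have htri₁ := norm_sub_norm_le (∫ z, g z θ₀ ∂P) (avg fun i : Fin n => g (x i s) θ₀)
  have htri₂ := norm_sub_norm_le (avg fun i : Fin n => g (x i s) θ₀)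
    (avg fun i : Fin n => g (x i s) θ)
  rw [norm_sub_rev] at htri₁ htri₂
  linarith

lemma exists_holdsWPA_le_norm_avg_of_isCompact
    (x_indep : Pairwise fun i j => IndepFun (x i) (x j) μ) (x_law : ∀ i, HasLaw (x i) P μ)
    (hg : Measurable (Function.uncurry g)) {K : Set (Vec k)} (hK : IsCompact K)
    (he : Integrable e P) (hle : ∀ᵐ z ∂P, ∀ θ ∈ K, ‖g z θ‖ ≤ e z)
    (hcont : ∀ θ ∈ K, ∀ᵐ z ∂P, ContinuousWithinAt (g z) K θ)
    (hne : ∀ θ ∈ K, ∫ z, g z θ ∂P ≠ 0) :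
    ∃ c : ℝ, 0 < c ∧
      HoldsWPA μ fun n s => ∀ θ ∈ K, c ≤ ‖avg fun i : Fin n => g (x i s) θ‖ := by
  refine hK.induction_on (p := fun t => ∃ c : ℝ, 0 < c ∧ HoldsWPA μ fun n s =>
    ∀ θ ∈ t, c ≤ ‖avg fun i : Fin n => g (x i s) θ‖) ?empty ?mono ?union ?nhds
  case empty => exact ⟨1, one_pos, .of_forall fun n => .of_forall fun s θ hθ => hθ.elim⟩
  case mono =>
    rintro t u htu ⟨c, hc, h⟩
    exact ⟨c, hc, h.mono (.of_forall fun n => .of_forall fun s hs θ hθ => hs θ (htu hθ))⟩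
  case union =>
    rintro t u ⟨c, hc, h⟩ ⟨c', hc', h'⟩
    refine ⟨min c c', lt_min hc hc', (h.and h').mono (.of_forall fun n => .of_forall ?_)⟩
    rintro s ⟨ht, hu⟩ θ (hθ | hθ)
    · exact (min_le_left _ _).trans (ht θ hθ)
    · exact (min_le_right _ _).trans (hu θ hθ)
  case nhds =>
    exact fun θ hθ => exists_nhdsWithin_holdsWPA_le_norm_avg x_indep x_law hg hK.measurableSet he
      hle hθ (hcont θ hθ) (hne θ hθ)

end Separation

/-- The average of `τ(λ'yᵢ) yᵢ`. The first-order condition of an inner problem with solution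
`tilt τ y λ` says that it vanishes. -/
noncomputable def tiltedMoment {n m : ℕ} (τ : ℝ → ℝ) (y : Fin n → Vec m) (l : Vec m) : Vec m :=
  avg fun i => τ (inner ℝ l (y i)) • y i

/-- The weights `wᵢ = τ(λ'yᵢ) / ∑ⱼ τ(λ'yⱼ)`: the inner problems of EL and ET have solutions of
this form for `τ(t) = (1 + t)⁻¹` and `τ(t) = exp(-t)`. -/
noncomputable def tilt {n m : ℕ} (τ : ℝ → ℝ) (y : Fin n → Vec m) (l : Vec m) (i : Fin n) : ℝ :=
  τ (inner ℝ l (y i)) / ∑ j, τ (inner ℝ l (y j))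

section Duality

variable {n m : ℕ} {D : Set ℝ} {h τ : ℝ → ℝ} {y : Fin n → Vec m} {l : Vec m} {w : Fin n → ℝ}

lemma inner_tiltedMoment (u : Vec m) :
    inner ℝ u (tiltedMoment τ y l) = avg fun i => τ (inner ℝ l (y i)) * inner ℝ u (y i) := by
  simp only [tiltedMoment, inner_avg, inner_smul_right]

lemma avg_mul_inner_eq_zero_of_tiltedMoment_eq_zero (h₀ : tiltedMoment τ y l = 0) (u : Vec m) :
    avg (fun i => τ (inner ℝ l (y i)) * inner ℝ u (y i)) = 0 := by
  rw [← inner_tiltedMoment, h₀, inner_zero_right]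

lemma tilt_pos (hτ : ∀ i, 0 < τ (inner ℝ l (y i))) (i : Fin n) : 0 < tilt τ y l i :=
  div_pos (hτ i) (Finset.sum_pos (fun j _ => hτ j) ⟨i, Finset.mem_univ i⟩)

lemma natCast_mul_tilt (hn : n ≠ 0) (τ : ℝ → ℝ) (y : Fin n → Vec m) (l : Vec m) (i : Fin n) :
    n * tilt τ y l i = τ (inner ℝ l (y i)) / avg fun j => τ (inner ℝ l (y j)) := by
  have hn' : (n : ℝ) ≠ 0 := Nat.cast_ne_zero.2 hn
  simp only [tilt, avg, smul_eq_mul]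
  field_simp

lemma tilt_mem_weightSet (hn : n ≠ 0) (hτ : ∀ i, 0 < τ (inner ℝ l (y i)))
    (h₀ : tiltedMoment τ y l = 0) : tilt τ y l ∈ weightSet (Set.Ioi 0) y := by
  have : NeZero n := ⟨hn⟩
  have hsum : 0 < ∑ j, τ (inner ℝ l (y j)) :=
    Finset.sum_pos (fun j _ => hτ j) Finset.univ_nonempty
  have hmoment : ∑ i, τ (inner ℝ l (y i)) • y i = 0 :=
    (smul_eq_zero.1 h₀).resolve_left (inv_ne_zero (Nat.cast_ne_zero.2 hn))
  refine ⟨tilt_pos hτ, ?_, ?_⟩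
  · simp only [tilt, div_eq_inv_mul, mul_smul, ← Finset.smul_sum, hmoment, smul_zero]
  · simp only [tilt, ← Finset.sum_div, div_self hsum.ne']

lemma discrepancy_hEL_tilt (hn : n ≠ 0) (hτ : ∀ i, 0 < τ (inner ℝ l (y i))) :
    discrepancy hEL (tilt τ y l) = Real.log (avg fun i => τ (inner ℝ l (y i)))
      - avg fun i => Real.log (τ (inner ℝ l (y i))) := by
  change (avg fun i => -Real.log (n * tilt τ y l i)) = _
  simp only [natCast_mul_tilt hn, Real.log_div (hτ _).ne' (avg_pos hn hτ).ne', neg_sub]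
  rw [avg_sub, avg_const hn]

lemma sum_mul_inner_of_mem_weightSet (hw : w ∈ weightSet D y) (l : Vec m) :
    ∑ i, w i * inner ℝ l (y i) = 0 := by
  have hinner := congrArg (inner ℝ l) hw.2.1
  simpa only [inner_sum, inner_smul_right, inner_zero_right] using hinner

lemma avg_natCast_mul_mul_inner_of_mem_weightSet (hw : w ∈ weightSet D y) (l : Vec m) :
    avg (fun i => n * w i * inner ℝ l (y i)) = 0 := by
  simp only [avg, mul_assoc, ← Finset.mul_sum, sum_mul_inner_of_mem_weightSet hw l, mul_zero,
    smul_zero]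

lemma avg_natCast_mul_of_mem_weightSet (hn : n ≠ 0) (hw : w ∈ weightSet D y) :
    avg (fun i => n * w i) = 1 := by
  simp only [avg, ← Finset.mul_sum, hw.2.2, mul_one, smul_eq_mul]
  exact inv_mul_cancel₀ (Nat.cast_ne_zero.2 hn)

open InformationTheory

lemma isMinDiscrepancyWeights_iff_eq_of_sub_eq_avg_klFun {v : Fin n → ℝ} (hv : v ∈ weightSet D y)
    {c : (Fin n → ℝ) → Fin n → ℝ} {r : (Fin n → ℝ) → Fin n → ℝ}
    (hdiff : ∀ w ∈ weightSet D y,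
      discrepancy h w - discrepancy h v = avg fun i => c w i * klFun (r w i))
    (hc : ∀ w ∈ weightSet D y, ∀ i, 0 < c w i) (hr : ∀ w ∈ weightSet D y, ∀ i, 0 ≤ r w i)
    (hrv : ∀ w ∈ weightSet D y, ∀ i, r w i = 1 → w i = v i) (w : Fin n → ℝ) :
    IsMinDiscrepancyWeights D h y w ↔ w = v := by
  have hnonneg : ∀ w ∈ weightSet D y, ∀ i, 0 ≤ c w i * klFun (r w i) := fun w hw i =>
    mul_nonneg (hc w hw i).le (klFun_nonneg (hr w hw i))
  constructor
  · rintro ⟨hw, hmin⟩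
    have hsum : ∑ i, c w i * klFun (r w i) ≤ 0 := by
      rw [sum_eq_mul_avg, ← hdiff w hw]
      exact mul_nonpos_of_nonneg_of_nonpos (Nat.cast_nonneg n)
        (sub_nonpos.2 (isMinOn_iff.1 hmin v hv))
    have hzero := (Finset.sum_eq_zero_iff_of_nonneg fun i _ => hnonneg w hw i).1
      (hsum.antisymm (Finset.sum_nonneg fun i _ => hnonneg w hw i))
    funext i
    refine hrv w hw i ((klFun_eq_zero_iff (hr w hw i)).1 ?_)
    exact (mul_eq_zero.1 (hzero i (Finset.mem_univ i))).resolve_left (hc w hw i).ne'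
  · rintro rfl
    refine ⟨hv, isMinOn_iff.2 fun u hu => sub_nonneg.1 ?_⟩
    rw [hdiff u hu]
    exact avg_nonneg (hnonneg u hu)

lemma avg_inv_one_add_inner_eq_one (hn : n ≠ 0) (hl : ∀ i, 0 < 1 + inner ℝ l (y i))
    (h₀ : tiltedMoment (fun t => (1 + t)⁻¹) y l = 0) :
    avg (fun i => (1 + inner ℝ l (y i))⁻¹) = 1 := by
  calc avg (fun i => (1 + inner ℝ l (y i))⁻¹)
      = avg (fun i => (1 + inner ℝ l (y i))⁻¹ + (1 + inner ℝ l (y i))⁻¹ * inner ℝ l (y i)) := by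
        rw [avg_add, avg_mul_inner_eq_zero_of_tiltedMoment_eq_zero h₀, add_zero]
    _ = avg fun _ : Fin n => (1 : ℝ) := by
        congr with i
        rw [← mul_one_add, inv_mul_cancel₀ (hl i).ne']
    _ = 1 := avg_const hn 1

lemma isELWeights_iff_eq_tilt (hn : n ≠ 0) (hl : ∀ i, 0 < 1 + inner ℝ l (y i))
    (h₀ : tiltedMoment (fun t => (1 + t)⁻¹) y l = 0) (w : Fin n → ℝ) :
    IsELWeights y w ↔ w = tilt (fun t => (1 + t)⁻¹) y l := by
  have hn' : (0 : ℝ) < n := Nat.cast_pos.2 (Nat.pos_of_ne_zero hn)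
  have hmem := tilt_mem_weightSet (τ := fun t => (1 + t)⁻¹) hn (fun i => inv_pos.2 (hl i)) h₀
  obtain ⟨v, hv⟩ : ∃ v, v = tilt (fun t => (1 + t)⁻¹) y l := ⟨_, rfl⟩
  rw [← hv] at hmem ⊢
  have hnv : ∀ i, n * v i = (1 + inner ℝ l (y i))⁻¹ := fun i => by
    rw [hv, natCast_mul_tilt hn, avg_inv_one_add_inner_eq_one hn hl h₀, div_one]
  have hratio_mean : ∀ u ∈ weightSet (Set.Ioi 0) y, avg (fun i => u i / v i) = 1 := fun u hu => by
    have hratio : ∀ i, u i / v i = n * u i + n * u i * inner ℝ l (y i) := fun i => by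
      rw [← mul_div_mul_left _ _ hn'.ne', hnv, div_inv_eq_mul]
      ring
    simp only [hratio]
    rw [avg_add, avg_natCast_mul_of_mem_weightSet hn hu,
      avg_natCast_mul_mul_inner_of_mem_weightSet hu, add_zero]
  refine isMinDiscrepancyWeights_iff_eq_of_sub_eq_avg_klFun (c := fun u i => u i / v i)
    (r := fun u i => v i / u i) hmem (fun u hu => ?_) (fun u hu i => div_pos (hu.1 i) (hmem.1 i))
    (fun u hu i => (div_pos (hmem.1 i) (hu.1 i)).le)
    (fun u hu i hi => ((div_eq_one_iff_eq (hu.1 i).ne').1 hi).symm) w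
  calc discrepancy hEL u - discrepancy hEL v
      = avg (fun i => hEL (n * u i) - hEL (n * v i)) + (avg (fun i => u i / v i) - 1) := by
        rw [hratio_mean u hu, sub_self, add_zero, avg_sub]
        simp only [discrepancy, avg, smul_eq_mul]
    _ = avg fun i => u i / v i * klFun (v i / u i) := by
        nth_rw 1 [← avg_const hn (1 : ℝ)]
        rw [← avg_sub, ← avg_add]
        congr 1 with i
        have hu0 : u i ≠ 0 := (hu.1 i).ne'
        have hv0 : v i ≠ 0 := (hmem.1 i).ne'
        rw [klFun_apply, hEL, hEL, Real.log_mul hn'.ne' hu0, Real.log_mul hn'.ne' hv0,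
          Real.log_div hv0 hu0]
        field_simp
        ring

lemma isETWeights_iff_eq_tilt (hn : n ≠ 0) (h₀ : tiltedMoment (fun t => Real.exp (-t)) y l = 0)
    (w : Fin n → ℝ) : IsETWeights y w ↔ w = tilt (fun t => Real.exp (-t)) y l := by
  have hn' : (0 : ℝ) < n := Nat.cast_pos.2 (Nat.pos_of_ne_zero hn)
  have hmem₀ := tilt_mem_weightSet (τ := fun t => Real.exp (-t)) hn (fun i => Real.exp_pos _) h₀
  obtain ⟨v, hv⟩ : ∃ v, v = tilt (fun t => Real.exp (-t)) y l := ⟨_, rfl⟩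
  rw [← hv] at hmem₀ ⊢
  have hvpos : ∀ i, 0 < v i := hmem₀.1
  have hmem : v ∈ weightSet (Set.Ici 0) y := ⟨fun i => (hvpos i).le, hmem₀.2⟩
  set M := avg fun j => Real.exp (-inner ℝ l (y j)) with hM
  have hM0 : 0 < M := avg_pos hn fun _ => Real.exp_pos _
  have hlogv : ∀ i, Real.log (n * v i) = -inner ℝ l (y i) - Real.log M := fun i => by
    rw [hv, natCast_mul_tilt hn, ← hM, Real.log_div (Real.exp_pos _).ne' hM0.ne', Real.log_exp]
  have hcross : ∀ u ∈ weightSet (Set.Ici 0) y,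
      avg (fun i => n * u i * Real.log (n * v i)) = -Real.log M := fun u hu => by
    simp only [hlogv, mul_sub, mul_neg]
    rw [avg_sub, avg_neg, avg_natCast_mul_mul_inner_of_mem_weightSet hu, avg_mul_right,
      avg_natCast_mul_of_mem_weightSet hn hu, neg_zero, zero_sub, one_mul]
  refine isMinDiscrepancyWeights_iff_eq_of_sub_eq_avg_klFun (c := fun _ i => n * v i)
    (r := fun u i => u i / v i) hmem (fun u hu => ?_) (fun _ _ i => mul_pos hn' (hvpos i))
    (fun u hu i => div_nonneg (hu.1 i) (hvpos i).le)
    (fun u _ i hi => (div_eq_one_iff_eq (hvpos i).ne').1 hi) w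
  calc discrepancy hET u - discrepancy hET v
      = avg (fun i => n * u i * Real.log (n * u i)) - avg (fun i => n * u i * Real.log (n * v i))
          + (avg (fun i => n * v i) - avg fun i => n * u i) := by
        rw [hcross u hu, ← hcross v hmem, avg_natCast_mul_of_mem_weightSet hn hu,
          avg_natCast_mul_of_mem_weightSet hn hmem, sub_self, add_zero]
        simp only [discrepancy, hET, avg, smul_eq_mul]
    _ = avg fun i => n * v i * klFun (u i / v i) := by
        rw [← avg_sub, ← avg_sub, ← avg_add]
        congr 1 with i
        have hv0 : v i ≠ 0 := (hvpos i).ne'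
        rcases (show 0 ≤ u i from hu.1 i).eq_or_lt with hu0 | hu0
        · simp [← hu0, klFun_zero]
        · rw [klFun_apply, Real.log_mul hn'.ne' hu0.ne', Real.log_mul hn'.ne' hv0,
            Real.log_div hu0.ne' hv0]
          field_simp
          ring

end Duality

/-- The common structure of the empirical likelihood and exponential tilting problems: the
solution of the inner problem has the form `tilt τ y λ`, where `-τ` is the derivative of the dual
criterion `T`. -/
structure IsTilting (m : ℕ) (IsSol : ∀ {n : ℕ}, (Fin n → Vec m) → (Fin n → ℝ) → Prop)
    (τ T : ℝ → ℝ) : Prop where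
  hasDerivAt : ∀ t, |t| < 1 → HasDerivAt T (-τ t) t
  growth : ∀ t, |t| ≤ 1 / 8 → T 0 - t + t ^ 2 / 4 ≤ T t
  pos : ∀ t, |t| < 1 → 0 < τ t
  continuousOn : ContinuousOn τ (Set.Ioo (-1) 1)
  mem_weightSet : ∀ {n : ℕ} {y : Fin n → Vec m} {w : Fin n → ℝ}, IsSol y w → (∀ i, 0 < w i) →
    w ∈ weightSet (Set.Ioi 0) y
  isSol_iff : ∀ {n : ℕ} {y : Fin n → Vec m} {l : Vec m}, n ≠ 0 → (∀ i, |inner ℝ l (y i)| < 1) →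
    tiltedMoment τ y l = 0 → ∀ w, IsSol y w ↔ w = tilt τ y l
  discrepancy_le : ∀ {n : ℕ} {y : Fin n → Vec m} {l : Vec m}, n ≠ 0 →
    (∀ i, |inner ℝ l (y i)| < 1) → tiltedMoment τ y l = 0 →
    discrepancy hEL (tilt τ y l) ≤ inner ℝ l (avg y)

section Tilting

variable {n m : ℕ} {y : Fin n → Vec m} {l : Vec m}

lemma one_add_pos_of_abs_lt_one {t : ℝ} (ht : |t| < 1) : 0 < 1 + t :=
  neg_lt_iff_pos_add'.1 (abs_lt.1 ht).1

lemma one_sub_add_sq_div_le_exp_neg {t : ℝ} (ht : |t| ≤ 1 / 8) :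
    1 - t + t ^ 2 / 4 ≤ Real.exp (-t) := by
  have htaylor := Real.exp_bound (x := -t) (by rw [abs_neg]; linarith) (n := 3) (by norm_num)
  simp only [Finset.sum_range_succ, Finset.sum_range_zero, abs_neg] at htaylor
  have hcube : |t| ^ 3 ≤ t ^ 2 / 8 := by
    rw [← sq_abs t]
    nlinarith [mul_nonneg (sq_nonneg |t|) (sub_nonneg.2 ht)]
  have hlower := (abs_le.1 htaylor).1
  norm_num [Nat.factorial] at hlower
  nlinarith [sq_nonneg t]

lemma neg_add_sq_div_le_neg_log_one_add {t : ℝ} (ht : |t| ≤ 1 / 8) :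
    -t + t ^ 2 / 4 ≤ -Real.log (1 + t) := by
  have htaylor := Real.abs_log_sub_add_sum_range_le (x := -t) (by rw [abs_neg]; linarith) 2
  simp only [Finset.sum_range_succ, Finset.sum_range_zero, sub_neg_eq_add, abs_neg] at htaylor
  have hcube : |t| ^ (2 + 1) / (1 - |t|) ≤ t ^ 2 / 4 := by
    rw [div_le_iff₀ (by linarith), ← sq_abs t]
    nlinarith [mul_nonneg (sq_nonneg |t|) (sub_nonneg.2 ht)]
  have hlower := (abs_le.1 (htaylor.trans hcube)).2
  norm_num at hlower
  linarith

lemma discrepancy_hEL_tilt_inv_one_add (hn : n ≠ 0) (hl : ∀ i, 0 < 1 + inner ℝ l (y i))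
    (h₀ : tiltedMoment (fun t => (1 + t)⁻¹) y l = 0) :
    discrepancy hEL (tilt (fun t => (1 + t)⁻¹) y l)
      = avg fun i => Real.log (1 + inner ℝ l (y i)) := by
  rw [discrepancy_hEL_tilt (τ := fun t => (1 + t)⁻¹) hn fun i => inv_pos.2 (hl i)]
  simp only [avg_inv_one_add_inner_eq_one hn hl h₀, Real.log_inv, avg_neg, Real.log_one, zero_sub,
    neg_neg]

lemma discrepancy_hEL_tilt_exp_neg (hn : n ≠ 0) (y : Fin n → Vec m) (l : Vec m) :
    discrepancy hEL (tilt (fun t => Real.exp (-t)) y l)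
      = inner ℝ l (avg y) + Real.log (avg fun i => Real.exp (-inner ℝ l (y i))) := by
  rw [discrepancy_hEL_tilt (τ := fun t => Real.exp (-t)) hn fun i => Real.exp_pos _, inner_avg]
  simp only [Real.log_exp, avg_neg, sub_neg_eq_add, add_comm]

lemma avg_exp_neg_inner_le_one (hn : n ≠ 0)
    (h₀ : tiltedMoment (fun t => Real.exp (-t)) y l = 0) :
    avg (fun i => Real.exp (-inner ℝ l (y i))) ≤ 1 := by
  calc avg (fun i => Real.exp (-inner ℝ l (y i)))
      ≤ avg fun i => 1 - Real.exp (-inner ℝ l (y i)) * inner ℝ l (y i) := by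
        refine avg_mono fun i => ?_
        have hmul := mul_le_mul_of_nonneg_left (Real.add_one_le_exp (inner ℝ l (y i)))
          (Real.exp_pos (-inner ℝ l (y i))).le
        rw [← Real.exp_add, neg_add_cancel, Real.exp_zero] at hmul
        linarith
    _ = 1 := by
        rw [avg_sub, avg_const hn, avg_mul_inner_eq_zero_of_tiltedMoment_eq_zero h₀, sub_zero]

lemma isTilting_EL (m : ℕ) : IsTilting m (fun {_} => IsELWeights) (fun t => (1 + t)⁻¹)
    (fun t => -Real.log (1 + t)) where
  hasDerivAt t ht := by
    simpa using (((hasDerivAt_id t).const_add 1).log (one_add_pos_of_abs_lt_one ht).ne').fun_neg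
  growth t ht := by simpa using neg_add_sq_div_le_neg_log_one_add ht
  pos t ht := inv_pos.2 (one_add_pos_of_abs_lt_one ht)
  continuousOn := ContinuousOn.inv₀ (by fun_prop) fun t ht =>
    (one_add_pos_of_abs_lt_one (abs_lt.2 ht)).ne'
  mem_weightSet hw _ := hw.1
  isSol_iff hn hl := isELWeights_iff_eq_tilt hn fun i => one_add_pos_of_abs_lt_one (hl i)
  discrepancy_le hn hl h₀ := by
    have hpos := fun i => one_add_pos_of_abs_lt_one (hl i)
    rw [discrepancy_hEL_tilt_inv_one_add hn hpos h₀, inner_avg]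
    exact avg_mono fun i => by linarith [Real.log_le_sub_one_of_pos (hpos i)]

lemma isTilting_ET (m : ℕ) : IsTilting m (fun {_} => IsETWeights) (fun t => Real.exp (-t))
    (fun t => Real.exp (-t)) where
  hasDerivAt t _ := by simpa using (hasDerivAt_neg t).exp
  growth t ht := by simpa using one_sub_add_sq_div_le_exp_neg ht
  pos t _ := Real.exp_pos _
  continuousOn := by fun_prop
  mem_weightSet hw hpos := ⟨hpos, hw.1.2⟩
  isSol_iff hn _ := isETWeights_iff_eq_tilt hn
  discrepancy_le {n y l} hn _ h₀ := by
    rw [discrepancy_hEL_tilt_exp_neg hn, add_le_iff_nonpos_right]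
    exact Real.log_nonpos (avg_nonneg fun i => (Real.exp_pos _).le)
      (avg_exp_neg_inner_le_one hn h₀)

variable {IsSol : ∀ {n : ℕ}, (Fin n → Vec m) → (Fin n → ℝ) → Prop} {τ T : ℝ → ℝ} {r c : ℝ}

lemma abs_inner_lt_one {l v : Vec m} (hl : ‖l‖ ≤ r) (hv : r * ‖v‖ ≤ 1 / 8) :
    |inner ℝ l v| < 1 :=
  ((abs_inner_le_mul hl le_rfl).trans hv).trans_lt (by norm_num)

lemma IsTilting.hasFDerivAt_dual (hT : IsTilting m IsSol τ T)
    (hl : ∀ i, |inner ℝ l (y i)| < 1) :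
    HasFDerivAt (fun l => avg fun i => T (inner ℝ l (y i)))
      (-innerSL ℝ (tiltedMoment τ y l)) l := by
  have hinner : ∀ i, HasFDerivAt (fun l : Vec m => inner ℝ l (y i)) (innerSL ℝ (y i)) l := fun i =>
    (innerSL ℝ (y i)).hasFDerivAt.congr_of_eventuallyEq (.of_forall fun l => real_inner_comm _ _)
  have hsum : HasFDerivAt (fun l => avg fun i => T (inner ℝ l (y i)))
      ((n : ℝ)⁻¹ • ∑ i, -τ (inner ℝ l (y i)) • innerSL ℝ (y i)) l :=
    (HasFDerivAt.fun_sum fun i _ => (hT.hasDerivAt _ (hl i)).comp_hasFDerivAt l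
      (hinner i)).const_smul (n : ℝ)⁻¹
  convert hsum using 1
  simp [tiltedMoment, avg]

-- The quadratic growth of the dual criterion beats its linear term on the sphere of radius `r`.
lemma IsTilting.dual_zero_lt_dual (hT : IsTilting m IsSol τ T) (hn : n ≠ 0) (hr : 0 < r)
    (hy : ∀ i, r * ‖y i‖ ≤ 1 / 8)
    (hc : ∀ u : Vec m, c * ‖u‖ ^ 2 ≤ avg fun i => inner ℝ u (y i) ^ 2)
    (hbar : ‖avg y‖ < c * r / 4) (hl : ‖l‖ = r) :
    avg (fun i => T (inner ℝ (0 : Vec m) (y i))) < avg fun i => T (inner ℝ l (y i)) := by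
  have hgrowth : avg (fun i => T 0 - inner ℝ l (y i) + inner ℝ l (y i) ^ 2 * 4⁻¹)
      ≤ avg fun i => T (inner ℝ l (y i)) := avg_mono fun i => by
    have := hT.growth _ ((abs_inner_le_mul hl.le le_rfl).trans (hy i))
    linarith
  rw [avg_add, avg_sub, avg_const hn, avg_mul_right, ← inner_avg] at hgrowth
  have hquad := hc l
  have hlin : inner ℝ l (avg y) ≤ r * ‖avg y‖ :=
    (le_abs_self _).trans (abs_inner_le_mul hl.le le_rfl)
  simp only [inner_zero_left]
  rw [avg_const hn]
  rw [hl] at hquad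
  nlinarith

lemma IsTilting.exists_tiltedMoment_eq_zero (hT : IsTilting m IsSol τ T) (hn : n ≠ 0)
    (hr : 0 < r) (hy : ∀ i, r * ‖y i‖ ≤ 1 / 8)
    (hc : ∀ u : Vec m, c * ‖u‖ ^ 2 ≤ avg fun i => inner ℝ u (y i) ^ 2)
    (hbar : ‖avg y‖ < c * r / 4) :
    ∃ l : Vec m, ‖l‖ ≤ r ∧ tiltedMoment τ y l = 0 := by
  have hder : ∀ l ∈ Metric.closedBall (0 : Vec m) r, HasFDerivAt
      (fun l => avg fun i => T (inner ℝ l (y i))) (-innerSL ℝ (tiltedMoment τ y l)) l :=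
    fun l hl => hT.hasFDerivAt_dual fun i => abs_inner_lt_one (mem_closedBall_zero_iff.1 hl) (hy i)
  have hzero : (0 : Vec m) ∈ Metric.closedBall 0 r := Metric.mem_closedBall_self hr.le
  obtain ⟨l, hl, hmin⟩ := (isCompact_closedBall (0 : Vec m) r).exists_isMinOn ⟨0, hzero⟩
    fun l hl => (hder l hl).continuousAt.continuousWithinAt
  have hlr : ‖l‖ ≤ r := mem_closedBall_zero_iff.1 hl
  have hlt : ‖l‖ < r := hlr.lt_of_ne fun heq =>
    (hT.dual_zero_lt_dual hn hr hy hc hbar heq).not_ge (isMinOn_iff.1 hmin 0 hzero)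
  have hloc : IsLocalMin (fun l => avg fun i => T (inner ℝ l (y i))) l :=
    hmin.isLocalMin (mem_of_superset (Metric.isOpen_ball.mem_nhds (mem_ball_zero_iff.2 hlt))
      Metric.ball_subset_closedBall)
  have hcrit := DFunLike.congr_fun (hloc.hasFDerivAt_eq_zero (hder l hl)) (tiltedMoment τ y l)
  exact ⟨l, hlr, (inner_self_eq_zero (𝕜 := ℝ)).1 (neg_eq_zero.1 hcrit)⟩

end Tilting

/-- The pairs `(θ, λ)` with `θ ∈ Θ` at which the first-order condition of the inner problem holds.
Multipliers with `|λ'yᵢ(θ)| ≥ 1` are excluded, since the tilting functions are only controlled on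
`(-1, 1)`. -/
def tiltedPairs {n k m : ℕ} (τ : ℝ → ℝ) (Θ : Set (Vec k)) (Y : Vec k → Fin n → Vec m) :
    Set (Vec k × Vec m) :=
  {q | q.1 ∈ Θ ∧ (∀ i, |inner ℝ q.2 (Y q.1 i)| < 1) ∧ tiltedMoment τ (Y q.1) q.2 = 0}

/-- The objective `n⁻¹ ∑ᵢ -ln(n wᵢ)` of the outer problem at the weights `w = tilt τ (Y θ) λ`. -/
noncomputable def tiltedObjective {n k m : ℕ} (τ : ℝ → ℝ) (Y : Vec k → Fin n → Vec m)
    (q : Vec k × Vec m) : ℝ :=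
  discrepancy hEL (tilt τ (Y q.1) q.2)

section Estimates

variable {n k m : ℕ} {IsSol : ∀ {n : ℕ}, (Fin n → Vec m) → (Fin n → ℝ) → Prop} {τ T : ℝ → ℝ}
  {Θ K : Set (Vec k)} {Y : Vec k → Fin n → Vec m} {r R : ℝ} {q₀ : Vec k × Vec m}

lemma tiltedPairs_mono (hK : K ⊆ Θ) : tiltedPairs τ K Y ⊆ tiltedPairs τ Θ Y :=
  fun _ hq => ⟨hK hq.1, hq.2⟩

lemma mk_mem_tiltedPairs (hsmall : ∀ θ ∈ K, ∀ i, r * ‖Y θ i‖ ≤ 1 / 8) {θ : Vec k} (hθ : θ ∈ K)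
    {l : Vec m} (hl : ‖l‖ ≤ r) (h₀ : tiltedMoment τ (Y θ) l = 0) :
    (θ, l) ∈ tiltedPairs τ K Y :=
  ⟨hθ, fun i => abs_inner_lt_one hl (hsmall θ hθ i), h₀⟩

lemma IsTilting.continuousOn_tilting_inner (hT : IsTilting m IsSol τ T)
    {s : Set (Vec k × Vec m)} {i : Fin n} (hY : ContinuousOn (fun q => Y q.1 i) s)
    (hs : ∀ q ∈ s, |inner ℝ q.2 (Y q.1 i)| < 1) :
    ContinuousOn (fun q => τ (inner ℝ q.2 (Y q.1 i))) s :=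
  hT.continuousOn.comp (continuousOn_snd.inner (𝕜 := ℝ) hY) fun q hq => abs_lt.1 (hs q hq)

lemma IsTilting.isCompact_tiltedPairs_inter (hT : IsTilting m IsSol τ T) (hK : IsCompact K)
    (hcont : ∀ i, ContinuousOn (fun θ => Y θ i) K)
    (hsmall : ∀ θ ∈ K, ∀ i, r * ‖Y θ i‖ ≤ 1 / 8) :
    IsCompact (tiltedPairs τ K Y ∩ {q | ‖q.2‖ ≤ r}) := by
  have hball : IsCompact (K ×ˢ Metric.closedBall (0 : Vec m) r) :=
    hK.prod (isCompact_closedBall _ _)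
  have hY : ∀ i, ContinuousOn (fun q : Vec k × Vec m => Y q.1 i)
      (K ×ˢ Metric.closedBall (0 : Vec m) r) := fun i =>
    (hcont i).comp continuousOn_fst fun q hq => hq.1
  have hmoment : ContinuousOn (fun q => tiltedMoment τ (Y q.1) q.2)
      (K ×ˢ Metric.closedBall (0 : Vec m) r) := continuousOn_avg fun i =>
    (hT.continuousOn_tilting_inner (hY i) fun q hq =>
      abs_inner_lt_one (mem_closedBall_zero_iff.1 hq.2) (hsmall q.1 hq.1 i)).smul (hY i)
  refine hball.of_isClosed_subset ?_ fun q hq => ⟨hq.1.1, mem_closedBall_zero_iff.2 hq.2⟩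
  convert hmoment.preimage_isClosed_of_isClosed hball.isClosed isClosed_singleton (t := {0}) using 1
  ext q
  exact ⟨fun hq => ⟨⟨hq.1.1, mem_closedBall_zero_iff.2 hq.2⟩, hq.1.2.2⟩, fun hq =>
    ⟨mk_mem_tiltedPairs hsmall hq.1.1 (mem_closedBall_zero_iff.1 hq.1.2) hq.2,
      mem_closedBall_zero_iff.1 hq.1.2⟩⟩

lemma IsTilting.continuousOn_tiltedObjective (hT : IsTilting m IsSol τ T) (hn : n ≠ 0)
    (hcont : ∀ i, ContinuousOn (fun θ => Y θ i) K) :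
    ContinuousOn (tiltedObjective τ Y) (tiltedPairs τ K Y) := by
  have hτ : ∀ i, ContinuousOn (fun q => τ (inner ℝ q.2 (Y q.1 i))) (tiltedPairs τ K Y) := fun i =>
    hT.continuousOn_tilting_inner ((hcont i).comp continuousOn_fst fun q hq => hq.1)
      fun q hq => hq.2.1 i
  have hpos : ∀ q ∈ tiltedPairs τ K Y, ∀ i, 0 < τ (inner ℝ q.2 (Y q.1 i)) := fun q hq i =>
    hT.pos _ (hq.2.1 i)
  refine ContinuousOn.congr (ContinuousOn.sub
    ((continuousOn_avg hτ).log fun q hq => (avg_pos hn (hpos q hq)).ne')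
    (continuousOn_avg fun i => (hτ i).log fun q hq => (hpos q hq i).ne'))
    fun q hq => discrepancy_hEL_tilt (τ := τ) (y := Y q.1) (l := q.2) hn (hpos q hq)

lemma IsTilting.isSol_tilt (hT : IsTilting m IsSol τ T) (hn : n ≠ 0)
    (hq₀ : q₀ ∈ tiltedPairs τ Θ Y) : IsSol (Y q₀.1) (tilt τ (Y q₀.1) q₀.2) :=
  (hT.isSol_iff hn hq₀.2.1 hq₀.2.2 _).2 rfl

lemma IsTilting.tilt_pos (hT : IsTilting m IsSol τ T) (hq₀ : q₀ ∈ tiltedPairs τ Θ Y) (i : Fin n) :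
    0 < tilt τ (Y q₀.1) q₀.2 i :=
  _root_.tilt_pos (fun i => hT.pos _ (hq₀.2.1 i)) i

lemma IsTilting.tiltedObjective_le_of_norm_le (hT : IsTilting m IsSol τ T) (hn : n ≠ 0)
    (hq₀ : q₀ ∈ tiltedPairs τ Θ Y) (hR : ‖q₀.2‖ * ‖avg (Y q₀.1)‖ ≤ R) :
    tiltedObjective τ Y q₀ ≤ R :=
  (hT.discrepancy_le hn hq₀.2.1 hq₀.2.2).trans ((real_inner_le_norm _ _).trans hR)

lemma IsTilting.exists_isLogEstimator (hT : IsTilting m IsSol τ T) (hn : n ≠ 0)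
    (hK : IsCompact K) (hKΘ : K ⊆ Θ) (hcont : ∀ i, ContinuousOn (fun θ => Y θ i) K)
    (hsmall : ∀ θ ∈ K, ∀ i, r * ‖Y θ i‖ ≤ 1 / 8)
    (hex : ∀ θ ∈ K, ∃ l : Vec m, ‖l‖ ≤ r ∧ tiltedMoment τ (Y θ) l = 0)
    (hlevel : ∀ θ ∈ Θ, ∀ w ∈ weightSet (Set.Ioi 0) (Y θ), discrepancy hEL w ≤ R → θ ∈ K)
    (hq₀ : q₀ ∈ tiltedPairs τ K Y) (hq₀r : ‖q₀.2‖ ≤ r) (hq₀R : tiltedObjective τ Y q₀ ≤ R) :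
    ∃ θ, IsLogEstimator (fun y w => IsSol y w) Θ Y θ := by
  obtain ⟨q, ⟨hq, -⟩, hmin⟩ := (hT.isCompact_tiltedPairs_inter hK hcont hsmall).exists_isMinOn
    ⟨q₀, hq₀, hq₀r⟩ ((hT.continuousOn_tiltedObjective hn hcont).mono Set.inter_subset_left)
  refine ⟨q.1, hKΘ hq.1, _, hT.isSol_tilt hn hq, hT.tilt_pos hq, fun θ hθ w hw hwpos => ?_⟩
  by_cases hθK : θ ∈ K
  · obtain ⟨l, hl, hl₀⟩ := hex θ hθK
    have hmem : (θ, l) ∈ tiltedPairs τ K Y := mk_mem_tiltedPairs hsmall hθK hl hl₀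
    rw [(hT.isSol_iff hn hmem.2.1 hl₀ w).1 hw]
    exact isMinOn_iff.1 hmin _ ⟨hmem, hl⟩
  · have hlt : R < discrepancy hEL w := not_le.1 fun hle =>
      hθK (hlevel θ hθ w (hT.mem_weightSet hw hwpos) hle)
    exact (isMinOn_iff.1 hmin q₀ ⟨hq₀, hq₀r⟩).trans (hq₀R.trans hlt.le)

lemma IsTilting.exists_isMinOn_tiltedObjective (hT : IsTilting m IsSol τ T) (hn : n ≠ 0)
    (hKΘ : K ⊆ Θ) (hsmall : ∀ θ ∈ K, ∀ i, r * ‖Y θ i‖ ≤ 1 / 8)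
    (hex : ∀ θ ∈ K, ∃ l : Vec m, ‖l‖ ≤ r ∧ tiltedMoment τ (Y θ) l = 0)
    (hlevel : ∀ θ ∈ Θ, ∀ w ∈ weightSet (Set.Ioi 0) (Y θ), discrepancy hEL w ≤ R → θ ∈ K)
    (hq₀ : q₀ ∈ tiltedPairs τ K Y) (hq₀R : tiltedObjective τ Y q₀ ≤ R) {θ : Vec k}
    (hθ : IsLogEstimator (fun y w => IsSol y w) Θ Y θ) :
    θ ∈ K ∧ ∃ l : Vec m, ‖l‖ ≤ r ∧ (θ, l) ∈ tiltedPairs τ K Y ∧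
      IsMinOn (tiltedObjective τ Y) (tiltedPairs τ Θ Y) (θ, l) := by
  obtain ⟨hθΘ, w, hw, hwpos, hmin⟩ := hθ
  have hle : ∀ q ∈ tiltedPairs τ Θ Y, discrepancy hEL w ≤ tiltedObjective τ Y q := fun q hq =>
    hmin q.1 hq.1 _ (hT.isSol_tilt hn hq) (hT.tilt_pos hq)
  have hθK : θ ∈ K := hlevel θ hθΘ w (hT.mem_weightSet hw hwpos)
    ((hle q₀ (tiltedPairs_mono hKΘ hq₀)).trans hq₀R)
  obtain ⟨l, hl, hl₀⟩ := hex θ hθK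
  have hmem : (θ, l) ∈ tiltedPairs τ K Y := mk_mem_tiltedPairs hsmall hθK hl hl₀
  rw [(hT.isSol_iff hn hmem.2.1 hl₀ w).1 hw] at hle
  exact ⟨hθK, l, hl, hmem, isMinOn_iff.2 hle⟩

end Estimates

section FirstOrder

variable {n k m : ℕ} {Y : Vec k → Fin n → Vec m} {Θ : Set (Vec k)} {θ : Vec k} {l : Vec m}
  {G : Fin n → Vec k →L[ℝ] Vec m} {τ : ℝ → ℝ} {τ' : Fin n → ℝ}

lemma exists_inner_multiplier {E : Type*} [NormedAddCommGroup E] [NormedSpace ℝ E]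
    [CompleteSpace E] {f : E → Vec m} {φ : E → ℝ} {x₀ : E} {f' : E →L[ℝ] Vec m}
    {φ' : E →L[ℝ] ℝ} (hmin : IsLocalMinOn φ {x | f x = f x₀} x₀)
    (hf : HasStrictFDerivAt f f' x₀) (hφ : HasStrictFDerivAt φ φ' x₀) :
    ∃ (u : Vec m) (c : ℝ), (u ≠ 0 ∨ c ≠ 0) ∧ ∀ x, inner ℝ u (f' x) + c * φ' x = 0 := by
  obtain ⟨Λ, c, hne, hΛ⟩ :=
    IsLocalExtrOn.exists_linear_map_of_hasStrictFDerivAt (Or.inl hmin) hf hφ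
  obtain ⟨u, hu⟩ := (InnerProductSpace.toDual ℝ (Vec m)).surjective
    (LinearMap.toContinuousLinearMap Λ)
  have hinner : ∀ v, inner ℝ u v = Λ v := fun v => by
    rw [← InnerProductSpace.toDual_apply_apply (𝕜 := ℝ), hu, LinearMap.coe_toContinuousLinearMap']
  refine ⟨u, c, ?_, fun x => by rw [hinner]; exact hΛ x⟩
  by_contra! hzero
  refine hne (Prod.ext (LinearMap.ext fun v => ?_) hzero.2)
  rw [← hinner, hzero.1, inner_zero_left]
  rfl

/-- The derivative of `(θ, λ) ↦ λ'y(θ)`, where `G` is the derivative of `y`. -/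
noncomputable def innerDeriv (G : Vec k →L[ℝ] Vec m) (l y : Vec m) : Vec k × Vec m →L[ℝ] ℝ :=
  (innerSL ℝ l).comp (G.comp (ContinuousLinearMap.fst ℝ _ _)) +
    (innerSL ℝ y).comp (ContinuousLinearMap.snd ℝ _ _)

lemma innerDeriv_apply (G : Vec k →L[ℝ] Vec m) (l y : Vec m) (v : Vec k) (d : Vec m) :
    innerDeriv G l y (v, d) = inner ℝ l (G v) + inner ℝ y d := rfl

lemma hasStrictFDerivAt_inner_snd {f : Vec k → Vec m} {G : Vec k →L[ℝ] Vec m}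
    (hf : HasStrictFDerivAt f G θ) (l : Vec m) :
    HasStrictFDerivAt (fun q : Vec k × Vec m => inner ℝ q.2 (f q.1)) (innerDeriv G l (f θ))
      (θ, l) := by
  have hfst : HasStrictFDerivAt (fun q : Vec k × Vec m => f q.1)
      (G.comp (ContinuousLinearMap.fst ℝ _ _)) (θ, l) :=
    HasStrictFDerivAt.comp (θ, l) (f := Prod.fst) hf hasStrictFDerivAt_fst
  have hinner := HasStrictFDerivAt.inner ℝ (hasStrictFDerivAt_snd (𝕜 := ℝ) (p := (θ, l))) hfst
  refine hinner.congr_fderiv (ContinuousLinearMap.ext fun ⟨v, d⟩ => ?_)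
  simp [innerDeriv_apply, fderivInnerCLM_apply, real_inner_comm d]

lemma hasStrictFDerivAt_avg_comp_inner (hY : ∀ i, HasStrictFDerivAt (fun θ => Y θ i) (G i) θ)
    (hτ : ∀ i, HasStrictDerivAt τ (τ' i) (inner ℝ l (Y θ i))) :
    HasStrictFDerivAt (fun q : Vec k × Vec m => avg fun i => τ (inner ℝ q.2 (Y q.1 i)))
      (avg fun i => τ' i • innerDeriv (G i) l (Y θ i)) (θ, l) := by
  have hsum : HasStrictFDerivAt (fun q : Vec k × Vec m => ∑ i, τ (inner ℝ q.2 (Y q.1 i)))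
      (∑ i, τ' i • innerDeriv (G i) l (Y θ i)) (θ, l) :=
    HasStrictFDerivAt.fun_sum fun i _ =>
      HasStrictDerivAt.comp_hasStrictFDerivAt (θ, l) (hτ i) (hasStrictFDerivAt_inner_snd (hY i) l)
  exact hsum.const_smul (n : ℝ)⁻¹

lemma hasStrictFDerivAt_tiltedMoment (hY : ∀ i, HasStrictFDerivAt (fun θ => Y θ i) (G i) θ)
    (hτ : ∀ i, HasStrictDerivAt τ (τ' i) (inner ℝ l (Y θ i))) :
    HasStrictFDerivAt (fun q : Vec k × Vec m => tiltedMoment τ (Y q.1) q.2)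
      (avg fun i => τ (inner ℝ l (Y θ i)) • (G i).comp (ContinuousLinearMap.fst ℝ _ _) +
        (τ' i • innerDeriv (G i) l (Y θ i)).smulRight (Y θ i)) (θ, l) := by
  have hsum : HasStrictFDerivAt
      (fun q : Vec k × Vec m => ∑ i, τ (inner ℝ q.2 (Y q.1 i)) • Y q.1 i)
      (∑ i, (τ (inner ℝ l (Y θ i)) • (G i).comp (ContinuousLinearMap.fst ℝ _ _) +
        (τ' i • innerDeriv (G i) l (Y θ i)).smulRight (Y θ i))) (θ, l) :=
    HasStrictFDerivAt.fun_sum fun i _ =>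
      (HasStrictDerivAt.comp_hasStrictFDerivAt (θ, l) (hτ i)
        (hasStrictFDerivAt_inner_snd (hY i) l)).fun_smul
      (HasStrictFDerivAt.comp (θ, l) (f := Prod.fst) (hY i) hasStrictFDerivAt_fst)
  exact hsum.const_smul (n : ℝ)⁻¹

lemma eventually_mem_tiltedPairs (hΘ : Θ ∈ 𝓝 θ) (hY : ∀ i, ContinuousAt (fun θ => Y θ i) θ)
    (hq : (θ, l) ∈ tiltedPairs τ Θ Y) :
    ∀ᶠ q in 𝓝[{q | tiltedMoment τ (Y q.1) q.2 = tiltedMoment τ (Y θ) l}] (θ, l),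
      q ∈ tiltedPairs τ Θ Y := by
  have hinner : ∀ i, ∀ᶠ q : Vec k × Vec m in 𝓝 (θ, l), |inner ℝ q.2 (Y q.1 i)| < 1 := fun i => by
    have hYi : ContinuousAt (fun q : Vec k × Vec m => Y q.1 i) (θ, l) :=
      ContinuousAt.comp (f := Prod.fst) (x := (θ, l)) (hY i) continuousAt_fst
    exact (continuousAt_snd.inner (𝕜 := ℝ) hYi).abs.eventually_lt continuousAt_const (hq.2.1 i)
  filter_upwards [self_mem_nhdsWithin, mem_nhdsWithin_of_mem_nhds
    ((continuousAt_fst.eventually_mem hΘ).and (eventually_all.2 hinner))] with q hq₀ hq'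
  exact ⟨hq'.1, hq'.2, (show _ = _ from hq₀).trans hq.2.2⟩

lemma eq_zero_of_avg_mul_inner_sq_eq_zero (hn : n ≠ 0) {y : Fin n → Vec m} {c : ℝ}
    (hc : 0 < c) (hpd : ∀ u : Vec m, c * ‖u‖ ^ 2 ≤ avg fun i => inner ℝ u (y i) ^ 2)
    {a : Fin n → ℝ} (ha : ∀ i, 0 < a i) {u : Vec m}
    (hu : avg (fun i => a i * inner ℝ u (y i) ^ 2) = 0) : u = 0 := by
  have hinner : ∀ i, inner ℝ u (y i) = 0 := fun i => by
    have hle := le_mul_avg (fun i => mul_nonneg (ha i).le (sq_nonneg (inner ℝ u (y i)))) i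
    rw [hu, mul_zero] at hle
    have hsq : inner ℝ u (y i) ^ 2 = 0 :=
      (nonpos_of_mul_nonpos_right hle (ha i)).antisymm (sq_nonneg _)
    exact pow_eq_zero_iff two_ne_zero |>.1 hsq
  have hnorm := hpd u
  simp only [hinner, zero_pow two_ne_zero, avg_const hn] at hnorm
  have hsq : ‖u‖ ^ 2 = 0 := (nonpos_of_mul_nonpos_right hnorm hc).antisymm (sq_nonneg _)
  exact norm_eq_zero.1 (pow_eq_zero_iff two_ne_zero |>.1 hsq)

-- The multiplier of the objective cannot vanish, because the derivative of the constraint in `λ`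
-- is nonsingular; it is normalized to `1`.
lemma exists_multiplier_of_isMinOn (hn : n ≠ 0) (hΘ : Θ ∈ 𝓝 θ)
    (hY : ∀ i, HasStrictFDerivAt (fun θ => Y θ i) (G i) θ)
    (hτ : ∀ i, HasStrictDerivAt τ (τ' i) (inner ℝ l (Y θ i))) (hτ' : ∀ i, τ' i < 0) {c : ℝ}
    (hc : 0 < c) (hpd : ∀ u : Vec m, c * ‖u‖ ^ 2 ≤ avg fun i => inner ℝ u (Y θ i) ^ 2)
    (hq : (θ, l) ∈ tiltedPairs τ Θ Y)
    (hmin : IsMinOn (tiltedObjective τ Y) (tiltedPairs τ Θ Y) (θ, l)) {φ : Vec k × Vec m → ℝ}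
    {φ' : Vec k × Vec m →L[ℝ] ℝ} (hφ : HasStrictFDerivAt φ φ' (θ, l))
    (heq : ∀ q ∈ tiltedPairs τ Θ Y, tiltedObjective τ Y q = φ q) :
    ∃ u : Vec m,
      (∀ v, avg (fun i => τ (inner ℝ l (Y θ i)) * inner ℝ u (G i v)
        + τ' i * inner ℝ l (G i v) * inner ℝ u (Y θ i)) + φ' (v, 0) = 0) ∧
      ∀ d, avg (fun i => τ' i * inner ℝ d (Y θ i) * inner ℝ u (Y θ i)) + φ' (0, d) = 0 := by
  have hlocal : IsLocalMinOn φ {q | tiltedMoment τ (Y q.1) q.2 = tiltedMoment τ (Y θ) l}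
      (θ, l) := by
    filter_upwards [eventually_mem_tiltedPairs hΘ (fun i => (hY i).continuousAt) hq] with q hq'
    rw [← heq _ hq, ← heq _ hq']
    exact isMinOn_iff.1 hmin q hq'
  obtain ⟨u, a, hne, hua⟩ :=
    exists_inner_multiplier (f := fun q : Vec k × Vec m => tiltedMoment τ (Y q.1) q.2)
      (x₀ := (θ, l)) hlocal (hasStrictFDerivAt_tiltedMoment (Y := Y) hY hτ) hφ
  have hθ : ∀ v, avg (fun i => τ (inner ℝ l (Y θ i)) * inner ℝ u (G i v)
      + τ' i * inner ℝ l (G i v) * inner ℝ u (Y θ i)) + a * φ' (v, 0) = 0 := fun v => by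
    simpa [avg_apply, inner_avg, innerDeriv_apply, inner_add_right, inner_smul_right, smul_smul]
      using hua (v, 0)
  have hl : ∀ d, avg (fun i => τ' i * inner ℝ d (Y θ i) * inner ℝ u (Y θ i))
      + a * φ' (0, d) = 0 := fun d => by
    simpa [avg_apply, inner_avg, innerDeriv_apply, inner_smul_right, smul_smul,
      real_inner_comm d] using hua (0, d)
  have ha : a ≠ 0 := hne.elim (fun hu ha => hu ?_) id
  · refine ⟨a⁻¹ • u, fun v => mul_left_cancel₀ ha ?_, fun d => mul_left_cancel₀ ha ?_⟩
    · rw [mul_zero, ← hθ v, mul_add, ← avg_mul_left]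
      congr 2 with i
      rw [real_inner_smul_left, real_inner_smul_left]
      field_simp
    · rw [mul_zero, ← hl d, mul_add, ← avg_mul_left]
      congr 2 with i
      rw [real_inner_smul_left]
      field_simp
  · refine eq_zero_of_avg_mul_inner_sq_eq_zero hn hc hpd (fun i => neg_pos.2 (hτ' i)) ?_
    have hlu := hl u
    rw [ha, zero_mul, add_zero, ← neg_eq_zero, ← avg_neg] at hlu
    rw [← hlu]
    congr 1 with i
    ring

lemma avg_inner_jac_eq_zero_of_isMinOn_EL (hn : n ≠ 0) (hΘ : Θ ∈ 𝓝 θ)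
    (hY : ∀ i, HasStrictFDerivAt (fun θ => Y θ i) (G i) θ) {c : ℝ} (hc : 0 < c)
    (hpd : ∀ u : Vec m, c * ‖u‖ ^ 2 ≤ avg fun i => inner ℝ u (Y θ i) ^ 2)
    (hq : (θ, l) ∈ tiltedPairs (fun t => (1 + t)⁻¹) Θ Y)
    (hmin : IsMinOn (tiltedObjective (fun t => (1 + t)⁻¹) Y)
      (tiltedPairs (fun t => (1 + t)⁻¹) Θ Y) (θ, l)) (v : Vec k) :
    avg (fun i => (1 + inner ℝ l (Y θ i))⁻¹ * inner ℝ l (G i v)) = 0 := by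
  have hpos : ∀ i, 0 < 1 + inner ℝ l (Y θ i) := fun i => one_add_pos_of_abs_lt_one (hq.2.1 i)
  have hτ : ∀ i, HasStrictDerivAt (fun t : ℝ => (1 + t)⁻¹) (-((1 + inner ℝ l (Y θ i))⁻¹) ^ 2)
      (inner ℝ l (Y θ i)) := fun i => by
    simpa [Function.comp_def] using HasStrictDerivAt.comp (inner ℝ l (Y θ i)) (h₂ := Inv.inv)
      (hasStrictDerivAt_inv (hpos i).ne')
      ((hasStrictDerivAt_id (inner ℝ l (Y θ i))).const_add 1)
  have hφ := hasStrictFDerivAt_avg_comp_inner (l := l) hY (τ := fun t => Real.log (1 + t))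
    (τ' := fun i => (1 + inner ℝ l (Y θ i))⁻¹) fun i => by
      simpa using ((hasStrictDerivAt_id (inner ℝ l (Y θ i))).const_add 1).log (hpos i).ne'
  obtain ⟨u, hθ, hl⟩ := exists_multiplier_of_isMinOn hn hΘ hY hτ
    (fun i => neg_lt_zero.2 (pow_pos (inv_pos.2 (hpos i)) 2)) hc hpd hq hmin hφ fun q hq =>
      discrepancy_hEL_tilt_inv_one_add hn (fun i => one_add_pos_of_abs_lt_one (hq.2.1 i)) hq.2.2
  have hcrit := avg_mul_inner_eq_zero_of_tiltedMoment_eq_zero hq.2.2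
  have hu : u = 0 := by
    refine eq_zero_of_avg_mul_inner_sq_eq_zero hn hc hpd
      (fun i => pow_pos (inv_pos.2 (hpos i)) 2) ?_
    rw [← neg_eq_zero, ← hl u, ← avg_neg]
    simp only [avg_apply, smul_apply, innerDeriv_apply, map_zero, inner_zero_right, zero_add,
      smul_eq_mul, real_inner_comm u, hcrit, add_zero]
    congr 1 with i
    ring
  simpa [hu, avg_const hn, avg_apply, innerDeriv_apply] using hθ v

lemma exists_multiplier_of_isMinOn_ETEL (hn : n ≠ 0) (hΘ : Θ ∈ 𝓝 θ)
    (hY : ∀ i, HasStrictFDerivAt (fun θ => Y θ i) (G i) θ) {c : ℝ} (hc : 0 < c)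
    (hpd : ∀ u : Vec m, c * ‖u‖ ^ 2 ≤ avg fun i => inner ℝ u (Y θ i) ^ 2)
    (hq : (θ, l) ∈ tiltedPairs (fun t => Real.exp (-t)) Θ Y)
    (hmin : IsMinOn (tiltedObjective (fun t => Real.exp (-t)) Y)
      (tiltedPairs (fun t => Real.exp (-t)) Θ Y) (θ, l)) :
    ∃ ν : Vec m,
      (∀ d, avg (fun i => Real.exp (-inner ℝ l (Y θ i)) * inner ℝ ν (Y θ i) * inner ℝ d (Y θ i))
        = avg fun i => inner ℝ d (Y θ i)) ∧
      ∀ v, avg (fun i => (1 - Real.exp (-inner ℝ l (Y θ i)) /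
            (avg fun j => Real.exp (-inner ℝ l (Y θ j)))
          - Real.exp (-inner ℝ l (Y θ i)) * inner ℝ ν (Y θ i)) * inner ℝ l (G i v)
          + Real.exp (-inner ℝ l (Y θ i)) * inner ℝ ν (G i v)) = 0 := by
  have hexp : ∀ i, HasStrictDerivAt (fun t => Real.exp (-t)) (-Real.exp (-inner ℝ l (Y θ i)))
      (inner ℝ l (Y θ i)) := fun i => by
    simpa using (hasStrictDerivAt_neg (inner ℝ l (Y θ i))).exp
  have hM : 0 < avg fun j => Real.exp (-inner ℝ l (Y θ j)) := avg_pos hn fun _ => Real.exp_pos _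
  have hφ := ((hasStrictFDerivAt_avg_comp_inner (l := l) hY hexp).log hM.ne').fun_add
    (hasStrictFDerivAt_avg_comp_inner (l := l) hY (τ := fun t => t) (τ' := fun _ => 1)
      fun i => hasStrictDerivAt_id _)
  obtain ⟨ν, hθ, hl⟩ := exists_multiplier_of_isMinOn hn hΘ hY hexp
    (fun i => neg_lt_zero.2 (Real.exp_pos _)) hc hpd hq hmin hφ fun q _ => by
      rw [tiltedObjective, discrepancy_hEL_tilt_exp_neg hn, add_comm, inner_avg]
  have hcrit := avg_mul_inner_eq_zero_of_tiltedMoment_eq_zero hq.2.2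
  refine ⟨ν, fun d => ?_, fun v => ?_⟩
  · have hd := hl d
    simp only [avg_apply, add_apply, smul_apply, innerDeriv_apply, map_zero, inner_zero_right,
      zero_add, smul_eq_mul, neg_mul, one_mul, avg_neg, real_inner_comm d, hcrit, mul_zero,
      neg_zero] at hd
    rw [neg_add_eq_zero] at hd
    rw [← hd]
    congr 1 with i
    ring
  · have hv := hθ v
    simp only [avg_apply, add_apply, smul_apply, innerDeriv_apply, inner_zero_right, add_zero,
      smul_eq_mul, one_mul] at hv
    rw [← avg_mul_left, ← avg_add, ← avg_add] at hv
    rw [← hv]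
    congr 1 with i
    ring

end FirstOrder

section ScalarBounds

variable {t u : ℝ}

lemma half_le_exp_neg (ht : |t| ≤ 1 / 2) : 1 / 2 ≤ Real.exp (-t) := by
  linarith [Real.one_sub_le_exp_neg t, le_of_abs_le ht]

lemma abs_exp_neg_sub_one_le (ht : |t| ≤ 1 / 2) : |Real.exp (-t) - 1| ≤ 2 * |t| := by
  simpa using Real.abs_exp_sub_one_le (x := -t) (by rw [abs_neg]; linarith)

lemma exp_neg_le_two (ht : |t| ≤ 1 / 2) : Real.exp (-t) ≤ 2 := by
  linarith [(abs_le.1 (abs_exp_neg_sub_one_le ht)).2]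

lemma abs_exp_neg_sub_one_add_le (ht : |t| ≤ 1 / 2) : |Real.exp (-t) - 1 + t| ≤ t ^ 2 := by
  simpa using Real.abs_exp_sub_one_sub_id_le (x := -t) (by rw [abs_neg]; linarith)

lemma abs_one_sub_exp_neg_mul_one_add_le (ht : |t| ≤ 1 / 2) :
    |1 - Real.exp (-t) * (1 + t)| ≤ t ^ 2 := by
  have h := abs_le.1 ht
  have hle : Real.exp (-t) * (1 + t) ≤ 1 := by
    calc Real.exp (-t) * (1 + t) ≤ Real.exp (-t) * Real.exp t := by
          gcongr; linarith [Real.add_one_le_exp t]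
      _ = 1 := by rw [← Real.exp_add, neg_add_cancel, Real.exp_zero]
  rw [abs_of_nonneg (sub_nonneg.2 hle)]
  nlinarith [Real.one_sub_le_exp_neg t]

lemma inv_one_add_pos (ht : |t| ≤ 1 / 2) : 0 < (1 + t)⁻¹ :=
  inv_pos.2 (one_add_pos_of_abs_lt_one (by linarith))

lemma inv_one_add_le_two (ht : |t| ≤ 1 / 2) : (1 + t)⁻¹ ≤ 2 := by
  rw [inv_le_comm₀ (inv_pos.1 (inv_one_add_pos ht)) two_pos]
  linarith [neg_le_of_abs_le ht]

lemma abs_inv_one_add_sub_le (ht : |t| ≤ 1 / 2) (hu : |u| ≤ 1 / 2) :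
    |(1 + t)⁻¹ - (1 + u)⁻¹| ≤ 4 * |t - u| := by
  have ht' : 1 + t ≠ 0 := (inv_pos.1 (inv_one_add_pos ht)).ne'
  have hu' : 1 + u ≠ 0 := (inv_pos.1 (inv_one_add_pos hu)).ne'
  have heq : (1 + t)⁻¹ - (1 + u)⁻¹ = (1 + t)⁻¹ * (1 + u)⁻¹ * (u - t) := by field_simp; ring
  rw [heq, abs_mul, abs_sub_comm u t,
    abs_of_pos (mul_pos (inv_one_add_pos ht) (inv_one_add_pos hu))]
  gcongr
  nlinarith [inv_one_add_le_two ht, inv_one_add_le_two hu, inv_one_add_pos ht]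

lemma abs_inv_one_add_sub_one_le (ht : |t| ≤ 1 / 2) : |(1 + t)⁻¹ - 1| ≤ 2 * |t| := by
  have heq : (1 + t)⁻¹ - 1 = (1 + t)⁻¹ * -t := by
    field_simp [(inv_pos.1 (inv_one_add_pos ht)).ne']; ring
  rw [heq, abs_mul, abs_neg, abs_of_pos (inv_one_add_pos ht)]
  gcongr
  exact inv_one_add_le_two ht

lemma abs_inv_one_add_sub_one_add_le (ht : |t| ≤ 1 / 2) :
    |(1 + t)⁻¹ - 1 + t| ≤ 2 * t ^ 2 := by
  have heq : (1 + t)⁻¹ - 1 + t = (1 + t)⁻¹ * t ^ 2 := by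
    field_simp [(inv_pos.1 (inv_one_add_pos ht)).ne']; ring
  rw [heq, abs_mul, abs_of_pos (inv_one_add_pos ht), abs_of_nonneg (sq_nonneg t)]
  gcongr
  exact inv_one_add_le_two ht

lemma sq_le_one_add_pow_four (a : ℝ) : a ^ 2 ≤ 1 + a ^ 4 := by
  nlinarith [sq_nonneg (a ^ 2 - 1), sq_nonneg (a ^ 2)]

lemma pow_three_le_one_add_pow_four (a : ℝ) : a ^ 3 ≤ 1 + a ^ 4 := by
  nlinarith [sq_nonneg (a ^ 2 - a), sq_nonneg (a ^ 2 - 1), sq_nonneg (a - 1)]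

lemma mul_le_one_add_pow_four_add_sq (a g : ℝ) : a * g ≤ 1 + a ^ 4 + g ^ 2 := by
  nlinarith [two_mul_le_add_sq a g, sq_le_one_add_pow_four a, sq_nonneg g]

lemma sq_mul_le_pow_four_add_sq (a g : ℝ) : a ^ 2 * g ≤ a ^ 4 + g ^ 2 := by
  nlinarith [two_mul_le_add_sq (a ^ 2) g, sq_nonneg g, sq_nonneg (a ^ 2)]

lemma le_one_add_sq (g : ℝ) : g ≤ 1 + g ^ 2 := by
  nlinarith [sq_nonneg (g - 1), sq_nonneg g]

end ScalarBounds

section PointwiseResidual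

variable {a s A K x z M : ℝ}

lemma abs_inv_one_add_sub_one_add_exp_neg_mul_le (hx : |x| ≤ s * a) (hz : |z| ≤ 2 * s * a)
    (hzx : |z - x| ≤ A * s ^ 2 * a) (hsa : s * a ≤ 1 / 8) :
    |(1 + z)⁻¹ - 1 + Real.exp (-x) * z| ≤ 2 * s * a * (s ^ 2 * (9 * a ^ 2 + A * a)) := by
  have hx' : |x| ≤ 1 / 2 := by linarith
  have hz' : |z| ≤ 1 / 2 := by linarith
  have hfactor : (1 + z)⁻¹ - 1 + Real.exp (-x) * z
      = z * ((Real.exp (-x) - 1 + x) + (z - x) - ((1 + z)⁻¹ - 1 + z)) := by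
    field_simp [(inv_pos.1 (inv_one_add_pos hz')).ne']
    ring
  have hx_sq : x ^ 2 ≤ (s * a) ^ 2 := sq_le_sq' (neg_le_of_abs_le hx) (le_of_abs_le hx)
  have hz_sq : z ^ 2 ≤ (2 * s * a) ^ 2 := sq_le_sq' (neg_le_of_abs_le hz) (le_of_abs_le hz)
  have hrest : |(Real.exp (-x) - 1 + x) + (z - x) - ((1 + z)⁻¹ - 1 + z)|
      ≤ s ^ 2 * (9 * a ^ 2 + A * a) :=
    calc _ ≤ x ^ 2 + A * s ^ 2 * a + 2 * z ^ 2 :=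
          (abs_sub _ _).trans (add_le_add ((abs_add_le _ _).trans
            (add_le_add (abs_exp_neg_sub_one_add_le hx') hzx)) (abs_inv_one_add_sub_one_add_le hz'))
      _ ≤ (s * a) ^ 2 + A * s ^ 2 * a + 2 * (2 * s * a) ^ 2 := by gcongr
      _ = _ := by ring
  rw [hfactor, abs_mul]
  exact mul_le_mul hz hrest (abs_nonneg _) ((abs_nonneg _).trans hz)

lemma abs_mul_inv_sub_one_le {p : ℝ} (hp : 0 ≤ p) (hp₂ : p ≤ 2) (hM : |M - 1| ≤ 3 * K * s ^ 2)
    (hM₂ : 1 / 2 ≤ M) : |p * (M⁻¹ - 1)| ≤ 12 * K * s ^ 2 := by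
  have hM₀ : 0 < M := by linarith
  have hMinv : M⁻¹ ≤ 2 := by rw [inv_le_comm₀ hM₀ two_pos]; linarith
  have heq : p * (M⁻¹ - 1) = p * M⁻¹ * (1 - M) := by field_simp
  rw [heq, abs_mul, abs_sub_comm 1 M, abs_of_nonneg (by positivity)]
  calc p * M⁻¹ * |M - 1| ≤ 2 * 2 * (3 * K * s ^ 2) := by gcongr
    _ = _ := by ring

lemma abs_inv_one_add_sub_exp_neg_sub_one_add_le (hx : |x| ≤ s * a) (hz : |z| ≤ 2 * s * a)
    (hsa : s * a ≤ 1 / 8) (hM : |M - 1| ≤ 3 * K * s ^ 2) (hM₂ : 1 / 2 ≤ M) :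
    |(1 + z)⁻¹ - Real.exp (-x) - 1 + Real.exp (-x) / M + Real.exp (-x) * z|
      ≤ s ^ 2 * (12 * a ^ 2 + 12 * K) := by
  have hx' : |x| ≤ 1 / 2 := by linarith
  have hz' : |z| ≤ 1 / 2 := by linarith
  have hz_sq : z ^ 2 ≤ (2 * s * a) ^ 2 := sq_le_sq' (neg_le_of_abs_le hz) (le_of_abs_le hz)
  have hexp : |(Real.exp (-x) - 1) * z| ≤ 2 * (s * a) * (2 * s * a) := by
    rw [abs_mul]
    exact mul_le_mul (by linarith [abs_exp_neg_sub_one_le hx']) hz (abs_nonneg _)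
      (by linarith [abs_nonneg x])
  have heq : (1 + z)⁻¹ - Real.exp (-x) - 1 + Real.exp (-x) / M + Real.exp (-x) * z
      = ((1 + z)⁻¹ - 1 + z) + (Real.exp (-x) - 1) * z + Real.exp (-x) * (M⁻¹ - 1) := by ring
  rw [heq]
  calc _ ≤ 2 * z ^ 2 + 2 * (s * a) * (2 * s * a) + 12 * K * s ^ 2 :=
        (abs_add_three _ _ _).trans (add_le_add (add_le_add (abs_inv_one_add_sub_one_add_le hz')
          hexp) (abs_mul_inv_sub_one_le (Real.exp_pos _).le (exp_neg_le_two hx') hM hM₂))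
    _ ≤ 2 * (2 * s * a) ^ 2 + 2 * (s * a) * (2 * s * a) + 12 * K * s ^ 2 := by gcongr
    _ = _ := by ring

lemma abs_one_sub_exp_neg_div_sub_le (hs : 0 ≤ s) (hs₁ : s ≤ 1) (hK : 0 ≤ K) (hx : |x| ≤ s * a)
    (hz : |z| ≤ 2 * s * a) (hsa : s * a ≤ 1 / 8) (hM : |M - 1| ≤ 3 * K * s ^ 2)
    (hM₂ : 1 / 2 ≤ M) :
    |1 - Real.exp (-x) / M - Real.exp (-x) * z| ≤ s * (6 * a + 12 * K) := by
  have hx' : |x| ≤ 1 / 2 := by linarith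
  have hexp : |Real.exp (-x) * z| ≤ 2 * (2 * s * a) := by
    rw [abs_mul, Real.abs_exp]
    exact mul_le_mul (exp_neg_le_two hx') hz (abs_nonneg _) two_pos.le
  have heq : 1 - Real.exp (-x) / M - Real.exp (-x) * z
      = -(Real.exp (-x) - 1) - Real.exp (-x) * (M⁻¹ - 1) - Real.exp (-x) * z := by ring
  have hsq : s ^ 2 ≤ s := by nlinarith
  rw [heq]
  calc _ ≤ 2 * (s * a) + 12 * K * s ^ 2 + 2 * (2 * s * a) := by
        refine (abs_sub _ _).trans (add_le_add ((abs_sub _ _).trans (add_le_add ?_ ?_)) hexp)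
        · rw [abs_neg]
          linarith [abs_exp_neg_sub_one_le hx']
        · exact abs_mul_inv_sub_one_le (Real.exp_pos _).le (exp_neg_le_two hx') hM hM₂
    _ ≤ 2 * (s * a) + 12 * K * s + 2 * (2 * s * a) := by gcongr
    _ = _ := by ring

end PointwiseResidual

/-- Bounds on the values `yᵢ` of the moment functions and `Gᵢ` of their derivatives at one
parameter, under which third-order expansions in a multiplier of size `s` have a remainder that is
uniform in the sample. -/
structure MomentBound {n k m : ℕ} (y : Fin n → Vec m) (G : Fin n → Vec k →L[ℝ] Vec m)
    (a g : Fin n → ℝ) (K s : ℝ) : Prop where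
  norm_le : ∀ i, ‖y i‖ ≤ a i
  norm_deriv_le : ∀ i, ‖G i‖ ≤ g i
  avg_le : avg (fun i => 1 + a i ^ 4 + g i ^ 2) ≤ K
  mul_le : ∀ i, s * a i ≤ 1 / 8

namespace MomentBound

variable {n k m : ℕ} {y : Fin n → Vec m} {G : Fin n → Vec k →L[ℝ] Vec m} {a g : Fin n → ℝ}
  {c A K s : ℝ} {l ν : Vec m}

lemma bound_nonneg (h : MomentBound y G a g K s) : 0 ≤ K :=
  (avg_nonneg fun i => by positivity).trans h.avg_le

lemma abs_inner_le_half (h : MomentBound y G a g K s) (hl : ‖l‖ ≤ s) (i : Fin n) :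
    |inner ℝ l (y i)| ≤ 1 / 2 := by
  linarith [abs_inner_le_mul hl (h.norm_le i), h.mul_le i]

lemma half_le_avg_exp_neg (h : MomentBound y G a g K s) (hn : n ≠ 0) (hl : ‖l‖ ≤ s) :
    1 / 2 ≤ avg fun i => Real.exp (-inner ℝ l (y i)) :=
  calc (1 / 2 : ℝ) = avg fun _ : Fin n => (1 / 2 : ℝ) := (avg_const hn _).symm
    _ ≤ _ := avg_mono fun i => half_le_exp_neg (h.abs_inner_le_half hl i)

lemma abs_avg_exp_neg_sub_one_le (h : MomentBound y G a g K s) (hn : n ≠ 0) (hl : ‖l‖ ≤ s)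
    (h₀ : tiltedMoment (fun t => Real.exp (-t)) y l = 0) :
    |avg (fun i => Real.exp (-inner ℝ l (y i))) - 1| ≤ 3 * K * s ^ 2 := by
  have heq : avg (fun i => Real.exp (-inner ℝ l (y i))) - 1
      = avg fun i => (Real.exp (-inner ℝ l (y i)) - 1 + inner ℝ l (y i))
          + (Real.exp (-inner ℝ l (y i)) - 1) * inner ℝ l (y i) := by
    have hone := avg_const hn (1 : ℝ)
    have hl₀ := avg_mul_inner_eq_zero_of_tiltedMoment_eq_zero h₀ l
    rw [← add_zero (avg _ - 1), ← hl₀]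
    nth_rewrite 1 [← hone]
    rw [← avg_sub, ← avg_add]
    congr 1 with i
    ring
  have hbound : ∀ i, ‖(Real.exp (-inner ℝ l (y i)) - 1 + inner ℝ l (y i))
      + (Real.exp (-inner ℝ l (y i)) - 1) * inner ℝ l (y i)‖
      ≤ 3 * s ^ 2 * (1 + a i ^ 4 + g i ^ 2) := fun i => by
    have hx := h.abs_inner_le_half hl i
    have hsq := sq_le_sq' (neg_le_of_abs_le (abs_inner_le_mul hl (h.norm_le i)))
      (le_of_abs_le (abs_inner_le_mul hl (h.norm_le i)))
    calc _ ≤ inner ℝ l (y i) ^ 2 + 2 * |inner ℝ l (y i)| * |inner ℝ l (y i)| := by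
          refine (norm_add_le _ _).trans (add_le_add (abs_exp_neg_sub_one_add_le hx) ?_)
          rw [norm_mul, Real.norm_eq_abs, Real.norm_eq_abs]
          gcongr
          exact abs_exp_neg_sub_one_le hx
      _ = 3 * inner ℝ l (y i) ^ 2 := by rw [mul_assoc, abs_mul_abs_self]; ring
      _ ≤ 3 * (s * a i) ^ 2 := by gcongr
      _ = 3 * s ^ 2 * a i ^ 2 := by ring
      _ ≤ _ := by
        gcongr
        linarith [sq_le_one_add_pow_four (a i), sq_nonneg (g i)]
  rw [heq]
  exact (norm_avg_le_mul (by positivity) hbound h.avg_le).trans_eq (by ring)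

lemma avg_exp_neg_mul_inner_sub_sq (h₀ : tiltedMoment (fun t => Real.exp (-t)) y l = 0)
    (hν : ∀ d, avg (fun i => Real.exp (-inner ℝ l (y i)) * inner ℝ ν (y i) * inner ℝ d (y i))
      = avg fun i => inner ℝ d (y i)) :
    avg (fun i => Real.exp (-inner ℝ l (y i)) * inner ℝ (ν - l) (y i) ^ 2)
      = avg fun i => (1 - Real.exp (-inner ℝ l (y i)) * (1 + inner ℝ l (y i)))
          * inner ℝ (ν - l) (y i) := by
  have hl := avg_mul_inner_eq_zero_of_tiltedMoment_eq_zero h₀ (ν - l)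
  have hsplit : ∀ i, (1 - Real.exp (-inner ℝ l (y i)) * (1 + inner ℝ l (y i)))
      * inner ℝ (ν - l) (y i) = inner ℝ (ν - l) (y i)
        - Real.exp (-inner ℝ l (y i)) * inner ℝ (ν - l) (y i)
        - Real.exp (-inner ℝ l (y i)) * inner ℝ l (y i) * inner ℝ (ν - l) (y i) := fun i => by ring
  simp only [hsplit]
  rw [avg_sub, avg_sub, hl, sub_zero, ← hν (ν - l), ← avg_sub]
  congr 1 with i
  rw [inner_sub_left]
  ring

lemma norm_multiplier_sub_le (h : MomentBound y G a g K s) (hc : 0 < c)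
    (hpd : ∀ u : Vec m, c * ‖u‖ ^ 2 ≤ avg fun i => inner ℝ u (y i) ^ 2) (hl : ‖l‖ ≤ s)
    (h₀ : tiltedMoment (fun t => Real.exp (-t)) y l = 0)
    (hν : ∀ d, avg (fun i => Real.exp (-inner ℝ l (y i)) * inner ℝ ν (y i) * inner ℝ d (y i))
      = avg fun i => inner ℝ d (y i)) :
    ‖ν - l‖ ≤ 2 * K / c * s ^ 2 := by
  have hK := h.bound_nonneg
  have hlower : c / 2 * ‖ν - l‖ ^ 2
      ≤ avg fun i => Real.exp (-inner ℝ l (y i)) * inner ℝ (ν - l) (y i) ^ 2 :=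
    calc c / 2 * ‖ν - l‖ ^ 2 = 1 / 2 * (c * ‖ν - l‖ ^ 2) := by ring
      _ ≤ 1 / 2 * avg fun i => inner ℝ (ν - l) (y i) ^ 2 := by gcongr; exact hpd _
      _ = avg fun i => 1 / 2 * inner ℝ (ν - l) (y i) ^ 2 := (avg_mul_left _ _).symm
      _ ≤ _ := avg_mono fun i => by
        gcongr
        exact half_le_exp_neg (h.abs_inner_le_half hl i)
  have hupper : ‖avg fun i => (1 - Real.exp (-inner ℝ l (y i)) * (1 + inner ℝ l (y i)))
      * inner ℝ (ν - l) (y i)‖ ≤ s ^ 2 * ‖ν - l‖ * K := by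
    refine norm_avg_le_mul (by positivity) (fun i => ?_) h.avg_le
    have hsq := sq_le_sq' (neg_le_of_abs_le (abs_inner_le_mul hl (h.norm_le i)))
      (le_of_abs_le (abs_inner_le_mul hl (h.norm_le i)))
    rw [Real.norm_eq_abs, abs_mul]
    calc _ ≤ (s * a i) ^ 2 * (‖ν - l‖ * a i) :=
          mul_le_mul ((abs_one_sub_exp_neg_mul_one_add_le (h.abs_inner_le_half hl i)).trans hsq)
            (abs_inner_le_mul le_rfl (h.norm_le i)) (abs_nonneg _) (sq_nonneg _)
      _ = s ^ 2 * ‖ν - l‖ * a i ^ 3 := by ring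
      _ ≤ s ^ 2 * ‖ν - l‖ * (1 + a i ^ 4 + g i ^ 2) := by
        gcongr
        linarith [pow_three_le_one_add_pow_four (a i), sq_nonneg (g i)]
  rw [avg_exp_neg_mul_inner_sub_sq h₀ hν] at hlower
  rcases (norm_nonneg (ν - l)).eq_or_lt with hzero | hpos
  · rw [← hzero]
    positivity
  · have hcancel : c / 2 * ‖ν - l‖ ≤ s ^ 2 * K := by
      refine le_of_mul_le_mul_right ?_ hpos
      linarith [hlower.trans ((le_abs_self _).trans hupper)]
    rw [div_mul_eq_mul_div, le_div_iff₀ hc]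
    linarith

lemma norm_tiltedMoment_multiplier_le (h : MomentBound y G a g K s) (hA : 0 ≤ A) (hl : ‖l‖ ≤ s)
    (hνs : ‖ν‖ ≤ 2 * s) (hνl : ‖ν - l‖ ≤ A * s ^ 2)
    (hν : ∀ d, avg (fun i => Real.exp (-inner ℝ l (y i)) * inner ℝ ν (y i) * inner ℝ d (y i))
      = avg fun i => inner ℝ d (y i)) :
    ‖tiltedMoment (fun t => (1 + t)⁻¹) y ν‖ ≤ (18 + 2 * A) * K * s ^ 3 := by
  have hs : 0 ≤ s := (norm_nonneg l).trans hl
  have heq : tiltedMoment (fun t => (1 + t)⁻¹) y ν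
      = avg fun i => ((1 + inner ℝ ν (y i))⁻¹ - 1
          + Real.exp (-inner ℝ l (y i)) * inner ℝ ν (y i)) • y i := by
    refine ext_inner_left ℝ fun d => ?_
    simp only [inner_tiltedMoment, inner_avg, inner_smul_right, add_mul, sub_mul, one_mul]
    rw [avg_add, avg_sub, hν d, sub_add_cancel]
  rw [heq]
  refine (norm_avg_le_mul (c := (18 + 2 * A) * s ^ 3) (by positivity) (fun i => ?_)
    h.avg_le).trans_eq (by ring)
  have ha : 0 ≤ a i := (norm_nonneg _).trans (h.norm_le i)
  have hzx : |inner ℝ ν (y i) - inner ℝ l (y i)| ≤ A * s ^ 2 * a i := by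
    rw [← inner_sub_left]
    exact abs_inner_le_mul hνl (h.norm_le i)
  rw [norm_smul]
  calc _ ≤ 2 * s * a i * (s ^ 2 * (9 * a i ^ 2 + A * a i)) * a i :=
        mul_le_mul (abs_inv_one_add_sub_one_add_exp_neg_mul_le (abs_inner_le_mul hl (h.norm_le i))
          (abs_inner_le_mul hνs (h.norm_le i)) hzx (h.mul_le i)) (h.norm_le i) (norm_nonneg _)
          (by positivity)
    _ = (18 * a i ^ 4 + 2 * A * a i ^ 3) * s ^ 3 := by ring
    _ ≤ (18 * (1 + a i ^ 4 + g i ^ 2) + 2 * A * (1 + a i ^ 4 + g i ^ 2)) * s ^ 3 := by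
      gcongr
      · linarith [sq_nonneg (g i)]
      · linarith [pow_three_le_one_add_pow_four (a i), sq_nonneg (g i)]
    _ = _ := by ring

lemma abs_score_term_le (h : MomentBound y G a g K s) (hA : 0 ≤ A) (hs₁ : s ≤ 1) (hl : ‖l‖ ≤ s)
    (hνs : ‖ν‖ ≤ 2 * s) (hνl : ‖ν - l‖ ≤ A * s ^ 2) {M : ℝ} (hM : |M - 1| ≤ 3 * K * s ^ 2)
    (hM₂ : 1 / 2 ≤ M) (v : Vec k) (i : Fin n) :
    |((1 + inner ℝ ν (y i))⁻¹ - Real.exp (-inner ℝ l (y i)) - 1 + Real.exp (-inner ℝ l (y i)) / M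
        + Real.exp (-inner ℝ l (y i)) * inner ℝ ν (y i)) * inner ℝ ν (G i v)
      + (1 - Real.exp (-inner ℝ l (y i)) / M
        - Real.exp (-inner ℝ l (y i)) * inner ℝ ν (y i)) * inner ℝ (ν - l) (G i v)|
      ≤ (24 + 24 * K + A * (6 + 12 * K)) * s ^ 3 * ‖v‖ * (1 + a i ^ 4 + g i ^ 2) := by
  have hs : 0 ≤ s := (norm_nonneg l).trans hl
  have hK := h.bound_nonneg
  have ha : 0 ≤ a i := (norm_nonneg _).trans (h.norm_le i)
  have hx := abs_inner_le_mul hl (h.norm_le i)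
  have hz := abs_inner_le_mul hνs (h.norm_le i)
  calc _ ≤ s ^ 2 * (12 * a i ^ 2 + 12 * K) * (2 * s * (g i * ‖v‖))
        + s * (6 * a i + 12 * K) * (A * s ^ 2 * (g i * ‖v‖)) := by
        refine (abs_add_le _ _).trans ?_
        rw [abs_mul, abs_mul]
        exact add_le_add
          (mul_le_mul (abs_inv_one_add_sub_exp_neg_sub_one_add_le hx hz (h.mul_le i) hM hM₂)
            (abs_inner_apply_le_mul hνs (h.norm_deriv_le i) v) (abs_nonneg _) (by positivity))
          (mul_le_mul (abs_one_sub_exp_neg_div_sub_le hs hs₁ hK hx hz (h.mul_le i) hM hM₂)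
            (abs_inner_apply_le_mul hνl (h.norm_deriv_le i) v) (abs_nonneg _) (by positivity))
    _ = (24 * (a i ^ 2 * g i) + 24 * K * g i + A * (6 * (a i * g i) + 12 * K * g i))
          * s ^ 3 * ‖v‖ := by ring
    _ ≤ (24 * (1 + a i ^ 4 + g i ^ 2) + 24 * K * (1 + a i ^ 4 + g i ^ 2)
          + A * (6 * (1 + a i ^ 4 + g i ^ 2) + 12 * K * (1 + a i ^ 4 + g i ^ 2)))
          * s ^ 3 * ‖v‖ := by
      have hg : g i ≤ 1 + a i ^ 4 + g i ^ 2 := by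
        linarith [le_one_add_sq (g i), pow_nonneg ha 4]
      gcongr
      · linarith [sq_mul_le_pow_four_add_sq (a i) (g i)]
      · exact mul_le_one_add_pow_four_add_sq (a i) (g i)
    _ = _ := by ring

lemma abs_avg_score_multiplier_le (h : MomentBound y G a g K s) (hn : n ≠ 0) (hA : 0 ≤ A)
    (hs₁ : s ≤ 1) (hl : ‖l‖ ≤ s) (h₀ : tiltedMoment (fun t => Real.exp (-t)) y l = 0)
    (hνs : ‖ν‖ ≤ 2 * s) (hνl : ‖ν - l‖ ≤ A * s ^ 2) (v : Vec k)
    (hv : avg (fun i => (1 - Real.exp (-inner ℝ l (y i)) /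
          (avg fun j => Real.exp (-inner ℝ l (y j)))
        - Real.exp (-inner ℝ l (y i)) * inner ℝ ν (y i)) * inner ℝ l (G i v)
        + Real.exp (-inner ℝ l (y i)) * inner ℝ ν (G i v)) = 0) :
    |avg fun i => (1 + inner ℝ ν (y i))⁻¹ * inner ℝ ν (G i v)|
      ≤ (24 + 24 * K + A * (6 + 12 * K)) * K * s ^ 3 * ‖v‖ := by
  have hs : 0 ≤ s := (norm_nonneg l).trans hl
  have hK := h.bound_nonneg
  rw [← sub_zero (avg _), ← hv, ← avg_sub, ← Real.norm_eq_abs]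
  refine (norm_avg_le_mul (c := (24 + 24 * K + A * (6 + 12 * K)) * s ^ 3 * ‖v‖) (by positivity)
    (fun i => ?_) h.avg_le).trans_eq (by ring)
  refine le_of_eq_of_le ?_ (h.abs_score_term_le hA hs₁ hl hνs hνl
    (h.abs_avg_exp_neg_sub_one_le hn hl h₀) (h.half_le_avg_exp_neg hn hl) v i)
  rw [Real.norm_eq_abs, inner_sub_left]
  congr 1
  ring

end MomentBound

section Linearization

variable {k m : ℕ}

/- The system `Γ v - Ω u ≈ 0`, `Γ' u ≈ 0` is the linearization of the first-order conditions of EL;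
pairing its first equation with `u` controls `u`, and the injectivity of `Γ` then controls `v`. -/
lemma exists_norm_add_norm_le_of_linearized {Γ : Vec k →L[ℝ] Vec m} {Ω : Vec m →L[ℝ] Vec m}
    {c₁ c₂ : ℝ} (hc₁ : 0 < c₁) (hc₂ : 0 < c₂) (hΓ : ∀ v, c₁ * ‖v‖ ≤ ‖Γ v‖)
    (hΩ : ∀ u, c₂ * ‖u‖ ^ 2 ≤ inner ℝ (Ω u) u) :
    ∃ A > 0, ∀ (v : Vec k) (u : Vec m) (q : ℝ), 0 ≤ q → ‖Γ v - Ω u‖ ≤ q →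
      (∀ w, |inner ℝ u (Γ w)| ≤ q * ‖w‖) → ‖v‖ + ‖u‖ ≤ A * q := by
  set β := ‖Ω‖ / c₁ + 1 with hβ
  refine ⟨1 / c₁ + β * (1 + (1 / c₁ + β) / c₂), by positivity, fun v u q hq hvu hu => ?_⟩
  have hsq : c₂ * ‖u‖ ^ 2 ≤ q * (‖v‖ + ‖u‖) := by
    have hpair : inner ℝ (Ω u) u = inner ℝ u (Γ v) - inner ℝ (Γ v - Ω u) u := by
      rw [inner_sub_left, real_inner_comm u (Γ v), sub_sub_cancel]
    linarith [hΩ u, le_of_abs_le (hu v), neg_le_of_abs_le (abs_inner_le_mul hvu (le_refl ‖u‖))]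
  have hadd : ‖v‖ + ‖u‖ ≤ 1 / c₁ * q + β * ‖u‖ := by
    have hv : c₁ * ‖v‖ ≤ q + ‖Ω‖ * ‖u‖ := by
      have htri : ‖Γ v‖ ≤ ‖Γ v - Ω u‖ + ‖Ω u‖ := by simpa using norm_add_le (Γ v - Ω u) (Ω u)
      linarith [hΓ v, Ω.le_opNorm u]
    have hv' : ‖v‖ ≤ (q + ‖Ω‖ * ‖u‖) / c₁ := by rwa [le_div_iff₀' hc₁]
    calc ‖v‖ + ‖u‖ ≤ (q + ‖Ω‖ * ‖u‖) / c₁ + ‖u‖ := by gcongr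
      _ = _ := by rw [hβ]; ring
  have hu_le : ‖u‖ ≤ (1 + (1 / c₁ + β) / c₂) * q := by
    rcases le_or_gt ‖u‖ q with hle | hlt
    · have : 0 ≤ (1 / c₁ + β) / c₂ * q := by positivity
      linarith
    · have hupos : 0 < ‖u‖ := hq.trans_lt hlt
      have hcancel : c₂ * ‖u‖ ≤ q * (1 / c₁ + β) := by
        refine le_of_mul_le_mul_right ?_ hupos
        calc c₂ * ‖u‖ * ‖u‖ = c₂ * ‖u‖ ^ 2 := by ring
          _ ≤ q * (1 / c₁ * q + β * ‖u‖) := hsq.trans (by gcongr)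
          _ ≤ q * (1 / c₁ * ‖u‖ + β * ‖u‖) := by gcongr
          _ = _ := by ring
      have hdiv : ‖u‖ ≤ q * (1 / c₁ + β) / c₂ := by rwa [le_div_iff₀' hc₂]
      calc ‖u‖ ≤ q * (1 / c₁ + β) / c₂ := hdiv
        _ ≤ q + q * (1 / c₁ + β) / c₂ := le_add_of_nonneg_left hq
        _ = _ := by ring
  calc ‖v‖ + ‖u‖ ≤ 1 / c₁ * q + β * ((1 + (1 / c₁ + β) / c₂) * q) := hadd.trans (by gcongr)
    _ = _ := by ring

variable {y₁ y₂ y₀ l₁ l₂ : Vec m} {a d r s : ℝ}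

lemma abs_inv_one_add_inner_sub_le (h₁ : ‖y₁‖ ≤ a) (h₂ : ‖y₂‖ ≤ a) (h₁₂ : ‖y₂ - y₁‖ ≤ d)
    (hl₁ : ‖l₁‖ ≤ s) (hl₂ : ‖l₂‖ ≤ s) (hsa : s * a ≤ 1 / 4) :
    |(1 + inner ℝ l₂ y₂)⁻¹ - (1 + inner ℝ l₁ y₁)⁻¹| ≤ 4 * (‖l₂ - l₁‖ * a + s * d) := by
  have hz₁ := abs_inner_le_mul hl₁ h₁
  have hz₂ := abs_inner_le_mul hl₂ h₂
  have hdiff : inner ℝ l₂ y₂ - inner ℝ l₁ y₁ = inner ℝ (l₂ - l₁) y₂ + inner ℝ l₁ (y₂ - y₁) := by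
    rw [inner_sub_left, inner_sub_right, sub_add_sub_cancel]
  refine (abs_inv_one_add_sub_le (by linarith) (by linarith)).trans ?_
  rw [hdiff]
  gcongr
  exact (abs_add_le _ _).trans
    (add_le_add (abs_inner_le_mul le_rfl h₂) (abs_inner_le_mul hl₁ h₁₂))

lemma norm_smul_sub_smul_le (h₂ : ‖y₂‖ ≤ a) (h₁₂ : ‖y₂ - y₁‖ ≤ d) {τ₁ τ₂ η c : ℝ}
    (hτ : |τ₂ - τ₁| ≤ η) (hτ₁ : |τ₁| ≤ c) :
    ‖τ₂ • y₂ - τ₁ • y₁‖ ≤ η * a + c * d := by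
  have heq : τ₂ • y₂ - τ₁ • y₁ = (τ₂ - τ₁) • y₂ + τ₁ • (y₂ - y₁) := by module
  rw [heq]
  refine (norm_add_le _ _).trans ?_
  rw [norm_smul, norm_smul]
  exact add_le_add (mul_le_mul hτ h₂ (norm_nonneg _) ((abs_nonneg _).trans hτ))
    (mul_le_mul hτ₁ h₁₂ (norm_nonneg _) ((abs_nonneg _).trans hτ₁))

lemma norm_inner_mul_smul_sub_le (h₀ : ‖y₀‖ ≤ a) (h₂ : ‖y₂‖ ≤ a) (h₂₀ : ‖y₂ - y₀‖ ≤ r) {τ η : ℝ}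
    (hτ : |τ - 1| ≤ η) (u : Vec m) :
    ‖(inner ℝ u y₂ * τ) • y₂ - inner ℝ u y₀ • y₀‖ ≤ ‖u‖ * (η * a ^ 2 + 2 * (a * r)) := by
  have hcoeff : |inner ℝ u y₂ * τ - inner ℝ u y₀| ≤ ‖u‖ * (a * η + r) := by
    have heq : inner ℝ u y₂ * τ - inner ℝ u y₀
        = inner ℝ u y₂ * (τ - 1) + inner ℝ u (y₂ - y₀) := by rw [inner_sub_right]; ring
    rw [heq]
    calc _ ≤ ‖u‖ * a * η + ‖u‖ * r := by
          refine (abs_add_le _ _).trans (add_le_add ?_ (abs_inner_le_mul le_rfl h₂₀))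
          rw [abs_mul]
          exact mul_le_mul (abs_inner_le_mul le_rfl h₂) hτ (abs_nonneg _)
            ((abs_nonneg _).trans (abs_inner_le_mul le_rfl h₂))
      _ = _ := by ring
  exact (norm_smul_sub_smul_le h₂ h₂₀ hcoeff (abs_inner_le_mul le_rfl h₀)).trans_eq (by ring)

lemma norm_inner_mul_smul_add_le (h₁ : ‖y₁‖ ≤ a) (h₂ : ‖y₂‖ ≤ a) (h₁₂ : ‖y₂ - y₁‖ ≤ d)
    (hl₁ : ‖l₁‖ ≤ s) (hl₂ : ‖l₂‖ ≤ s) (hsa : s * a ≤ 1 / 4) :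
    ‖(inner ℝ l₁ (y₂ - y₁) * (1 + inner ℝ l₂ y₂)⁻¹) • y₂
        + inner ℝ l₁ y₁ • ((1 + inner ℝ l₂ y₂)⁻¹ • y₂ - (1 + inner ℝ l₁ y₁)⁻¹ • y₁)‖
      ≤ 4 * s * (a ^ 3 * ‖l₂ - l₁‖ + a * d + s * (a ^ 2 * d)) := by
  have hs : 0 ≤ s := (norm_nonneg _).trans hl₁
  have hd : 0 ≤ d := (norm_nonneg _).trans h₁₂
  have ha : 0 ≤ a := (norm_nonneg _).trans h₁
  have hz₁ := abs_inner_le_mul hl₁ h₁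
  have hz₂ := abs_inner_le_mul hl₂ h₂
  have hτ₁ : |(1 + inner ℝ l₁ y₁)⁻¹| ≤ 2 := by
    rw [abs_of_pos (inv_one_add_pos (by linarith))]
    exact inv_one_add_le_two (by linarith)
  have hτ₂ : |(1 + inner ℝ l₂ y₂)⁻¹| ≤ 2 := by
    rw [abs_of_pos (inv_one_add_pos (by linarith))]
    exact inv_one_add_le_two (by linarith)
  have hfirst : ‖(inner ℝ l₁ (y₂ - y₁) * (1 + inner ℝ l₂ y₂)⁻¹) • y₂‖ ≤ s * d * 2 * a := by
    rw [norm_smul, Real.norm_eq_abs, abs_mul]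
    exact mul_le_mul (mul_le_mul (abs_inner_le_mul hl₁ h₁₂) hτ₂ (abs_nonneg _) (by positivity))
      h₂ (norm_nonneg _) (by positivity)
  have hsecond : ‖inner ℝ l₁ y₁ • ((1 + inner ℝ l₂ y₂)⁻¹ • y₂ - (1 + inner ℝ l₁ y₁)⁻¹ • y₁)‖
      ≤ s * a * (4 * (‖l₂ - l₁‖ * a + s * d) * a + 2 * d) := by
    rw [norm_smul]
    exact mul_le_mul hz₁ (norm_smul_sub_smul_le h₂ h₁₂
      (abs_inv_one_add_inner_sub_le h₁ h₂ h₁₂ hl₁ hl₂ hsa) hτ₁) (norm_nonneg _) (by positivity)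
  exact ((norm_add_le _ _).trans (add_le_add hfirst hsecond)).trans_eq (by ring)

lemma inv_one_add_smul_sub_sub_eq (h₁ : 1 + inner ℝ l₁ y₁ ≠ 0) (h₂ : 1 + inner ℝ l₂ y₂ ≠ 0)
    (z : Vec m) :
    ((1 + inner ℝ l₂ y₂)⁻¹ • y₂ - (1 + inner ℝ l₁ y₁)⁻¹ • y₁)
        - (z - inner ℝ (l₂ - l₁) y₀ • y₀)
      = (y₂ - y₁ - z)
        - ((inner ℝ (l₂ - l₁) y₂ * (1 + inner ℝ l₂ y₂)⁻¹) • y₂ - inner ℝ (l₂ - l₁) y₀ • y₀)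
        - ((inner ℝ l₁ (y₂ - y₁) * (1 + inner ℝ l₂ y₂)⁻¹) • y₂
          + inner ℝ l₁ y₁ • ((1 + inner ℝ l₂ y₂)⁻¹ • y₂ - (1 + inner ℝ l₁ y₁)⁻¹ • y₁)) := by
  have hexpand : ∀ {l y : Vec m}, 1 + inner ℝ l y ≠ 0 →
      y = (1 + inner ℝ l y)⁻¹ • y + (inner ℝ l y * (1 + inner ℝ l y)⁻¹) • y := fun h => by
    rw [← add_smul, ← one_add_mul, mul_inv_cancel₀ h, one_smul]
  set τ₁ := (1 + inner ℝ l₁ y₁)⁻¹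
  set τ₂ := (1 + inner ℝ l₂ y₂)⁻¹
  have hcoeff : inner ℝ l₂ y₂ = inner ℝ (l₂ - l₁) y₂ + inner ℝ l₁ (y₂ - y₁) + inner ℝ l₁ y₁ := by
    rw [inner_sub_left, inner_sub_right]
    ring
  have hy₁ : τ₁ • y₁ = y₁ - (inner ℝ l₁ y₁ * τ₁) • y₁ := eq_sub_of_add_eq (hexpand h₁).symm
  have hy₂ : τ₂ • y₂ = y₂ - (inner ℝ l₂ y₂ * τ₂) • y₂ := eq_sub_of_add_eq (hexpand h₂).symm
  rw [hcoeff] at hy₂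
  rw [smul_sub, smul_smul, smul_smul]
  nth_rewrite 1 [hy₁, hy₂]
  module

variable {v : Vec k} {g b t : ℝ}

lemma norm_inv_one_add_smul_sub_linear_le (h₁ : ‖y₁‖ ≤ a) (h₂ : ‖y₂‖ ≤ a) (h₀ : ‖y₀‖ ≤ a)
    (h₁₂ : ‖y₂ - y₁‖ ≤ g * ‖v‖) (h₂₀ : ‖y₂ - y₀‖ ≤ g * t) {z : Vec m}
    (hz : ‖y₂ - y₁ - z‖ ≤ b * t * ‖v‖) (hl₁ : ‖l₁‖ ≤ s) (hl₂ : ‖l₂‖ ≤ s) (hsa : s * a ≤ 1 / 4)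
    (hs₁ : s ≤ 1) (ht : 0 ≤ t) (hb : 0 ≤ b) :
    ‖((1 + inner ℝ l₂ y₂)⁻¹ • y₂ - (1 + inner ℝ l₁ y₁)⁻¹ • y₁)
        - (z - inner ℝ (l₂ - l₁) y₀ • y₀)‖
      ≤ 8 * (s + t) * (‖v‖ + ‖l₂ - l₁‖) * (1 + a ^ 4 + g ^ 2 + b) := by
  have hs : 0 ≤ s := (norm_nonneg _).trans hl₁
  have hz₁ := abs_inner_le_mul hl₁ h₁
  have hz₂ := abs_inner_le_mul hl₂ h₂
  have hτ₂ : |(1 + inner ℝ l₂ y₂)⁻¹ - 1| ≤ 2 * (s * a) :=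
    (abs_inv_one_add_sub_one_le (by linarith)).trans (by linarith)
  set u := l₂ - l₁
  set D := 1 + a ^ 4 + g ^ 2
  have hD : 0 ≤ D := by positivity
  rw [inv_one_add_smul_sub_sub_eq (inv_pos.1 (inv_one_add_pos (by linarith))).ne'
    (inv_pos.1 (inv_one_add_pos (by linarith))).ne']
  calc _ ≤ b * t * ‖v‖ + ‖u‖ * (2 * (s * a) * a ^ 2 + 2 * (a * (g * t)))
        + 4 * s * (a ^ 3 * ‖u‖ + a * (g * ‖v‖) + s * (a ^ 2 * (g * ‖v‖))) :=
        norm_sub_le_of_le (norm_sub_le_of_le hz (norm_inner_mul_smul_sub_le h₀ h₂ h₂₀ hτ₂ u))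
          (norm_inner_mul_smul_add_le h₁ h₂ h₁₂ hl₁ hl₂ hsa)
    _ = b * (t * ‖v‖) + a ^ 3 * (6 * s * ‖u‖) + a * g * (2 * t * ‖u‖ + 4 * s * ‖v‖)
        + a ^ 2 * g * (4 * s * (s * ‖v‖)) := by ring
    _ ≤ (D + b) * (t * ‖v‖) + (D + b) * (6 * s * ‖u‖)
        + (D + b) * (2 * t * ‖u‖ + 4 * s * ‖v‖) + (D + b) * (4 * s * (1 * ‖v‖)) := by
      have := pow_three_le_one_add_pow_four a
      have := mul_le_one_add_pow_four_add_sq a g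
      have := sq_mul_le_pow_four_add_sq a g
      gcongr <;> linarith [sq_nonneg g]
    _ = 8 * (s + t) * (‖v‖ + ‖u‖) * (D + b) - (D + b) *
          (2 * (s * ‖u‖) + 7 * (t * ‖v‖) + 6 * (t * ‖u‖)) := by ring
    _ ≤ _ := sub_le_self _ (by positivity)

variable {G₁ G₂ G₀ : Vec k →L[ℝ] Vec m}

lemma abs_inv_one_add_mul_inner_sub_linear_le (h₁ : ‖y₁‖ ≤ a) (h₂ : ‖y₂‖ ≤ a)
    (h₁₂ : ‖y₂ - y₁‖ ≤ g * ‖v‖) (hG₁ : ‖G₁‖ ≤ g) (hG₂ : ‖G₂‖ ≤ g)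
    (hG₁₂ : ‖G₂ - G₁‖ ≤ b * ‖v‖) (hG₂₀ : ‖G₂ - G₀‖ ≤ b * t) (hl₁ : ‖l₁‖ ≤ s) (hl₂ : ‖l₂‖ ≤ s)
    (hsa : s * a ≤ 1 / 4) (hs₁ : s ≤ 1) (ht : 0 ≤ t) (hb : 0 ≤ b) (w : Vec k) :
    |((1 + inner ℝ l₂ y₂)⁻¹ * inner ℝ l₂ (G₂ w) - (1 + inner ℝ l₁ y₁)⁻¹ * inner ℝ l₁ (G₁ w))
        - inner ℝ (l₂ - l₁) (G₀ w)|
      ≤ 8 * (s + t) * (‖v‖ + ‖l₂ - l₁‖) * ‖w‖ * (1 + a ^ 4 + g ^ 2 + b) := by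
  have ha : 0 ≤ a := (norm_nonneg _).trans h₁
  have hg : 0 ≤ g := (norm_nonneg _).trans hG₁
  have hs : 0 ≤ s := (norm_nonneg _).trans hl₁
  have hz₂ := abs_inner_le_mul hl₂ h₂
  have hτ := abs_inv_one_add_inner_sub_le h₁ h₂ h₁₂ hl₁ hl₂ hsa
  have hτ₂ : |(1 + inner ℝ l₂ y₂)⁻¹ - 1| ≤ 2 * (s * a) :=
    (abs_inv_one_add_sub_one_le (by linarith)).trans (by linarith)
  have hτ₂' : |(1 + inner ℝ l₂ y₂)⁻¹| ≤ 2 := by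
    rw [abs_of_pos (inv_one_add_pos (by linarith))]
    exact inv_one_add_le_two (by linarith)
  set u := l₂ - l₁ with hu
  set τ₁ := (1 + inner ℝ l₁ y₁)⁻¹
  set τ₂ := (1 + inner ℝ l₂ y₂)⁻¹
  set D := 1 + a ^ 4 + g ^ 2
  have hD : 0 ≤ D := by positivity
  have hsplit : (τ₂ * inner ℝ l₂ (G₂ w) - τ₁ * inner ℝ l₁ (G₁ w)) - inner ℝ u (G₀ w)
      = (τ₂ - 1) * inner ℝ u (G₂ w) + inner ℝ u ((G₂ - G₀) w) + τ₂ * inner ℝ l₁ ((G₂ - G₁) w)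
        + (τ₂ - τ₁) * inner ℝ l₁ (G₁ w) := by
    simp only [sub_apply, inner_sub_right, hu, inner_sub_left]
    ring
  rw [hsplit]
  calc _ ≤ 2 * (s * a) * (‖u‖ * (g * ‖w‖)) + ‖u‖ * (b * t * ‖w‖) + 2 * (s * (b * ‖v‖ * ‖w‖))
        + 4 * (‖u‖ * a + s * (g * ‖v‖)) * (s * (g * ‖w‖)) := by
        refine (abs_add_le _ _).trans (add_le_add ((abs_add_le _ _).trans (add_le_add
          ((abs_add_le _ _).trans (add_le_add ?_ (abs_inner_apply_le_mul le_rfl hG₂₀ w))) ?_)) ?_)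
        all_goals rw [abs_mul]
        · exact mul_le_mul hτ₂ (abs_inner_apply_le_mul le_rfl hG₂ w) (abs_nonneg _) (by positivity)
        · exact mul_le_mul hτ₂' (abs_inner_apply_le_mul hl₁ hG₁₂ w) (abs_nonneg _) (by norm_num)
        · exact mul_le_mul hτ (abs_inner_apply_le_mul hl₁ hG₁ w) (abs_nonneg _) (by positivity)
    _ = ‖w‖ * (a * g * (6 * s * ‖u‖) + b * (t * ‖u‖ + 2 * s * ‖v‖)
        + g ^ 2 * (4 * s * (s * ‖v‖))) := by ring
    _ ≤ ‖w‖ * ((D + b) * (6 * s * ‖u‖) + (D + b) * (t * ‖u‖ + 2 * s * ‖v‖)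
        + (D + b) * (4 * s * (1 * ‖v‖))) := by
      have := mul_le_one_add_pow_four_add_sq a g
      have : g ^ 2 ≤ D := by simp only [D]; linarith [pow_nonneg ha 4]
      gcongr <;> linarith [pow_nonneg ha 4, sq_nonneg g]
    _ = 8 * (s + t) * (‖v‖ + ‖u‖) * ‖w‖ * (D + b)
        - ‖w‖ * (D + b) * (2 * (s * (‖u‖ + ‖v‖)) + t * (8 * ‖v‖ + 7 * ‖u‖)) := by ring
    _ ≤ _ := sub_le_self _ (by positivity)

end Linearization

section Discrepancy

variable {n m : ℕ} {y : Fin n → Vec m} {w : Fin n → ℝ}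

lemma avg_log_one_add_inner_le_discrepancy_hEL (hn : n ≠ 0) (hw : w ∈ weightSet (Set.Ioi 0) y)
    {l : Vec m} (hl : ∀ i, 0 < 1 + inner ℝ l (y i)) :
    avg (fun i => Real.log (1 + inner ℝ l (y i))) ≤ discrepancy hEL w := by
  have hlog : ∀ i, Real.log (1 + inner ℝ l (y i)) - hEL (n * w i)
      ≤ n * w i + n * w i * inner ℝ l (y i) - 1 := fun i => by
    have hpos : 0 < n * w i := mul_pos (Nat.cast_pos.2 (Nat.pos_of_ne_zero hn)) (hw.1 i)
    have hle := Real.log_le_sub_one_of_pos (mul_pos hpos (hl i))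
    rw [Real.log_mul hpos.ne' (hl i).ne'] at hle
    rw [hEL]
    linarith
  have havg := avg_mono hlog
  rw [avg_sub, avg_sub, avg_add, avg_natCast_mul_of_mem_weightSet hn hw,
    avg_natCast_mul_mul_inner_of_mem_weightSet hw, avg_const hn] at havg
  have hdis : discrepancy hEL w = avg fun i => hEL (n * w i) := by
    simp only [discrepancy, avg, smul_eq_mul]
  linarith

lemma sub_two_mul_sq_le_log_one_add {t : ℝ} (ht : |t| ≤ 1 / 2) :
    t - 2 * t ^ 2 ≤ Real.log (1 + t) := by
  have hpos : 0 < 1 + t := inv_pos.1 (inv_one_add_pos ht)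
  have hinv : 1 - (1 + t)⁻¹ = t - (1 + t)⁻¹ * t ^ 2 := by
    field_simp
    ring
  have hlog := Real.one_sub_inv_le_log_of_pos hpos
  have hmul : (1 + t)⁻¹ * t ^ 2 ≤ 2 * t ^ 2 := by
    gcongr
    exact inv_one_add_le_two ht
  linarith

/- The inner problem is bounded below by its dual, evaluated at a multiplier of norm `r` in the
direction of `avg y`. -/
lemma mul_norm_avg_le_discrepancy_hEL_add (hn : n ≠ 0) (hw : w ∈ weightSet (Set.Ioi 0) y) {r : ℝ}
    (hr : 0 ≤ r) (hy : ∀ i, r * ‖y i‖ ≤ 1 / 2) :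
    r * ‖avg y‖ ≤ discrepancy hEL w + 2 * r ^ 2 * avg fun i => ‖y i‖ ^ 2 := by
  set l : Vec m := (r * ‖avg y‖⁻¹) • avg y with hl
  have hl_norm : ‖l‖ ≤ r := by
    rw [hl, norm_smul, Real.norm_of_nonneg (by positivity), mul_assoc]
    exact mul_le_of_le_one_right hr inv_mul_le_one
  have hl_inner : inner ℝ l (avg y) = r * ‖avg y‖ := by
    rw [hl, real_inner_smul_left, real_inner_self_eq_norm_sq]
    rcases eq_or_ne ‖avg y‖ 0 with h₀ | h₀
    · simp [h₀]
    · field_simp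
  have hly : ∀ i, |inner ℝ l (y i)| ≤ 1 / 2 := fun i =>
    (abs_inner_le_mul hl_norm le_rfl).trans (hy i)
  have hsq : avg (fun i => 2 * inner ℝ l (y i) ^ 2) ≤ 2 * r ^ 2 * avg fun i => ‖y i‖ ^ 2 := by
    rw [← avg_mul_left]
    refine avg_mono fun i => ?_
    have habs := abs_inner_le_mul hl_norm (le_refl ‖y i‖)
    have := sq_le_sq' (neg_le_of_abs_le habs) (le_of_abs_le habs)
    rw [mul_pow] at this
    linarith
  have hlog := (avg_mono fun i => sub_two_mul_sq_le_log_one_add (hly i)).trans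
    (avg_log_one_add_inner_le_discrepancy_hEL hn hw fun i => inv_pos.1 (inv_one_add_pos (hly i)))
  rw [avg_sub, ← inner_avg, hl_inner] at hlog
  linarith

end Discrepancy

section Scale

lemma eventually_mul_inv_sqrt_lt (A : ℝ) {δ : ℝ} (hδ : 0 < δ) :
    ∀ᶠ n : ℕ in atTop, A * (√n)⁻¹ < δ := by
  have hlim : Tendsto (fun n : ℕ => A * (√n)⁻¹) atTop (𝓝 (A * 0)) :=
    (Real.tendsto_sqrt_atTop.comp tendsto_natCast_atTop_atTop).inv_tendsto_atTop.const_mul A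
  rw [mul_zero] at hlim
  exact hlim.eventually_lt_const hδ

lemma inv_sqrt_sq_mul_self {n : ℕ} (hn : n ≠ 0) : (√n)⁻¹ ^ 2 * n = 1 := by
  rw [inv_pow, Real.sq_sqrt n.cast_nonneg, inv_mul_cancel₀ (Nat.cast_ne_zero.2 hn)]

lemma eventually_mul_inv_sqrt_pow_four_mul_le (S K : ℝ) {δ : ℝ} (hδ : 0 < δ) :
    ∀ᶠ n : ℕ in atTop, (S * (√n)⁻¹) ^ 4 * (n * K) ≤ δ := by
  filter_upwards [eventually_ne_atTop 0, eventually_mul_inv_sqrt_lt (S ^ 4 * K) hδ,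
    eventually_mul_inv_sqrt_lt 1 one_pos] with n hn hS hone
  have : 0 ≤ (√n)⁻¹ := by positivity
  calc (S * (√n)⁻¹) ^ 4 * (n * K)
      = S ^ 4 * K * (√n)⁻¹ * (√n)⁻¹ * ((√n)⁻¹ ^ 2 * n) := by ring
    _ = S ^ 4 * K * (√n)⁻¹ * (√n)⁻¹ := by rw [inv_sqrt_sq_mul_self hn, mul_one]
    _ ≤ δ * (√n)⁻¹ := by gcongr
    _ ≤ δ := by nlinarith

end Scale

/-- `y` is `C¹` on the ball of radius `ρ` around `θs`, where `a` bounds its norm, `g` the norm of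
its derivative and `b` the Lipschitz constant of its derivative. -/
structure LocalBound {k m : ℕ} (y : Vec k → Vec m) (θs : Vec k) (ρ a g b : ℝ) : Prop where
  contDiffOn : ContDiffOn ℝ 1 y (Metric.ball θs ρ)
  norm_le : ∀ θ ∈ Metric.ball θs ρ, ‖y θ‖ ≤ a
  norm_fderiv_le : ∀ θ ∈ Metric.ball θs ρ, ‖fderiv ℝ y θ‖ ≤ g
  nonneg : 0 ≤ b
  norm_fderiv_sub_le : ∀ θ₁ ∈ Metric.ball θs ρ, ∀ θ₂ ∈ Metric.ball θs ρ,
    ‖fderiv ℝ y θ₁ - fderiv ℝ y θ₂‖ ≤ b * ‖θ₁ - θ₂‖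

namespace LocalBound

variable {k m : ℕ} {y : Vec k → Vec m} {θs θ θ₁ θ₂ : Vec k} {ρ a g b : ℝ}

lemma hasStrictFDerivAt (h : LocalBound y θs ρ a g b) (hθ : θ ∈ Metric.ball θs ρ) :
    HasStrictFDerivAt y (fderiv ℝ y θ) θ :=
  (h.contDiffOn.contDiffAt (Metric.isOpen_ball.mem_nhds hθ)).hasStrictFDerivAt one_ne_zero

lemma norm_sub_le (h : LocalBound y θs ρ a g b) (h₁ : θ₁ ∈ Metric.ball θs ρ)
    (h₂ : θ₂ ∈ Metric.ball θs ρ) : ‖y θ₂ - y θ₁‖ ≤ g * ‖θ₂ - θ₁‖ :=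
  (convex_ball θs ρ).norm_image_sub_le_of_norm_fderiv_le
    (fun _ hθ => (h.hasStrictFDerivAt hθ).differentiableAt) h.norm_fderiv_le h₁ h₂

lemma norm_sub_sub_fderiv_le (h : LocalBound y θs ρ a g b) {t : ℝ} (ht : t < ρ)
    (h₁ : ‖θ₁ - θs‖ ≤ t) (h₂ : ‖θ₂ - θs‖ ≤ t) :
    ‖y θ₂ - y θ₁ - fderiv ℝ y θs (θ₂ - θ₁)‖ ≤ b * t * ‖θ₂ - θ₁‖ := by
  have ht₀ : 0 ≤ t := (norm_nonneg _).trans h₁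
  have hsub : Metric.closedBall θs t ⊆ Metric.ball θs ρ := Metric.closedBall_subset_ball ht
  refine (convex_closedBall θs t).norm_image_sub_le_of_norm_fderiv_le'
    (fun _ hθ => (h.hasStrictFDerivAt (hsub hθ)).differentiableAt) (fun θ hθ => ?_)
    (mem_closedBall_iff_norm.2 h₁) (mem_closedBall_iff_norm.2 h₂)
  exact (h.norm_fderiv_sub_le θ (hsub hθ) θs (hsub (Metric.mem_closedBall_self ht₀))).trans
    (mul_le_mul_of_nonneg_left (mem_closedBall_iff_norm.1 hθ) h.nonneg)

lemma abs_inner_sq_sub_inner_sq_le (h : LocalBound y θs ρ a g b) (h₁ : θ₁ ∈ Metric.ball θs ρ)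
    (h₂ : θ₂ ∈ Metric.ball θs ρ) (u : Vec m) :
    |inner ℝ u (y θ₂) ^ 2 - inner ℝ u (y θ₁) ^ 2| ≤ 2 * ‖θ₂ - θ₁‖ * ‖u‖ ^ 2 * (a * g) := by
  have hg : 0 ≤ g := (norm_nonneg _).trans (h.norm_fderiv_le θ₁ h₁)
  have hsub : |inner ℝ u (y θ₂ - y θ₁)| ≤ ‖u‖ * (g * ‖θ₂ - θ₁‖) :=
    abs_inner_le_mul le_rfl (h.norm_sub_le h₁ h₂)
  have hadd : |inner ℝ u (y θ₂ + y θ₁)| ≤ ‖u‖ * (a + a) :=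
    abs_inner_le_mul le_rfl (norm_add_le_of_le (h.norm_le θ₂ h₂) (h.norm_le θ₁ h₁))
  calc |inner ℝ u (y θ₂) ^ 2 - inner ℝ u (y θ₁) ^ 2|
      = |inner ℝ u (y θ₂ - y θ₁)| * |inner ℝ u (y θ₂ + y θ₁)| := by
        rw [← abs_mul, inner_sub_right, inner_add_right]
        ring_nf
    _ ≤ ‖u‖ * (g * ‖θ₂ - θ₁‖) * (‖u‖ * (a + a)) := by gcongr
    _ = _ := by ring

end LocalBound

/-- A sample whose averages are close to their limits. Here `Y θ i` stands for `g(xᵢ, θ)`, the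
limits of the averages of its Jacobian and of its outer product at `θs` are `Γ` and `Ω`, and `e`
bounds the moment functions on all of `Θ`. -/
structure GoodSample {n k m : ℕ} (Y : Vec k → Fin n → Vec m) (Θ : Set (Vec k)) (θs : Vec k)
    (Γ : Vec k →L[ℝ] Vec m) (Ω : Vec m →L[ℝ] Vec m) (ρ c₀ K κ : ℝ) (a g b e : Fin n → ℝ) :
    Prop where
  localBound : ∀ i, LocalBound (fun θ => Y θ i) θs ρ (a i) (g i) (b i)
  avg_le : avg (fun i => 1 + a i ^ 4 + g i ^ 2 + b i) ≤ K
  norm_le_envelope : ∀ i, ∀ θ ∈ Θ, ‖Y θ i‖ ≤ e i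
  avg_envelope_sq_le : avg (fun i => e i ^ 2) ≤ K
  le_norm_avg : ∀ θ ∈ Θ, ρ / 2 ≤ ‖θ - θs‖ → c₀ ≤ ‖avg (Y θ)‖
  norm_avg_fderiv_sub_le : ‖avg (fun i => fderiv ℝ (fun θ => Y θ i) θs) - Γ‖ ≤ κ
  norm_avg_inner_smul_sub_le :
    ∀ u, ‖avg (fun i => inner ℝ u (Y θs i) • Y θs i) - Ω u‖ ≤ κ * ‖u‖

/-- Constants quantifying the invertibility of the linearized first-order conditions of EL, and a
radius `ρ` and a tolerance `κ` that are small relative to them and to the moment bound `K`. -/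
structure Calibration {k m : ℕ} (Γ : Vec k →L[ℝ] Vec m) (Ω : Vec m →L[ℝ] Vec m)
    (ρ c₁ c₂ A K κ : ℝ) : Prop where
  radius_pos : 0 < ρ
  pos₁ : 0 < c₁
  pos₂ : 0 < c₂
  bound_pos : 0 < K
  tol_nonneg : 0 ≤ κ
  mul_norm_le : ∀ v, c₁ * ‖v‖ ≤ ‖Γ v‖
  mul_norm_sq_le : ∀ u, c₂ * ‖u‖ ^ 2 ≤ inner ℝ (Ω u) u
  norm_add_norm_le : ∀ (v : Vec k) (u : Vec m) (q : ℝ), 0 ≤ q → ‖Γ v - Ω u‖ ≤ q →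
    (∀ w, |inner ℝ u (Γ w)| ≤ q * ‖w‖) → ‖v‖ + ‖u‖ ≤ A * q
  tol_le₁ : κ ≤ c₁ / 4
  tol_le₂ : κ ≤ c₂ / 4
  mul_tol_le : A * κ ≤ 1 / 4
  mul_radius_le : K * ρ ≤ c₁ / 4

namespace GoodSample

variable {n k m : ℕ} {Y : Vec k → Fin n → Vec m} {Θ : Set (Vec k)} {θs θ : Vec k}
  {Γ : Vec k →L[ℝ] Vec m} {Ω : Vec m →L[ℝ] Vec m} {ρ c₀ c₁ c₂ A K κ : ℝ} {a g b e : Fin n → ℝ}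

lemma avg_lipschitz_le (hY : GoodSample Y Θ θs Γ Ω ρ c₀ K κ a g b e) : avg b ≤ K :=
  (avg_mono fun i => le_add_of_nonneg_left (by positivity)).trans hY.avg_le

lemma avg_one_add_le (hY : GoodSample Y Θ θs Γ Ω ρ c₀ K κ a g b e) :
    avg (fun i => 1 + a i ^ 4 + g i ^ 2) ≤ K :=
  (avg_mono fun i => le_add_of_nonneg_right (hY.localBound i).nonneg).trans hY.avg_le

lemma norm_avg_fderiv_apply_sub_le (hY : GoodSample Y Θ θs Γ Ω ρ c₀ K κ a g b e) (v : Vec k) :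
    ‖avg (fun i => fderiv ℝ (fun θ => Y θ i) θs v) - Γ v‖ ≤ κ * ‖v‖ := by
  have hle := ContinuousLinearMap.le_of_opNorm_le _ hY.norm_avg_fderiv_sub_le v
  rwa [sub_apply, avg_apply] at hle

lemma mul_norm_sub_le (hY : GoodSample Y Θ θs Γ Ω ρ c₀ K κ a g b e)
    (hcal : Calibration Γ Ω ρ c₁ c₂ A K κ) (hθ : θ ∈ Metric.ball θs ρ) :
    c₁ / 2 * ‖θ - θs‖ ≤ ‖avg (Y θ) - avg (Y θs)‖ := by
  have hlt : ‖θ - θs‖ < ρ := mem_ball_iff_norm.1 hθ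
  set J := avg (fun i => fderiv ℝ (fun θ => Y θ i) θs (θ - θs)) with hJ
  have hlin : ‖avg (Y θ) - avg (Y θs) - J‖ ≤ ‖θ - θs‖ * ‖θ - θs‖ * K := by
    rw [hJ, ← avg_sub, ← avg_sub]
    refine norm_avg_le_mul (by positivity) (fun i => ?_) hY.avg_lipschitz_le
    have hi := (hY.localBound i).norm_sub_sub_fderiv_le hlt (θ₁ := θs) (by simp) le_rfl
    linarith
  have hquad : ‖θ - θs‖ * ‖θ - θs‖ * K ≤ c₁ / 4 * ‖θ - θs‖ := by
    have hK := hcal.bound_pos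
    calc ‖θ - θs‖ * ‖θ - θs‖ * K ≤ ‖θ - θs‖ * ρ * K := by gcongr
      _ = K * ρ * ‖θ - θs‖ := by ring
      _ ≤ _ := by gcongr; exact hcal.mul_radius_le
  have htol : κ * ‖θ - θs‖ ≤ c₁ / 4 * ‖θ - θs‖ := by gcongr; exact hcal.tol_le₁
  have htri : ‖Γ (θ - θs)‖ ≤ ‖avg (Y θ) - avg (Y θs)‖ + ‖avg (Y θ) - avg (Y θs) - J‖
      + ‖J - Γ (θ - θs)‖ := by
    calc ‖Γ (θ - θs)‖ = ‖(avg (Y θ) - avg (Y θs)) - (avg (Y θ) - avg (Y θs) - J)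
          - (J - Γ (θ - θs))‖ := by congr 1; abel
      _ ≤ _ := norm_sub_le_of_le (_root_.norm_sub_le _ _) le_rfl
  linarith [hcal.mul_norm_le (θ - θs), hY.norm_avg_fderiv_apply_sub_le (θ - θs)]

lemma mul_norm_sq_le_avg_inner_sq (hY : GoodSample Y Θ θs Γ Ω ρ c₀ K κ a g b e)
    (hcal : Calibration Γ Ω ρ c₁ c₂ A K κ) {t : ℝ} (htρ : t < ρ) (htc : 2 * K * t ≤ c₂ / 4)
    (ht : ‖θ - θs‖ ≤ t) (u : Vec m) :
    c₂ / 2 * ‖u‖ ^ 2 ≤ avg fun i => inner ℝ u (Y θ i) ^ 2 := by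
  have hθ : θ ∈ Metric.ball θs ρ := mem_ball_iff_norm.2 (ht.trans_lt htρ)
  have hK := hcal.bound_pos
  have htrue : avg (fun i => inner ℝ u (Y θs i) ^ 2)
      = inner ℝ u (avg fun i => inner ℝ u (Y θs i) • Y θs i) := by
    simp only [inner_avg, inner_smul_right, sq]
  have hvar := neg_le_of_abs_le
    (abs_inner_le_mul (le_refl ‖u‖) (hY.norm_avg_inner_smul_sub_le u))
  rw [inner_sub_right, ← htrue, real_inner_comm] at hvar
  have hdiff : ‖avg fun i => inner ℝ u (Y θ i) ^ 2 - inner ℝ u (Y θs i) ^ 2‖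
      ≤ 2 * ‖θ - θs‖ * ‖u‖ ^ 2 * K := by
    refine norm_avg_le_mul (by positivity) (fun i => ?_) hY.avg_one_add_le
    exact ((hY.localBound i).abs_inner_sq_sub_inner_sq_le
      (Metric.mem_ball_self hcal.radius_pos) hθ u).trans
      (mul_le_mul_of_nonneg_left (mul_le_one_add_pow_four_add_sq _ _) (by positivity))
  rw [avg_sub, Real.norm_eq_abs] at hdiff
  have hle : (κ + 2 * K * ‖θ - θs‖) * ‖u‖ ^ 2 ≤ c₂ / 2 * ‖u‖ ^ 2 := by
    gcongr
    calc κ + 2 * K * ‖θ - θs‖ ≤ c₂ / 4 + 2 * K * t := by gcongr; exact hcal.tol_le₂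
      _ ≤ c₂ / 2 := by linarith
  linarith [hcal.mul_norm_sq_le u, neg_le_of_abs_le hdiff]

lemma mul_bound_le (hY : GoodSample Y Θ θs Γ Ω ρ c₀ K κ a g b e) {s : ℝ}
    (hs : s ^ 4 * (n * K) ≤ (1 / 8) ^ 4) (i : Fin n) : s * a i ≤ 1 / 8 := by
  have havg : avg (fun i => a i ^ 4) ≤ K :=
    (avg_mono fun i => by linarith [sq_nonneg (g i)]).trans hY.avg_one_add_le
  have ha : a i ^ 4 ≤ n * K :=
    (le_mul_avg (f := fun i => a i ^ 4) (fun i => by positivity) i).trans (by gcongr)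
  refine le_of_pow_le_pow_left₀ (n := 4) (by norm_num) (by norm_num) ?_
  rw [mul_pow]
  exact (mul_le_mul_of_nonneg_left ha (by positivity)).trans hs

lemma norm_avg_le_of_discrepancy_le (hY : GoodSample Y Θ θs Γ Ω ρ c₀ K κ a g b e) (hn : n ≠ 0)
    (hK : 0 < K) (hθ : θ ∈ Θ) {w : Fin n → ℝ} (hw : w ∈ weightSet (Set.Ioi 0) (Y θ)) {R : ℝ}
    (hR : discrepancy hEL w ≤ R * (√n)⁻¹ ^ 2) :
    ‖avg (Y θ)‖ ≤ 2 * √K * (R + 1 / 2) * (√n)⁻¹ := by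
  have : 0 < (√n)⁻¹ := inv_pos.2 (Real.sqrt_pos.2 (Nat.cast_pos.2 (Nat.pos_of_ne_zero hn)))
  have : 0 < √K := Real.sqrt_pos.2 hK
  have hsq : avg (fun i => ‖Y θ i‖ ^ 2) ≤ K := (avg_mono fun i =>
    pow_le_pow_left₀ (norm_nonneg _) (hY.norm_le_envelope i θ hθ) 2).trans hY.avg_envelope_sq_le
  set r := (√n)⁻¹ / (2 * √K) with hr
  have hrK : r ^ 2 * K = (√n)⁻¹ ^ 2 / 4 := by
    rw [hr, div_pow, mul_pow, Real.sq_sqrt hK.le]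
    field_simp
    norm_num
  have hsmall : ∀ i, r * ‖Y θ i‖ ≤ 1 / 2 := fun i => by
    refine le_of_pow_le_pow_left₀ two_ne_zero (by norm_num) ?_
    calc (r * ‖Y θ i‖) ^ 2 = r ^ 2 * ‖Y θ i‖ ^ 2 := mul_pow _ _ _
      _ ≤ r ^ 2 * (n * K) := by
        gcongr
        exact (le_mul_avg (f := fun i => ‖Y θ i‖ ^ 2) (fun i => by positivity) i).trans
          (by gcongr)
      _ = (√n)⁻¹ ^ 2 * n / 4 := by linear_combination n * hrK
      _ = (1 / 2) ^ 2 := by rw [inv_sqrt_sq_mul_self hn]; norm_num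
  have hle : r * ‖avg (Y θ)‖ ≤ (R + 1 / 2) * (√n)⁻¹ ^ 2 := by
    have hdual := mul_norm_avg_le_discrepancy_hEL_add hn hw (by positivity) hsmall
    have : 2 * r ^ 2 * avg (fun i => ‖Y θ i‖ ^ 2) ≤ 2 * r ^ 2 * K := by gcongr
    linarith
  calc ‖avg (Y θ)‖ = 2 * √K / (√n)⁻¹ * (r * ‖avg (Y θ)‖) := by rw [hr]; field_simp
    _ ≤ 2 * √K / (√n)⁻¹ * ((R + 1 / 2) * (√n)⁻¹ ^ 2) := by gcongr
    _ = _ := by field_simp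

end GoodSample

/-- Localization of the outer problem: estimates exist, and each of them lies within `t` of `θs` and
comes with a multiplier of norm at most `s` with which it minimizes the tilted objective. -/
structure LocalizedEstimates {n k m : ℕ} (IsSol : (Fin n → Vec m) → (Fin n → ℝ) → Prop)
    (τ : ℝ → ℝ) (Θ : Set (Vec k)) (Y : Vec k → Fin n → Vec m) (θs : Vec k) (s t : ℝ) : Prop where
  exists_isLogEstimator : ∃ θ, IsLogEstimator IsSol Θ Y θ
  norm_sub_le : ∀ θ, IsLogEstimator IsSol Θ Y θ → ‖θ - θs‖ ≤ t
  exists_isMinOn : ∀ θ, IsLogEstimator IsSol Θ Y θ → ∃ l : Vec m, ‖l‖ ≤ s ∧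
    (θ, l) ∈ tiltedPairs τ Θ Y ∧ IsMinOn (tiltedObjective τ Y) (tiltedPairs τ Θ Y) (θ, l)

namespace GoodSample

variable {k m : ℕ} {Θ : Set (Vec k)} {θs θ : Vec k} {Γ : Vec k →L[ℝ] Vec m}
  {Ω : Vec m →L[ℝ] Vec m} {ρ c₀ c₁ c₂ A K κ : ℝ}

section FixedSize

variable {n : ℕ} {Y : Vec k → Fin n → Vec m} {a g b e : Fin n → ℝ}
  {IsSol : ∀ {n : ℕ}, (Fin n → Vec m) → (Fin n → ℝ) → Prop} {τ U : ℝ → ℝ} {B R s t : ℝ}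

lemma continuousOn_closedBall (hY : GoodSample Y Θ θs Γ Ω ρ c₀ K κ a g b e) (hρ : 0 < ρ)
    (i : Fin n) : ContinuousOn (fun θ => Y θ i) (Metric.closedBall θs (ρ / 2)) :=
  (hY.localBound i).contDiffOn.continuousOn.mono (Metric.closedBall_subset_ball (half_lt_self hρ))

lemma isCompact_inter_norm_avg_le (hY : GoodSample Y Θ θs Γ Ω ρ c₀ K κ a g b e) (hρ : 0 < ρ) :
    IsCompact (Metric.closedBall θs (ρ / 2) ∩ {θ | ‖avg (Y θ)‖ ≤ B}) :=
  (isCompact_closedBall θs (ρ / 2)).of_isClosed_subset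
    ((continuousOn_avg (hY.continuousOn_closedBall hρ)).norm.preimage_isClosed_of_isClosed
      Metric.isClosed_closedBall isClosed_Iic) Set.inter_subset_left

lemma exists_tiltedMoment_eq_zero (hY : GoodSample Y Θ θs Γ Ω ρ c₀ K κ a g b e)
    (hcal : Calibration Γ Ω ρ c₁ c₂ A K κ) (hT : IsTilting m IsSol τ U) (hn : n ≠ 0) (hs : 0 < s)
    (hsa : ∀ i, s * a i ≤ 1 / 8) (htρ : t < ρ) (htc : 2 * K * t ≤ c₂ / 4) (ht : ‖θ - θs‖ ≤ t)
    (hbar : ‖avg (Y θ)‖ < c₂ / 8 * s) :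
    ∃ l : Vec m, ‖l‖ ≤ s ∧ tiltedMoment τ (Y θ) l = 0 := by
  have hθ : θ ∈ Metric.ball θs ρ := mem_ball_iff_norm.2 (ht.trans_lt htρ)
  refine hT.exists_tiltedMoment_eq_zero hn hs (fun i => ?_)
    (hY.mul_norm_sq_le_avg_inner_sq hcal htρ htc ht) (by linarith)
  exact (mul_le_mul_of_nonneg_left ((hY.localBound i).norm_le θ hθ) hs.le).trans (hsa i)

/- Off the set where `‖θ - θs‖ ≤ ρ / 2` and `‖avg (Y θ)‖ ≤ B`, which lies within `t` of `θs`, the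
objective exceeds its value at `θs`, so both problems may be restricted to that compact set. -/
lemma localizedEstimates (hY : GoodSample Y Θ θs Γ Ω ρ c₀ K κ a g b e)
    (hcal : Calibration Γ Ω ρ c₁ c₂ A K κ) (hΘ : Metric.ball θs ρ ⊆ Θ)
    (hT : IsTilting m IsSol τ U) (hn : n ≠ 0) (hs : 0 < s) (hsa : ∀ i, s * a i ≤ 1 / 8)
    (htρ : t < ρ) (htc : 2 * K * t ≤ c₂ / 4) (hBc₀ : B < c₀) (hBs : B < c₂ / 8 * s)
    (hBt : B + ‖avg (Y θs)‖ ≤ c₁ / 2 * t) (hθs : ‖avg (Y θs)‖ ≤ B)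
    (hlevel : ∀ θ ∈ Θ, ∀ w ∈ weightSet (Set.Ioi 0) (Y θ), discrepancy hEL w ≤ R →
      ‖avg (Y θ)‖ ≤ B)
    {l₀ : Vec m} (hl₀ : ‖l₀‖ ≤ s) (h₀ : tiltedMoment τ (Y θs) l₀ = 0)
    (hl₀R : ‖l₀‖ * ‖avg (Y θs)‖ ≤ R) :
    LocalizedEstimates (fun y w => IsSol y w) τ Θ Y θs s t := by
  set Q := Metric.closedBall θs (ρ / 2) ∩ {θ | ‖avg (Y θ)‖ ≤ B}
  have hball : ∀ θ ∈ Q, θ ∈ Metric.ball θs ρ := fun θ hθ =>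
    Metric.closedBall_subset_ball (half_lt_self hcal.radius_pos) hθ.1
  have hQΘ : Q ⊆ Θ := fun θ hθ => hΘ (hball θ hθ)
  have hclose : ∀ θ ∈ Q, ‖θ - θs‖ ≤ t := fun θ hθ => by
    refine le_of_mul_le_mul_left ?_ (half_pos hcal.pos₁)
    exact ((hY.mul_norm_sub_le hcal (hball θ hθ)).trans
      (norm_sub_le_of_le hθ.2 le_rfl)).trans hBt
  have hsmall : ∀ θ ∈ Q, ∀ i, s * ‖Y θ i‖ ≤ 1 / 8 := fun θ hθ i =>
    (mul_le_mul_of_nonneg_left ((hY.localBound i).norm_le θ (hball θ hθ)) hs.le).trans (hsa i)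
  have hex : ∀ θ ∈ Q, ∃ l : Vec m, ‖l‖ ≤ s ∧ tiltedMoment τ (Y θ) l = 0 := fun θ hθ =>
    hY.exists_tiltedMoment_eq_zero hcal hT hn hs hsa htρ htc (hclose θ hθ) (hθ.2.trans_lt hBs)
  have hlevelQ : ∀ θ ∈ Θ, ∀ w ∈ weightSet (Set.Ioi 0) (Y θ), discrepancy hEL w ≤ R → θ ∈ Q :=
    fun θ hθ w hw hle => by
      have hB := hlevel θ hθ w hw hle
      refine ⟨mem_closedBall_iff_norm.2 ?_, hB⟩
      by_contra! hlt
      linarith [hY.le_norm_avg θ hθ hlt.le]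
  have hθsQ : θs ∈ Q := ⟨Metric.mem_closedBall_self (half_pos hcal.radius_pos).le, hθs⟩
  have hpair : (θs, l₀) ∈ tiltedPairs τ Q Y := mk_mem_tiltedPairs hsmall hθsQ hl₀ h₀
  have hobj : tiltedObjective τ Y (θs, l₀) ≤ R := hT.tiltedObjective_le_of_norm_le hn hpair hl₀R
  have hmin := fun θ => hT.exists_isMinOn_tiltedObjective hn hQΘ hsmall hex hlevelQ hpair hobj
    (θ := θ)
  exact {
    exists_isLogEstimator := hT.exists_isLogEstimator hn
      (hY.isCompact_inter_norm_avg_le hcal.radius_pos) hQΘ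
      (fun i => (hY.continuousOn_closedBall hcal.radius_pos i).mono Set.inter_subset_left)
      hsmall hex hlevelQ hpair hl₀ hobj
    norm_sub_le := fun θ hθ => hclose θ (hmin θ hθ).1
    exists_isMinOn := fun θ hθ =>
      let ⟨_, l, hl, hmem, hmin⟩ := hmin θ hθ
      ⟨l, hl, tiltedPairs_mono hQΘ hmem, hmin⟩ }

end FixedSize

lemma exists_eventually_localizedEstimates (hcal : Calibration Γ Ω ρ c₁ c₂ A K κ)
    (hΘ : Metric.ball θs ρ ⊆ Θ) (hc₀ : 0 < c₀) {C : ℝ} (hC : 0 ≤ C) :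
    ∃ S > 0, ∃ T : ℝ, ∀ᶠ n : ℕ in atTop, ∀ (Y : Vec k → Fin n → Vec m) (a g b e : Fin n → ℝ),
      GoodSample Y Θ θs Γ Ω ρ c₀ K κ a g b e → ‖avg (Y θs)‖ ≤ C * (√n)⁻¹ →
      ∀ {IsSol : ∀ {n : ℕ}, (Fin n → Vec m) → (Fin n → ℝ) → Prop} {τ U : ℝ → ℝ},
      IsTilting m IsSol τ U →
      LocalizedEstimates (fun y w => IsSol y w) τ Θ Y θs (S * (√n)⁻¹) (T * (√n)⁻¹) := by
  have hc₁ := hcal.pos₁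
  have hc₂ := hcal.pos₂
  set S₀ := 8 * (C + 1) / c₂ with hS₀
  set B := max C (2 * √K * (S₀ * C + 1 / 2))
  set S := 8 * (B + 1) / c₂ with hS
  set T := 2 / c₁ * (B + C) with hT
  have hCB : C ≤ B := le_max_left _ _
  have hB₀ : 0 ≤ B := hC.trans hCB
  have hS₀S : S₀ ≤ S := by rw [hS₀, hS]; gcongr
  have hS₀pos : 0 < S₀ := by positivity
  have hSpos : 0 < S := hS₀pos.trans_le hS₀S
  refine ⟨S, hSpos, T, ?_⟩
  filter_upwards [eventually_ne_atTop 0, eventually_mul_inv_sqrt_lt T hcal.radius_pos,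
    eventually_mul_inv_sqrt_lt B hc₀,
    eventually_mul_inv_sqrt_lt (2 * K * T) (δ := c₂ / 4) (by positivity),
    eventually_mul_inv_sqrt_pow_four_mul_le S K (δ := (1 / 8) ^ 4) (by positivity)]
    with n hn hTρ hBc₀ hKT hS4 Y a g b e hY hbar IsSol τ U hτ
  have hh : 0 < (√n)⁻¹ := inv_pos.2 (Real.sqrt_pos.2 (Nat.cast_pos.2 (Nat.pos_of_ne_zero hn)))
  have hsa := hY.mul_bound_le hS4
  have htc : 2 * K * (T * (√n)⁻¹) ≤ c₂ / 4 := by linarith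
  have hCS₀ : C * (√n)⁻¹ < c₂ / 8 * (S₀ * (√n)⁻¹) := by
    rw [show c₂ / 8 * (S₀ * (√n)⁻¹) = (C + 1) * (√n)⁻¹ by rw [hS₀]; field_simp]
    gcongr
    exact lt_add_one C
  have hBS : B * (√n)⁻¹ < c₂ / 8 * (S * (√n)⁻¹) := by
    rw [show c₂ / 8 * (S * (√n)⁻¹) = (B + 1) * (√n)⁻¹ by rw [hS]; field_simp]
    gcongr
    exact lt_add_one B
  have ha : ∀ i, 0 ≤ a i := fun i => (norm_nonneg _).trans
    ((hY.localBound i).norm_le θs (Metric.mem_ball_self hcal.radius_pos))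
  have hS₀a : ∀ i, S₀ * (√n)⁻¹ * a i ≤ 1 / 8 := fun i =>
    le_trans (by have := ha i; gcongr) (hsa i)
  obtain ⟨l₀, hl₀, hzero⟩ := hY.exists_tiltedMoment_eq_zero hcal hτ hn (mul_pos hS₀pos hh)
    hS₀a hTρ htc (θ := θs) (by rw [sub_self, norm_zero]; positivity) (hbar.trans_lt hCS₀)
  have hl₀R : ‖l₀‖ * ‖avg (Y θs)‖ ≤ S₀ * C * (√n)⁻¹ ^ 2 := by
    calc ‖l₀‖ * ‖avg (Y θs)‖ ≤ S₀ * (√n)⁻¹ * (C * (√n)⁻¹) := by gcongr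
      _ = _ := by ring
  have hBt : B * (√n)⁻¹ + C * (√n)⁻¹ = c₁ / 2 * (T * (√n)⁻¹) := by
    rw [hT]
    field_simp
  refine hY.localizedEstimates hcal hΘ hτ hn (mul_pos hSpos hh) hsa hTρ htc hBc₀ hBS
    (by linarith) (hbar.trans (by gcongr)) (fun θ hθ w hw hle => ?_) (hl₀.trans (by gcongr)) hzero
    hl₀R
  exact (hY.norm_avg_le_of_discrepancy_le hn hcal.bound_pos hθ hw hle).trans
    (mul_le_mul_of_nonneg_right (le_max_right _ _) hh.le)

end GoodSample

/-- The first-order conditions of EL, `∑ᵢ yᵢ / (1 + l'yᵢ) = 0` for the multiplier `l` and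
`∑ᵢ Gᵢ'l / (1 + l'yᵢ) = 0` for the parameter, hold up to an error of size `ε`. Here `yᵢ` and `Gᵢ`
are the values of the moment functions and of their derivatives at the parameter. -/
structure ApproxELConditions {n k m : ℕ} (y : Fin n → Vec m) (G : Fin n → Vec k →L[ℝ] Vec m)
    (l : Vec m) (ε : ℝ) : Prop where
  norm_tiltedMoment_le : ‖tiltedMoment (fun t => (1 + t)⁻¹) y l‖ ≤ ε
  abs_avg_score_le : ∀ v, |avg fun i => (1 + inner ℝ l (y i))⁻¹ * inner ℝ l (G i v)| ≤ ε * ‖v‖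

lemma MomentBound.exists_approxELConditions {n k m : ℕ} {y : Fin n → Vec m}
    {G : Fin n → Vec k →L[ℝ] Vec m} {a g : Fin n → ℝ} {c K s : ℝ} {l ν : Vec m}
    (h : MomentBound y G a g K s) (hn : n ≠ 0) (hc : 0 < c)
    (hpd : ∀ u : Vec m, c * ‖u‖ ^ 2 ≤ avg fun i => inner ℝ u (y i) ^ 2) (hs₁ : s ≤ 1)
    (hsc : 2 * K / c * s ≤ 1) (hl : ‖l‖ ≤ s)
    (h₀ : tiltedMoment (fun t => Real.exp (-t)) y l = 0)
    (hν : ∀ d, avg (fun i => Real.exp (-inner ℝ l (y i)) * inner ℝ ν (y i) * inner ℝ d (y i))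
      = avg fun i => inner ℝ d (y i))
    (hscore : ∀ v, avg (fun i => (1 - Real.exp (-inner ℝ l (y i)) /
          (avg fun j => Real.exp (-inner ℝ l (y j)))
        - Real.exp (-inner ℝ l (y i)) * inner ℝ ν (y i)) * inner ℝ l (G i v)
        + Real.exp (-inner ℝ l (y i)) * inner ℝ ν (G i v)) = 0) :
    ‖ν‖ ≤ 2 * s ∧
      ApproxELConditions y G ν ((42 + 24 * K + 2 * K / c * (8 + 12 * K)) * K * s ^ 3) := by
  have hs : 0 ≤ s := (norm_nonneg l).trans hl
  have hK := h.bound_nonneg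
  have hA : 0 ≤ 2 * K / c := by positivity
  have hνl := h.norm_multiplier_sub_le hc hpd hl h₀ hν
  have hνs : ‖ν‖ ≤ 2 * s := by
    calc ‖ν‖ ≤ ‖l‖ + ‖ν - l‖ := norm_le_norm_add_norm_sub' _ _
      _ ≤ s + 2 * K / c * s * s := by linarith
      _ ≤ s + 1 * s := by gcongr
      _ = 2 * s := by ring
  refine ⟨hνs, ?_, fun v => ?_⟩
  · refine (h.norm_tiltedMoment_multiplier_le hA hl hνs hνl hν).trans ?_
    have : 0 ≤ 2 * K / c * (6 + 12 * K) := by positivity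
    exact mul_le_mul_of_nonneg_right (mul_le_mul_of_nonneg_right (by linarith) hK) (by positivity)
  · refine (h.abs_avg_score_multiplier_le hn hA hs₁ hl h₀ hνs hνl v (hscore v)).trans ?_
    gcongr <;> linarith

namespace GoodSample

variable {k m : ℕ} {Θ : Set (Vec k)} {θs θ θ₁ θ₂ : Vec k} {Γ : Vec k →L[ℝ] Vec m}
  {Ω : Vec m →L[ℝ] Vec m} {ρ c₀ c₁ c₂ A K κ : ℝ}

section FixedSize

variable {n : ℕ} {Y : Vec k → Fin n → Vec m} {a g b e : Fin n → ℝ} {l₁ l₂ : Vec m}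
  {s t ε₁ ε₂ : ℝ}

lemma norm_apply_sub_apply_le (hY : GoodSample Y Θ θs Γ Ω ρ c₀ K κ a g b e) (htρ : t < ρ)
    (h₁ : ‖θ₁ - θs‖ ≤ t) (h₂ : ‖θ₂ - θs‖ ≤ t) (hl₁ : ‖l₁‖ ≤ s) (hl₂ : ‖l₂‖ ≤ s)
    (hsa : ∀ i, s * a i ≤ 1 / 4) (hs₁ : s ≤ 1)
    (hF₁ : ‖tiltedMoment (fun t => (1 + t)⁻¹) (Y θ₁) l₁‖ ≤ ε₁)
    (hF₂ : ‖tiltedMoment (fun t => (1 + t)⁻¹) (Y θ₂) l₂‖ ≤ ε₂) :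
    ‖Γ (θ₂ - θ₁) - Ω (l₂ - l₁)‖
      ≤ ε₁ + ε₂ + (8 * (s + t) * K + κ) * (‖θ₂ - θ₁‖ + ‖l₂ - l₁‖) := by
  have hs : 0 ≤ s := (norm_nonneg l₁).trans hl₁
  have ht : 0 ≤ t := (norm_nonneg _).trans h₁
  have hball : ∀ {θ}, ‖θ - θs‖ ≤ t → θ ∈ Metric.ball θs ρ := fun h =>
    mem_ball_iff_norm.2 (h.trans_lt htρ)
  have hθs : ‖θs - θs‖ ≤ t := by simpa using ht
  set J := avg fun i => fderiv ℝ (fun θ => Y θ i) θs (θ₂ - θ₁)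
  set V := avg fun i => inner ℝ (l₂ - l₁) (Y θs i) • Y θs i
  set F₁ := tiltedMoment (fun t => (1 + t)⁻¹) (Y θ₁) l₁
  set F₂ := tiltedMoment (fun t => (1 + t)⁻¹) (Y θ₂) l₂
  have hlin : ‖F₂ - F₁ - (J - V)‖ ≤ 8 * (s + t) * (‖θ₂ - θ₁‖ + ‖l₂ - l₁‖) * K := by
    simp only [F₁, F₂, J, V, tiltedMoment, ← avg_sub]
    refine norm_avg_le_mul (by positivity) (fun i => ?_) hY.avg_le
    have hi := hY.localBound i
    have hg : 0 ≤ g i := (norm_nonneg _).trans (hi.norm_fderiv_le θs (hball hθs))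
    exact norm_inv_one_add_smul_sub_linear_le (hi.norm_le _ (hball h₁)) (hi.norm_le _ (hball h₂))
      (hi.norm_le _ (hball hθs)) (hi.norm_sub_le (hball h₁) (hball h₂))
      ((hi.norm_sub_le (hball hθs) (hball h₂)).trans (by gcongr))
      (hi.norm_sub_sub_fderiv_le htρ h₁ h₂) hl₁ hl₂ (hsa i) hs₁ ht hi.nonneg
  calc ‖Γ (θ₂ - θ₁) - Ω (l₂ - l₁)‖
      = ‖F₂ - F₁ - (F₂ - F₁ - (J - V)) - (J - Γ (θ₂ - θ₁)) + (V - Ω (l₂ - l₁))‖ := by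
        congr 1; abel
    _ ≤ ε₂ + ε₁ + 8 * (s + t) * (‖θ₂ - θ₁‖ + ‖l₂ - l₁‖) * K + κ * ‖θ₂ - θ₁‖
        + κ * ‖l₂ - l₁‖ :=
      norm_add_le_of_le (norm_sub_le_of_le (norm_sub_le_of_le (norm_sub_le_of_le hF₂ hF₁) hlin)
        (hY.norm_avg_fderiv_apply_sub_le _)) (hY.norm_avg_inner_smul_sub_le _)
    _ = _ := by ring

lemma abs_inner_apply_le (hY : GoodSample Y Θ θs Γ Ω ρ c₀ K κ a g b e) (htρ : t < ρ)
    (h₁ : ‖θ₁ - θs‖ ≤ t) (h₂ : ‖θ₂ - θs‖ ≤ t) (hl₁ : ‖l₁‖ ≤ s) (hl₂ : ‖l₂‖ ≤ s)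
    (hsa : ∀ i, s * a i ≤ 1 / 4) (hs₁ : s ≤ 1) (w : Vec k)
    (hF₁ : |avg fun i => (1 + inner ℝ l₁ (Y θ₁ i))⁻¹
      * inner ℝ l₁ (fderiv ℝ (fun θ => Y θ i) θ₁ w)| ≤ ε₁ * ‖w‖)
    (hF₂ : |avg fun i => (1 + inner ℝ l₂ (Y θ₂ i))⁻¹
      * inner ℝ l₂ (fderiv ℝ (fun θ => Y θ i) θ₂ w)| ≤ ε₂ * ‖w‖) :
    |inner ℝ (l₂ - l₁) (Γ w)|
      ≤ (ε₁ + ε₂ + (8 * (s + t) * K + κ) * (‖θ₂ - θ₁‖ + ‖l₂ - l₁‖)) * ‖w‖ := by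
  have hs : 0 ≤ s := (norm_nonneg l₁).trans hl₁
  have ht : 0 ≤ t := (norm_nonneg _).trans h₁
  have hball : ∀ {θ}, ‖θ - θs‖ ≤ t → θ ∈ Metric.ball θs ρ := fun h =>
    mem_ball_iff_norm.2 (h.trans_lt htρ)
  have hθs : ‖θs - θs‖ ≤ t := by simpa using ht
  set J := avg fun i => fderiv ℝ (fun θ => Y θ i) θs w with hJ
  set F₁ := avg fun i => (1 + inner ℝ l₁ (Y θ₁ i))⁻¹
    * inner ℝ l₁ (fderiv ℝ (fun θ => Y θ i) θ₁ w)
  set F₂ := avg fun i => (1 + inner ℝ l₂ (Y θ₂ i))⁻¹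
    * inner ℝ l₂ (fderiv ℝ (fun θ => Y θ i) θ₂ w)
  have hlin : |F₂ - F₁ - inner ℝ (l₂ - l₁) J|
      ≤ 8 * (s + t) * (‖θ₂ - θ₁‖ + ‖l₂ - l₁‖) * ‖w‖ * K := by
    simp only [F₁, F₂, hJ, inner_avg, ← avg_sub]
    rw [← Real.norm_eq_abs]
    refine norm_avg_le_mul (by positivity) (fun i => ?_) hY.avg_le
    have hi := hY.localBound i
    exact abs_inv_one_add_mul_inner_sub_linear_le (hi.norm_le _ (hball h₁))
      (hi.norm_le _ (hball h₂)) (hi.norm_sub_le (hball h₁) (hball h₂))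
      (hi.norm_fderiv_le _ (hball h₁)) (hi.norm_fderiv_le _ (hball h₂))
      (hi.norm_fderiv_sub_le _ (hball h₂) _ (hball h₁))
      ((hi.norm_fderiv_sub_le _ (hball h₂) _ (hball hθs)).trans
        (mul_le_mul_of_nonneg_left h₂ hi.nonneg)) hl₁ hl₂ (hsa i) hs₁ ht hi.nonneg w
  have hJΓ : |inner ℝ (l₂ - l₁) (J - Γ w)| ≤ (‖θ₂ - θ₁‖ + ‖l₂ - l₁‖) * (κ * ‖w‖) :=
    abs_inner_le_mul (le_add_of_nonneg_left (norm_nonneg _)) (hY.norm_avg_fderiv_apply_sub_le w)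
  rw [inner_sub_right] at hJΓ
  calc |inner ℝ (l₂ - l₁) (Γ w)|
      = ‖F₂ - F₁ - (F₂ - F₁ - inner ℝ (l₂ - l₁) J)
          - (inner ℝ (l₂ - l₁) J - inner ℝ (l₂ - l₁) (Γ w))‖ := by
        rw [Real.norm_eq_abs]; congr 1; abel
    _ ≤ ε₂ * ‖w‖ + ε₁ * ‖w‖ + 8 * (s + t) * (‖θ₂ - θ₁‖ + ‖l₂ - l₁‖) * ‖w‖ * K
        + (‖θ₂ - θ₁‖ + ‖l₂ - l₁‖) * (κ * ‖w‖) :=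
      norm_sub_le_of_le (norm_sub_le_of_le (norm_sub_le_of_le hF₂ hF₁) hlin) hJΓ
    _ = _ := by ring

lemma norm_sub_le_of_approxELConditions (hY : GoodSample Y Θ θs Γ Ω ρ c₀ K κ a g b e)
    (hcal : Calibration Γ Ω ρ c₁ c₂ A K κ) (htρ : t < ρ) (h₁ : ‖θ₁ - θs‖ ≤ t)
    (h₂ : ‖θ₂ - θs‖ ≤ t) (hl₁ : ‖l₁‖ ≤ s) (hl₂ : ‖l₂‖ ≤ s) (hsa : ∀ i, s * a i ≤ 1 / 4)
    (hs₁ : s ≤ 1) (hA : A * (8 * (s + t) * K) ≤ 1 / 4)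
    (hF₁ : ApproxELConditions (Y θ₁) (fun i => fderiv ℝ (fun θ => Y θ i) θ₁) l₁ ε₁)
    (hF₂ : ApproxELConditions (Y θ₂) (fun i => fderiv ℝ (fun θ => Y θ i) θ₂) l₂ ε₂) :
    ‖θ₂ - θ₁‖ ≤ 2 * A * (ε₁ + ε₂) := by
  have hs : 0 ≤ s := (norm_nonneg l₁).trans hl₁
  have ht : 0 ≤ t := (norm_nonneg _).trans h₁
  have hε₁ : 0 ≤ ε₁ := (norm_nonneg _).trans hF₁.norm_tiltedMoment_le
  have hε₂ : 0 ≤ ε₂ := (norm_nonneg _).trans hF₂.norm_tiltedMoment_le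
  have hK := hcal.bound_pos
  have hκ := hcal.tol_nonneg
  set E := ‖θ₂ - θ₁‖ + ‖l₂ - l₁‖
  have hstable : E ≤ A * (ε₁ + ε₂ + (8 * (s + t) * K + κ) * E) :=
    hcal.norm_add_norm_le _ _ _ (by positivity)
      (hY.norm_apply_sub_apply_le htρ h₁ h₂ hl₁ hl₂ hsa hs₁ hF₁.norm_tiltedMoment_le
        hF₂.norm_tiltedMoment_le)
      fun w => hY.abs_inner_apply_le htρ h₁ h₂ hl₁ hl₂ hsa hs₁ w (hF₁.abs_avg_score_le w)
        (hF₂.abs_avg_score_le w)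
  have habsorb : A * (8 * (s + t) * K + κ) * E ≤ 1 / 2 * E := by
    gcongr
    linarith [hcal.mul_tol_le]
  linarith [norm_nonneg (l₂ - l₁)]

lemma approxELConditions_of_isMinOn_EL (hY : GoodSample Y Θ θs Γ Ω ρ c₀ K κ a g b e)
    (hcal : Calibration Γ Ω ρ c₁ c₂ A K κ) (hΘ : Metric.ball θs ρ ⊆ Θ) (hn : n ≠ 0) (htρ : t < ρ)
    (htc : 2 * K * t ≤ c₂ / 4) (ht : ‖θ - θs‖ ≤ t) {l : Vec m}
    (hq : (θ, l) ∈ tiltedPairs (fun t => (1 + t)⁻¹) Θ Y)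
    (hmin : IsMinOn (tiltedObjective (fun t => (1 + t)⁻¹) Y)
      (tiltedPairs (fun t => (1 + t)⁻¹) Θ Y) (θ, l)) :
    ApproxELConditions (Y θ) (fun i => fderiv ℝ (fun θ => Y θ i) θ) l 0 := by
  have hθ : θ ∈ Metric.ball θs ρ := mem_ball_iff_norm.2 (ht.trans_lt htρ)
  refine ⟨(norm_eq_zero.2 hq.2.2).le, fun v => ?_⟩
  rw [avg_inner_jac_eq_zero_of_isMinOn_EL hn
    (mem_of_superset (Metric.isOpen_ball.mem_nhds hθ) hΘ)
    (fun i => (hY.localBound i).hasStrictFDerivAt hθ) (half_pos hcal.pos₂)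
    (hY.mul_norm_sq_le_avg_inner_sq hcal htρ htc ht) hq hmin v, abs_zero, zero_mul]

lemma exists_approxELConditions_of_isMinOn_ETEL (hY : GoodSample Y Θ θs Γ Ω ρ c₀ K κ a g b e)
    (hcal : Calibration Γ Ω ρ c₁ c₂ A K κ) (hΘ : Metric.ball θs ρ ⊆ Θ) (hn : n ≠ 0) (htρ : t < ρ)
    (htc : 2 * K * t ≤ c₂ / 4) (ht : ‖θ - θs‖ ≤ t) {l : Vec m} (hl : ‖l‖ ≤ s)
    (hsa : ∀ i, s * a i ≤ 1 / 8) (hs₁ : s ≤ 1) (hsc : 2 * K / (c₂ / 2) * s ≤ 1)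
    (hq : (θ, l) ∈ tiltedPairs (fun t => Real.exp (-t)) Θ Y)
    (hmin : IsMinOn (tiltedObjective (fun t => Real.exp (-t)) Y)
      (tiltedPairs (fun t => Real.exp (-t)) Θ Y) (θ, l)) :
    ∃ ν : Vec m, ‖ν‖ ≤ 2 * s ∧ ApproxELConditions (Y θ) (fun i => fderiv ℝ (fun θ => Y θ i) θ) ν
      ((42 + 24 * K + 2 * K / (c₂ / 2) * (8 + 12 * K)) * K * s ^ 3) := by
  have hθ : θ ∈ Metric.ball θs ρ := mem_ball_iff_norm.2 (ht.trans_lt htρ)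
  have hpd := hY.mul_norm_sq_le_avg_inner_sq hcal htρ htc ht
  have hbound : MomentBound (Y θ) (fun i => fderiv ℝ (fun θ => Y θ i) θ) a g K s :=
    { norm_le := fun i => (hY.localBound i).norm_le θ hθ
      norm_deriv_le := fun i => (hY.localBound i).norm_fderiv_le θ hθ
      avg_le := hY.avg_one_add_le
      mul_le := hsa }
  obtain ⟨ν, hν, hscore⟩ := exists_multiplier_of_isMinOn_ETEL hn
    (mem_of_superset (Metric.isOpen_ball.mem_nhds hθ) hΘ)
    (fun i => (hY.localBound i).hasStrictFDerivAt hθ) (half_pos hcal.pos₂) hpd hq hmin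
  exact ⟨ν, hbound.exists_approxELConditions hn (half_pos hcal.pos₂) hpd hs₁ hsc hl hq.2.2 hν
    hscore⟩

end FixedSize

lemma exists_eventually_norm_sub_le (hcal : Calibration Γ Ω ρ c₁ c₂ A K κ)
    (hΘ : Metric.ball θs ρ ⊆ Θ) (hc₀ : 0 < c₀) {C : ℝ} (hC : 0 ≤ C) :
    ∃ D : ℝ, ∀ᶠ n : ℕ in atTop, ∀ (Y : Vec k → Fin n → Vec m) (a g b e : Fin n → ℝ),
      GoodSample Y Θ θs Γ Ω ρ c₀ K κ a g b e → ‖avg (Y θs)‖ ≤ C * (√n)⁻¹ →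
      (∃ θ, IsLogEstimator IsELWeights Θ Y θ) ∧ (∃ θ, IsLogEstimator IsETWeights Θ Y θ) ∧
      ∀ θ₁ θ₂, IsLogEstimator IsELWeights Θ Y θ₁ → IsLogEstimator IsETWeights Θ Y θ₂ →
        ‖θ₂ - θ₁‖ ≤ D * (√n)⁻¹ ^ 3 := by
  obtain ⟨S, hS, T, hloc⟩ := exists_eventually_localizedEstimates hcal hΘ hc₀ hC
  have hc₂ := hcal.pos₂
  set R := (42 + 24 * K + 2 * K / (c₂ / 2) * (8 + 12 * K)) * K
  refine ⟨2 * A * (R * S ^ 3), ?_⟩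
  filter_upwards [hloc, eventually_ne_atTop 0, eventually_mul_inv_sqrt_lt T hcal.radius_pos,
    eventually_mul_inv_sqrt_lt (2 * K * T) (δ := c₂ / 4) (by positivity),
    eventually_mul_inv_sqrt_pow_four_mul_le S K (δ := (1 / 8) ^ 4) (by positivity),
    eventually_mul_inv_sqrt_lt S (δ := 1 / 2) one_half_pos,
    eventually_mul_inv_sqrt_lt (2 * K / (c₂ / 2) * S) one_pos,
    eventually_mul_inv_sqrt_lt (A * (8 * (2 * S + T) * K)) (δ := 1 / 4) (by norm_num)]
    with n hloc hn hTρ hKT hS4 hS₁ hKS hA Y a g b e hY hbar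
  have hEL := hloc Y a g b e hY hbar (isTilting_EL m)
  have hET := hloc Y a g b e hY hbar (isTilting_ET m)
  refine ⟨hEL.exists_isLogEstimator, hET.exists_isLogEstimator, fun θ₁ θ₂ h₁ h₂ => ?_⟩
  obtain ⟨l₁, hl₁, hq₁, hmin₁⟩ := hEL.exists_isMinOn θ₁ h₁
  obtain ⟨l₂, hl₂, hq₂, hmin₂⟩ := hET.exists_isMinOn θ₂ h₂
  have ht₁ := hEL.norm_sub_le θ₁ h₁
  have ht₂ := hET.norm_sub_le θ₂ h₂
  have hs : 0 ≤ S * (√n)⁻¹ := by positivity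
  have hsa := hY.mul_bound_le hS4
  have htc : 2 * K * (T * (√n)⁻¹) ≤ c₂ / 4 := by linarith
  have hF₁ := hY.approxELConditions_of_isMinOn_EL hcal hΘ hn hTρ htc ht₁ hq₁ hmin₁
  obtain ⟨ν, hν, hF₂⟩ := hY.exists_approxELConditions_of_isMinOn_ETEL hcal hΘ hn hTρ htc ht₂ hl₂
    hsa (by linarith) (by linarith) hq₂ hmin₂
  calc ‖θ₂ - θ₁‖ ≤ 2 * A * (0 + R * (S * (√n)⁻¹) ^ 3) :=
        hY.norm_sub_le_of_approxELConditions hcal hTρ ht₁ ht₂ (hl₁.trans (by linarith)) hν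
          (fun i => by linarith [hsa i]) (by linarith) (by linarith) hF₁ hF₂
    _ = _ := by ring

end GoodSample

section LinearAlgebra

variable {E F : Type*} [NormedAddCommGroup E] [NormedSpace ℝ E] [FiniteDimensional ℝ E]
  [NormedAddCommGroup F] [NormedSpace ℝ F] {Γ : E →L[ℝ] F}

lemma exists_pos_mul_norm_le_of_injective (hΓ : Function.Injective Γ) :
    ∃ c : ℝ, 0 < c ∧ ∀ v, c * ‖v‖ ≤ ‖Γ v‖ := by
  obtain ⟨K, hK, hanti⟩ := Γ.toLinearMap.exists_antilipschitzWith (LinearMap.ker_eq_bot.2 hΓ)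
  refine ⟨(K : ℝ)⁻¹, inv_pos.2 (NNReal.coe_pos.2 hK), fun v => ?_⟩
  rw [inv_mul_le_iff₀ (NNReal.coe_pos.2 hK)]
  exact hanti.le_mul_norm (map_zero Γ) v

lemma injective_of_finrank_range_eq
    (h : Module.finrank ℝ (LinearMap.range Γ.toLinearMap) = Module.finrank ℝ E) :
    Function.Injective Γ := by
  have hker := Γ.toLinearMap.finrank_range_add_finrank_ker
  rw [h, Nat.add_eq_left] at hker
  exact LinearMap.ker_eq_bot.1 (Submodule.finrank_eq_zero.1 hker)

end LinearAlgebra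

lemma exists_pos_mul_norm_sq_le_inner {E : Type*} [NormedAddCommGroup E] [InnerProductSpace ℝ E]
    [FiniteDimensional ℝ E] {Ω : E →L[ℝ] E}
    (hΩ : ∀ u, u ≠ 0 → 0 < inner ℝ (Ω u) u) :
    ∃ c : ℝ, 0 < c ∧ ∀ u, c * ‖u‖ ^ 2 ≤ inner ℝ (Ω u) u := by
  have hpos : ∀ u ∈ Metric.sphere (0 : E) 1, 0 < inner ℝ (Ω u) u := fun u hu =>
    hΩ u (ne_zero_of_mem_unit_sphere ⟨u, hu⟩)
  obtain ⟨c, hc, hle⟩ := (isCompact_sphere (0 : E) 1).exists_forall_le' (by fun_prop) hpos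
  refine ⟨c, hc, fun u => ?_⟩
  rcases eq_or_ne u 0 with rfl | hu
  · simp
  have hu' : 0 < ‖u‖ := norm_pos_iff.2 hu
  have hunit := hle (‖u‖⁻¹ • u) (by simp [norm_smul, hu'.ne'])
  rw [map_smul, real_inner_smul_left, real_inner_smul_right] at hunit
  calc c * ‖u‖ ^ 2 ≤ ‖u‖⁻¹ * (‖u‖⁻¹ * inner ℝ (Ω u) u) * ‖u‖ ^ 2 := by gcongr
    _ = inner ℝ (Ω u) u := by field_simp

lemma exists_calibration {k m : ℕ} {Γ : Vec k →L[ℝ] Vec m} {Ω : Vec m →L[ℝ] Vec m}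
    (hΓ : Function.Injective Γ) (hΩ : ∀ u, u ≠ 0 → 0 < inner ℝ (Ω u) u) {ρ₀ K : ℝ} (hρ₀ : 0 < ρ₀)
    (hK : 0 < K) :
    ∃ ρ ≤ ρ₀, ∃ c₁ c₂ A κ : ℝ, 0 < κ ∧ Calibration Γ Ω ρ c₁ c₂ A K κ := by
  obtain ⟨c₁, hc₁, hΓ⟩ := exists_pos_mul_norm_le_of_injective hΓ
  obtain ⟨c₂, hc₂, hΩ⟩ := exists_pos_mul_norm_sq_le_inner hΩ
  obtain ⟨A, hA, hstab⟩ := exists_norm_add_norm_le_of_linearized hc₁ hc₂ hΓ hΩ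
  have hκ : 0 < min (min (c₁ / 4) (c₂ / 4)) (1 / (4 * A)) := by positivity
  refine ⟨min ρ₀ (c₁ / (4 * K)), min_le_left _ _, c₁, c₂, A, _, hκ,
    { radius_pos := by positivity
      pos₁ := hc₁
      pos₂ := hc₂
      bound_pos := hK
      tol_nonneg := hκ.le
      mul_norm_le := hΓ
      mul_norm_sq_le := hΩ
      norm_add_norm_le := hstab
      tol_le₁ := (min_le_left _ _).trans (min_le_left _ _)
      tol_le₂ := (min_le_left _ _).trans (min_le_right _ _)
      mul_tol_le := ?_
      mul_radius_le := ?_ }⟩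
  · calc A * _ ≤ A * (1 / (4 * A)) := by gcongr; exact min_le_right _ _
      _ = 1 / 4 := by field_simp
  · calc K * _ ≤ K * (c₁ / (4 * K)) := by gcongr; exact min_le_right _ _
      _ = c₁ / 4 := by field_simp

/-- The operator `u ↦ E[⟪f, u⟫ f]` of the second-moment matrix `E[f f']` of a random vector `f`,
the limit of the operators `u ↦ avg (⟪u, yᵢ⟫ yᵢ)` of a sample. -/
noncomputable def secondMoment {X E : Type*} [MeasurableSpace X] [NormedAddCommGroup E]
    [InnerProductSpace ℝ E] (P : Measure X) (f : X → E) : E →L[ℝ] E :=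
  ∫ z, InnerProductSpace.rankOne ℝ (f z) (f z) ∂P

section SecondMoment

variable {X : Type*} [MeasurableSpace X] {P : Measure X}

section InnerProductSpace

variable {E : Type*} [NormedAddCommGroup E] [InnerProductSpace ℝ E] {f : X → E}

lemma integrable_rankOne_self (hf : MemLp f 2 P) :
    Integrable (fun z => InnerProductSpace.rankOne ℝ (f z) (f z)) P := by
  have hcont : Continuous fun v : E => InnerProductSpace.rankOne ℝ v v :=
    (InnerProductSpace.rankOne ℝ).continuous.clm_apply continuous_id
  refine hf.norm.integrable_sq.mono (hcont.comp_aestronglyMeasurable hf.1) (.of_forall fun z => ?_)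
  rw [InnerProductSpace.norm_rankOne, ← sq, norm_pow, norm_norm]

lemma integrable_inner_smul_self (hf : MemLp f 2 P) (u : E) :
    Integrable (fun z => inner ℝ (f z) u • f z) P :=
  (integrable_rankOne_self hf).apply_continuousLinearMap u

lemma secondMoment_apply (hf : MemLp f 2 P) (u : E) :
    secondMoment P f u = ∫ z, inner ℝ (f z) u • f z ∂P := by
  rw [secondMoment, ContinuousLinearMap.integral_apply (integrable_rankOne_self hf)]
  simp only [InnerProductSpace.rankOne_apply]

variable [CompleteSpace E]

lemma inner_secondMoment_apply_self (hf : MemLp f 2 P) (u : E) :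
    inner ℝ (secondMoment P f u) u = ∫ z, inner ℝ (f z) u ^ 2 ∂P := by
  rw [secondMoment_apply hf, real_inner_comm, ← integral_inner (integrable_inner_smul_self hf u)]
  simp only [real_inner_smul_right, real_inner_comm u, sq]

lemma secondMoment_apply_eq_zero_of_inner_le (hf : MemLp f 2 P) {u : E}
    (hu : inner ℝ (secondMoment P f u) u ≤ 0) : secondMoment P f u = 0 := by
  rw [inner_secondMoment_apply_self hf] at hu
  have hae := (integral_eq_zero_iff_of_nonneg (fun z => sq_nonneg _)
    (hf.inner_const u).integrable_sq).1 (hu.antisymm (integral_nonneg fun z => sq_nonneg _))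
  rw [secondMoment_apply hf]
  refine integral_eq_zero_of_ae (hae.mono fun z hz => ?_)
  have hz : inner ℝ (f z) u = 0 := (pow_eq_zero_iff two_ne_zero).1 hz
  simp only [hz, zero_smul, Pi.zero_apply]

end InnerProductSpace

variable {k m : ℕ} {g : X → Vec k → Vec m} {θ : Vec k}

lemma secondMoment_apply_apply_eq_mulVec (hg : MemLp (fun z => g z θ) 2 P) (u : Vec m)
    (a : Fin m) :
    secondMoment P (fun z => g z θ) u a = (momentMatrix P g θ).mulVec (fun b => u b) a := by
  have hcoord := hg.eval_piLp
  rw [secondMoment_apply hg, eval_integral_piLp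
    fun c => (integrable_inner_smul_self hg u).eval_piLp c]
  have hprod : ∀ b, Integrable (fun z => g z θ a * g z θ b * u b) P := fun b =>
    ((hcoord a).integrable_mul (hcoord b)).mul_const _
  simp only [Matrix.mulVec, dotProduct, momentMatrix, Matrix.of_apply, ← integral_mul_const]
  rw [← integral_finsetSum _ fun b _ => hprod b]
  refine integral_congr_ae (.of_forall fun z => ?_)
  simp only [PiLp.smul_apply, PiLp.inner_apply, RCLike.inner_apply, conj_trivial, smul_eq_mul,
    Finset.sum_mul]
  exact Finset.sum_congr rfl fun b _ => by ring

lemma inner_secondMoment_pos (hg : MemLp (fun z => g z θ) 2 P)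
    (hdet : (momentMatrix P g θ).det ≠ 0) {u : Vec m} (hu : u ≠ 0) :
    0 < inner ℝ (secondMoment P (fun z => g z θ) u) u := by
  by_contra! hle
  have hzero := secondMoment_apply_eq_zero_of_inner_le hg hle
  have hmulVec : (momentMatrix P g θ).mulVec (fun b => u b) = 0 := by
    ext a
    rw [← secondMoment_apply_apply_eq_mulVec hg, hzero, PiLp.zero_apply, Pi.zero_apply]
  exact hu (PiLp.ext fun a => congrFun (Matrix.eq_zero_of_mulVec_eq_zero hdet hmulVec) a)

end SecondMoment

section Jacobian

variable {X : Type*} [MeasurableSpace X] {P : Measure X}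

lemma aestronglyMeasurable_of_forall_apply {E F : Type*} [NormedAddCommGroup E] [NormedSpace ℝ E]
    [FiniteDimensional ℝ E] [NormedAddCommGroup F] [NormedSpace ℝ F] {φ : X → E →L[ℝ] F}
    (hφ : ∀ v, AEStronglyMeasurable (fun z => φ z v) P) : AEStronglyMeasurable φ P := by
  let basis := Module.finBasis ℝ E
  let coord i : E →L[ℝ] ℝ := LinearMap.toContinuousLinearMap (basis.coord i)
  have hsum : φ = fun z => ∑ i, ContinuousLinearMap.smulRightL ℝ E F (coord i) (φ z (basis i)) := by
    ext z v
    conv_lhs => rw [← basis.sum_repr v, map_sum]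
    simp [coord]
  rw [hsum]
  exact Finset.aestronglyMeasurable_fun_sum _ fun i _ =>
    (ContinuousLinearMap.smulRightL ℝ E F (coord i)).continuous.comp_aestronglyMeasurable
      (hφ (basis i))

variable {k m : ℕ} {g : X → Vec k → Vec m} {θ : Vec k}

lemma aestronglyMeasurable_jac (hg : Measurable (Function.uncurry g))
    (hdiff : ∀ᵐ z ∂P, DifferentiableAt ℝ (g z) θ) :
    AEStronglyMeasurable (fun z => jac g z θ) P := by
  have happly : ∀ θ, Measurable fun z => g z θ := fun θ =>
    hg.comp (measurable_id.prodMk measurable_const)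
  refine aestronglyMeasurable_of_forall_apply fun v =>
    aestronglyMeasurable_of_tendsto_ae atTop (fun c : ℝ =>
      (((happly (θ + c⁻¹ • v)).sub (happly θ)).const_smul c).aestronglyMeasurable)
      (hdiff.mono fun z hz => hz.hasFDerivAt.lim_real v)

end Jacobian

lemma LocalBound.mono {k m : ℕ} {y : Vec k → Vec m} {θs : Vec k} {ρ ρ' a g b : ℝ}
    (h : LocalBound y θs ρ a g b) (hρ : ρ' ≤ ρ) : LocalBound y θs ρ' a g b where
  contDiffOn := h.contDiffOn.mono (Metric.ball_subset_ball hρ)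
  norm_le θ hθ := h.norm_le θ (Metric.ball_subset_ball hρ hθ)
  norm_fderiv_le θ hθ := h.norm_fderiv_le θ (Metric.ball_subset_ball hρ hθ)
  nonneg := h.nonneg
  norm_fderiv_sub_le θ₁ h₁ θ₂ h₂ := h.norm_fderiv_sub_le θ₁ (Metric.ball_subset_ball hρ h₁) θ₂
    (Metric.ball_subset_ball hρ h₂)

section Envelopes

variable {X : Type*} [MeasurableSpace X] {P : Measure X} {k m : ℕ} {g : X → Vec k → Vec m}

lemma integrable_jac (hg : Measurable (Function.uncurry g)) {θs : Vec k} {ρ : ℝ} (hρ : 0 < ρ)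
    {a l b : X → ℝ} (hlocal : ∀ᵐ z ∂P, LocalBound (g z) θs ρ (a z) (l z) (b z))
    (hl : Integrable l P) : Integrable (fun z => jac g z θs) P :=
  hl.mono' (aestronglyMeasurable_jac hg (hlocal.mono fun _ hz =>
    (hz.hasStrictFDerivAt (Metric.mem_ball_self hρ)).differentiableAt))
    (hlocal.mono fun _ hz => hz.norm_fderiv_le θs (Metric.mem_ball_self hρ))

lemma lintegral_biSup_sq_lt_top [IsFiniteMeasure P] {Y : Type*} {F : X → Y → ℝ≥0∞} {t : Set Y}
    {p : ℝ} (hp : 2 ≤ p) (hfin : ∫⁻ z, ⨆ y ∈ t, F z y ^ p ∂P < ∞) :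
    ∫⁻ z, ⨆ y ∈ t, F z y ^ 2 ∂P < ∞ := by
  have hpow : ∀ c : ℝ≥0∞, c ^ 2 ≤ 1 + c ^ p := fun c => by
    rcases le_total c 1 with hc | hc
    · exact (pow_le_one₀ zero_le hc).trans le_self_add
    · rw [← ENNReal.rpow_ofNat]
      exact (ENNReal.rpow_le_rpow_of_exponent_le hc hp).trans le_add_self
  calc ∫⁻ z, ⨆ y ∈ t, F z y ^ 2 ∂P ≤ ∫⁻ z, (1 + ⨆ y ∈ t, F z y ^ p) ∂P :=
        lintegral_mono fun z => iSup₂_le fun y hy => (hpow _).trans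
          (by gcongr; exact le_iSup₂ (f := fun y (_ : y ∈ t) => F z y ^ p) y hy)
    _ = P Set.univ + ∫⁻ z, ⨆ y ∈ t, F z y ^ p ∂P := by
        rw [lintegral_add_left measurable_const, lintegral_one]
    _ < ∞ := ENNReal.add_lt_top.2 ⟨measure_lt_top _ _, hfin⟩

lemma exists_memLp_norm_le [StandardBorelSpace X] [IsFiniteMeasure P]
    (hg : Measurable (Function.uncurry g)) {Θ : Set (Vec k)} (hΘ : MeasurableSet Θ)
    (hg2 : ∫⁻ z, ⨆ θ ∈ Θ, ‖g z θ‖ₑ ^ 2 ∂P < ∞) :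
    ∃ e : X → ℝ, MemLp e 2 P ∧ ∀ᵐ z ∂P, ∀ θ ∈ Θ, ‖g z θ‖ ≤ e z := by
  have hg2 : ∫⁻ z, ⨆ θ ∈ Θ, ‖g z θ‖ₑ ^ (2 : ℝ) ∂P < ∞ := by simpa only [ENNReal.rpow_ofNat]
  have heLp := memLp_supNormOn hg hΘ two_pos hg2
  rw [ENNReal.ofReal_ofNat] at heLp
  exact ⟨_, heLp, ae_norm_le_supNormOn hg hΘ two_pos hg2⟩

lemma exists_ae_localBound [StandardBorelSpace X] [IsFiniteMeasure P]
    (hg : Measurable (Function.uncurry g)) {N : Set (Vec k)} (hN : IsOpen N)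
    (hdiff : ∀ᵐ z ∂P, ContDiffOn ℝ 1 (g z) N) (hg4 : ∫⁻ z, ⨆ θ ∈ N, ‖g z θ‖ₑ ^ 4 ∂P < ∞)
    (hG2 : ∫⁻ z, ⨆ θ ∈ N, ‖jac g z θ‖ₑ ^ 2 ∂P < ∞) {b : X → ℝ}
    (hLip : ∀ᵐ z ∂P, ∀ θ₁ ∈ N, ∀ θ₂ ∈ N, ‖jac g z θ₁ - jac g z θ₂‖ ≤ b z * ‖θ₁ - θ₂‖)
    {θs : Vec k} {ρ : ℝ} (hball : Metric.ball θs ρ ⊆ N) :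
    ∃ a l : X → ℝ, MemLp a 4 P ∧ MemLp l 2 P ∧
      ∀ᵐ z ∂P, LocalBound (g z) θs ρ (a z) (l z) |b z| := by
  have hg4 : ∫⁻ z, ⨆ θ ∈ N, ‖g z θ‖ₑ ^ (4 : ℝ) ∂P < ∞ := by simpa only [ENNReal.rpow_ofNat]
  have hG2 : ∫⁻ z, ⨆ θ ∈ N, ‖jac g z θ‖ₑ ^ (2 : ℝ) ∂P < ∞ := by simpa only [ENNReal.rpow_ofNat]
  have ha := memLp_supNormOn hg hN.measurableSet four_pos hg4
  obtain ⟨l, -, hl, hle⟩ := exists_memLp_jac_le hg hN hdiff two_pos hG2 Metric.isOpen_ball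
    (convex_ball θs ρ) hball
  rw [ENNReal.ofReal_ofNat] at ha hl
  refine ⟨_, l, ha, hl, ?_⟩
  filter_upwards [hdiff, ae_norm_le_supNormOn hg hN.measurableSet four_pos hg4, hle, hLip]
    with z hz haz hlz hbz
  exact
    { contDiffOn := hz.mono hball
      norm_le := fun θ hθ => haz θ (hball hθ)
      norm_fderiv_le := hlz
      nonneg := abs_nonneg _
      norm_fderiv_sub_le := fun θ₁ h₁ θ₂ h₂ => (hbz θ₁ (hball h₁) θ₂ (hball h₂)).trans
        (by gcongr; exact le_abs_self _) }

lemma integrable_one_add_pow_four_add_sq_add_abs [IsFiniteMeasure P] {a l b : X → ℝ}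
    (ha : MemLp a 4 P) (hl : MemLp l 2 P) (hb : Integrable b P) :
    Integrable (fun z => 1 + a z ^ 4 + l z ^ 2 + |b z|) P := by
  have ha4 : Integrable (fun z => a z ^ 4) P := by
    simpa only [Real.norm_eq_abs, Even.pow_abs (by decide : Even 4)] using
      ha.integrable_norm_pow (p := 4) (by norm_num)
  exact (((integrable_const 1).add ha4).add hl.integrable_sq).add hb.abs

end Envelopes

section Typical

variable {S X : Type*} [MeasurableSpace S] {μ : Measure S} {x : ℕ → S → X} {k m : ℕ}
  {g : X → Vec k → Vec m} {Θ : Set (Vec k)} {θs : Vec k} {ρ c₀ c₁ c₂ A K κ : ℝ}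

lemma natCast_rpow_neg_three_halves (n : ℕ) : (n : ℝ) ^ (-(3 / 2) : ℝ) = (√n)⁻¹ ^ 3 := by
  rw [Real.sqrt_eq_rpow, ← Real.rpow_neg n.cast_nonneg, ← Real.rpow_natCast,
    ← Real.rpow_mul n.cast_nonneg]
  norm_num

lemma isBigOInProbability_sub_of_goodSample {Γ : Vec k →L[ℝ] Vec m} {Ω : Vec m →L[ℝ] Vec m}
    (hcal : Calibration Γ Ω ρ c₁ c₂ A K κ) (hΘ : Metric.ball θs ρ ⊆ Θ) (hc₀ : 0 < c₀)
    {a l b e : X → ℝ}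
    (hgood : HoldsWPA μ fun n s => GoodSample (n := n) (fun θ i => g (x i s) θ) Θ θs Γ Ω ρ c₀ K κ
      (fun i => a (x i s)) (fun i => l (x i s)) (fun i => b (x i s)) (fun i => e (x i s)))
    (havg : IsBigOInProbability μ (fun n s => avg fun i : Fin n => g (x i s) θs)
      fun n => (√n)⁻¹)
    {θEL θETEL : ℕ → S → Vec k}
    (hEL_est : ∀ n, ∀ᵐ s ∂μ, (∃ θ, IsELEstimate g Θ n (fun i => x i s) θ) →
      IsELEstimate g Θ n (fun i => x i s) (θEL n s))
    (hETEL_est : ∀ n, ∀ᵐ s ∂μ, (∃ θ, IsETELEstimate g Θ n (fun i => x i s) θ) →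
      IsETELEstimate g Θ n (fun i => x i s) (θETEL n s)) :
    IsBigOInProbability μ (fun n s => θETEL n s - θEL n s)
      fun n => (n : ℝ) ^ (-(3 / 2) : ℝ) := by
  refine hgood.isBigOInProbability havg fun C => ?_
  obtain ⟨D, hD⟩ := GoodSample.exists_eventually_norm_sub_le hcal hΘ hc₀ (abs_nonneg C)
  refine ⟨D, hD.mono fun n hn => ?_⟩
  filter_upwards [hEL_est n, hETEL_est n] with s hEL hETEL hsample hC
  have hC' : ‖avg fun i : Fin n => g (x i s) θs‖ ≤ |C| * (√n)⁻¹ :=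
    hC.trans (by gcongr; exact le_abs_self C)
  obtain ⟨hexEL, hexETEL, hle⟩ := hn _ _ _ _ _ hsample hC'
  rw [natCast_rpow_neg_three_halves]
  exact hle _ _ (hEL hexEL) (hETEL hexETEL)

variable [MeasurableSpace X] [IsProbabilityMeasure μ] {P : Measure X}

lemma holdsWPA_goodSample (x_indep : Pairwise fun i j => IndepFun (x i) (x j) μ)
    (x_law : ∀ i, HasLaw (x i) P μ) (hκ : 0 < κ) {a l b e : X → ℝ}
    (hlocal : ∀ᵐ z ∂P, LocalBound (g z) θs ρ (a z) (l z) (b z))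
    (hint : Integrable (fun z => 1 + a z ^ 4 + l z ^ 2 + b z) P)
    (hK : ∫ z, (1 + a z ^ 4 + l z ^ 2 + b z) ∂P < K)
    (he : ∀ᵐ z ∂P, ∀ θ ∈ Θ, ‖g z θ‖ ≤ e z) (heLp : MemLp e 2 P) (hKe : ∫ z, e z ^ 2 ∂P < K)
    (hsep : HoldsWPA μ fun n s => ∀ θ ∈ Θ \ Metric.ball θs (ρ / 2),
      c₀ ≤ ‖avg fun i : Fin n => g (x i s) θ‖)
    (hjac : Integrable (fun z => jac g z θs) P) (hgLp : MemLp (fun z => g z θs) 2 P) :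
    HoldsWPA μ fun n s => GoodSample (n := n) (fun θ i => g (x i s) θ) Θ θs (meanJac P g θs)
      (secondMoment P fun z => g z θs) ρ c₀ K κ (fun i => a (x i s)) (fun i => l (x i s))
      (fun i => b (x i s)) (fun i => e (x i s)) := by
  refine ((((holdsWPA_avg_le x_indep x_law hint hK).and
    (holdsWPA_avg_le x_indep x_law heLp.integrable_sq hKe)).and hsep).and
    ((holdsWPA_norm_avg_sub_integral_lt x_indep x_law hjac hκ).and
      (holdsWPA_norm_avg_sub_integral_lt x_indep x_law (integrable_rankOne_self hgLp)
        hκ))).mono (.of_forall fun n => ?_)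
  filter_upwards [ae_forall_sample x_law hlocal, ae_forall_sample x_law he] with s hlocal he
  rintro ⟨⟨⟨havg, havg_sq⟩, hsep⟩, hjac, hvar⟩
  exact
    { localBound := fun i => hlocal i
      avg_le := havg
      norm_le_envelope := fun i => he i
      avg_envelope_sq_le := havg_sq
      le_norm_avg := fun θ hθ hθs => hsep θ ⟨hθ, by rwa [mem_ball_iff_norm, not_lt]⟩
      norm_avg_fderiv_sub_le := hjac.le
      norm_avg_inner_smul_sub_le := fun u => by
        have hle := ContinuousLinearMap.le_of_opNorm_le _ hvar.le u
        rw [sub_apply, avg_apply] at hle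
        simpa only [InnerProductSpace.rankOne_apply, real_inner_comm u, secondMoment] using hle }

lemma exists_holdsWPA_le_norm_avg_of_notMem_ball [StandardBorelSpace X]
    (x_indep : Pairwise fun i j => IndepFun (x i) (x j) μ) (x_law : ∀ i, HasLaw (x i) P μ)
    (hg : Measurable (Function.uncurry g)) (hΘ : IsCompact Θ) {e : X → ℝ} (heint : Integrable e P)
    (he : ∀ᵐ z ∂P, ∀ θ ∈ Θ, ‖g z θ‖ ≤ e z)
    (hcont : ∀ θ ∈ Θ, ∀ᵐ z ∂P, ContinuousWithinAt (g z) Θ θ)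
    (hunique : ∀ θ ∈ Θ, ∫ z, g z θ ∂P = 0 → θ = θs) {r : ℝ} (hr : 0 < r) :
    ∃ c : ℝ, 0 < c ∧ HoldsWPA μ fun n s => ∀ θ ∈ Θ \ Metric.ball θs r,
      c ≤ ‖avg fun i : Fin n => g (x i s) θ‖ :=
  exists_holdsWPA_le_norm_avg_of_isCompact x_indep x_law hg (hΘ.diff Metric.isOpen_ball) heint
    (he.mono fun _ hz θ hθ => hz θ hθ.1)
    (fun θ hθ => (hcont θ hθ.1).mono fun _ hz => hz.mono Set.sdiff_subset)
    (fun θ hθ h0 => hθ.2 (hunique θ hθ.1 h0 ▸ Metric.mem_ball_self hr))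

end Typical

theorem theorem5_general {S X : Type*} [MeasurableSpace S] [MeasurableSpace X]
    [StandardBorelSpace X] {k m : ℕ} (μ : Measure S) [IsProbabilityMeasure μ] (P : Measure X)
    (x : ℕ → S → X) (x_indep : Pairwise fun i j => IndepFun (x i) (x j) μ)
    (x_law : ∀ i, HasLaw (x i) P μ) (g : X → Vec k → Vec m) (hg : Measurable (Function.uncurry g))
    (Θ N : Set (Vec k)) (hΘ : IsCompact Θ) (hN : IsOpen N) (θs : Vec k) (hθsΘ : θs ∈ interior Θ)
    (hθsN : θs ∈ N) (hmean : ∫ z, g z θs ∂P = 0) (hunique : ∀ θ ∈ Θ, ∫ z, g z θ ∂P = 0 → θ = θs)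
    (hcont : ∀ θ ∈ Θ, ∀ᵐ z ∂P, ContinuousWithinAt (g z) Θ θ)
    (hdiff : ∀ᵐ z ∂P, ContDiffOn ℝ 1 (g z) N) (hg2 : ∫⁻ z, ⨆ θ ∈ Θ, ‖g z θ‖ₑ ^ 2 ∂P < ∞)
    (hg4 : ∫⁻ z, ⨆ θ ∈ N, ‖g z θ‖ₑ ^ 4 ∂P < ∞)
    (hG2 : ∫⁻ z, ⨆ θ ∈ N, ‖jac g z θ‖ₑ ^ 2 ∂P < ∞)
    (hdet : (momentMatrix P g θs).det ≠ 0)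
    (hrank : Module.finrank ℝ (LinearMap.range (meanJac P g θs).toLinearMap) = k)
    (b : X → ℝ) (hb : Integrable b P)
    (hLip : ∀ᵐ z ∂P, ∀ θ₁ ∈ N, ∀ θ₂ ∈ N, ‖jac g z θ₁ - jac g z θ₂‖ ≤ b z * ‖θ₁ - θ₂‖)
    (θEL θETEL : ℕ → S → Vec k)
    (hEL_est : ∀ n, ∀ᵐ s ∂μ, (∃ θ, IsELEstimate g Θ n (fun i => x i s) θ) →
      IsELEstimate g Θ n (fun i => x i s) (θEL n s))
    (hETEL_est : ∀ n, ∀ᵐ s ∂μ, (∃ θ, IsETELEstimate g Θ n (fun i => x i s) θ) →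
      IsETELEstimate g Θ n (fun i => x i s) (θETEL n s)) :
    IsBigOInProbability μ (fun n s => θETEL n s - θEL n s)
      fun n => (n : ℝ) ^ (-(3 / 2) : ℝ) := by
  have : IsProbabilityMeasure P := (x_law 0).isProbabilityMeasure_iff.1 inferInstance
  obtain ⟨ρ₀, hρ₀, hball⟩ := Metric.isOpen_iff.1 (hN.inter isOpen_interior) θs ⟨hθsN, hθsΘ⟩
  obtain ⟨e, heLp, he⟩ := exists_memLp_norm_le hg hΘ.measurableSet hg2
  obtain ⟨a, l, ha, hl, hlocal⟩ := exists_ae_localBound hg hN hdiff hg4 hG2 hLip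
    (hball.trans Set.inter_subset_left)
  have hgLp : MemLp (fun z => g z θs) 2 P :=
    heLp.of_le (hg.comp measurable_prodMk_right).aestronglyMeasurable
      (he.mono fun z hz => (hz θs (interior_subset hθsΘ)).trans (le_abs_self _))
  have hint := integrable_one_add_pow_four_add_sq_add_abs ha hl hb
  obtain ⟨K, hK⟩ := exists_gt (max (max (∫ z, e z ^ 2 ∂P)
    (∫ z, (1 + a z ^ 4 + l z ^ 2 + |b z|) ∂P)) 0)
  simp only [max_lt_iff] at hK
  obtain ⟨ρ, hρ, c₁, c₂, A, κ, hκ, hcal⟩ := exists_calibration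
    (injective_of_finrank_range_eq (hrank.trans finrank_euclideanSpace_fin.symm))
    (fun u hu => inner_secondMoment_pos hgLp hdet hu) hρ₀ hK.2
  obtain ⟨c₀, hc₀, hsep⟩ := exists_holdsWPA_le_norm_avg_of_notMem_ball x_indep x_law hg hΘ
    (heLp.integrable one_le_two) he hcont hunique (half_pos hcal.radius_pos)
  have hgood := holdsWPA_goodSample x_indep x_law hκ (hlocal.mono fun z hz => hz.mono hρ) hint
    hK.1.2 he heLp hK.1.1 hsep (integrable_jac hg hρ₀ hlocal (hl.integrable one_le_two)) hgLp
  have hscore := isBigOInProbability_avg x_indep x_law hgLp hmean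
  have hballΘ : Metric.ball θs ρ ⊆ Θ := (Metric.ball_subset_ball hρ).trans
    (hball.trans (Set.inter_subset_right.trans interior_subset))
  exact isBigOInProbability_sub_of_goodSample (b := fun z => |b z|) hcal hballΘ hc₀ hgood hscore
    hEL_est hETEL_est

theorem theorem5 {S X : Type*} [MeasurableSpace S] [MeasurableSpace X] [StandardBorelSpace X]
    {k m : ℕ}
    -- an i.i.d. sequence `x 0, x 1, …` with law `P`
    (μ : Measure S) [IsProbabilityMeasure μ] (P : Measure X) (x : ℕ → S → X)
    (x_indep : iIndepFun x μ) (x_law : ∀ i, HasLaw (x i) P μ)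
    -- the moment function and the regularity conditions
    (g : X → Vec k → Vec m) (Θ N : Set (Vec k)) (θs : Vec k)
    (hreg : Regular P g Θ N θs)
    (hg4 : ∫⁻ z, ⨆ θ ∈ N, ‖g z θ‖ₑ ^ 4 ∂P < ∞)
    (hG2 : ∫⁻ z, ⨆ θ ∈ N, ‖jac g z θ‖ₑ ^ 2 ∂P < ∞)
    (b : X → ℝ) (hb : Integrable b P)
    (hLip : ∀ᵐ z ∂P, ∀ θ₁ ∈ N, ∀ θ₂ ∈ N, ‖jac g z θ₁ - jac g z θ₂‖ ≤ b z * ‖θ₁ - θ₂‖)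
    -- the two estimators, which are only constrained on samples for which they exist
    (θEL θETEL : ℕ → S → Vec k)
    (hEL_est : ∀ n, ∀ᵐ s ∂μ, (∃ θ, IsELEstimate g Θ n (fun i => x i s) θ) →
      IsELEstimate g Θ n (fun i => x i s) (θEL n s))
    (hETEL_est : ∀ n, ∀ᵐ s ∂μ, (∃ θ, IsETELEstimate g Θ n (fun i => x i s) θ) →
      IsETELEstimate g Θ n (fun i => x i s) (θETEL n s)) :
    IsBigOInProbability μ (fun n s => θETEL n s - θEL n s)
      (fun n => (n : ℝ) ^ (-(3 / 2) : ℝ)) := by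
  obtain ⟨δ, hδ, hmom⟩ := hreg.moment_bound
  have : IsProbabilityMeasure P := (x_law 0).isProbabilityMeasure_iff.1 inferInstance
  exact theorem5_general μ P x (fun i j hij => x_indep.indepFun hij) x_law g hreg.measurable Θ N
    hreg.isCompact hreg.isOpen θs hreg.mem_interior hreg.mem_nhd hreg.moment_eq_zero hreg.unique
    hreg.continuous hreg.contDiff (lintegral_biSup_sq_lt_top (by linarith) hmom) hg4 hG2
    hreg.nonsingular hreg.rank_eq b hb hLip θEL θETEL hEL_est hETEL_est
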